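/- Let $d\ge 1$, write $\vec t<\vec s$ for vectors if $t_i<s_i$ for all $i=1,\dots,d$, and let $\mathbb N=\{0,1,\dots\}$. Let $\mu$ be a probability measure on $\{1,2,\dots\}^d$ whose support generates the group $\mathbb Z^d$. Let $\alpha_1,\dots,\alpha_d\in(0,1)$, with $\alpha_1<1/2$ if $d=1$, put $E=\mathrm{diag}(1/\alpha_1,\dots,1/\alpha_d)$, and assume that $\mu$ is in the strict domain of normal attraction of $(E,\nu)$, where $\nu$ is a probability measure on $[0,\infty)^d$ that is full (not carried by an affine hyperplane of $\mathbb R^d$): if $\xi_1,\xi_2,\dots$ are i.i.d. with law $\mu$, then $n^{-E}\sum_{i=1}^n\xi_i\Rightarrow\nu$. Let $(Z_n)_{n\in\mathbb Z^d}$ be i.i.d. with law $\mu$, and let $\mathcal G$ be the random graph with vertex set $\mathbb Z^d$ and directed edges from $n$ to $n-Z_n$, $n\in\mathbb Z^d$. Let $A_n$ be the set of sites that can be reached from $n$ along directed edges (including $n$ itself), and $q_n=\mathbb P(0\in A_n)$. Let $p\in(0,1)$. Number the connected components of $\mathcal G$ (measurably, as a function of $\mathcal G$), let $(\varepsilon_i)$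 be i.i.d. with $\mathbb P(\varepsilon_i=1)=p$ and $\mathbb P(\varepsilon_i=-1)=1-p$, independent of $\mathcal G$, and let $X_j=\varepsilon_i$ if $j\in\mathbb Z^d$ lies in the $i$-th component. For $j\in\mathbb Z^d$ let $$X^*_j=X_j-\mathbb E(X_j\mid\sigma_j),\qquad \sigma_j=\sigma\{X_k: k\in\mathbb Z^d,\ k<j\}.$$ Then $\sum_{k\in\mathbb N^d}q_k^2<\infty$ and $$\sigma_X^2:=\operatorname{Var}(X^*_0)=\frac{\operatorname{Var}(X_0)}{\sum_{k\in\mathbb N^d}q_k^2}.$$ Further, let $c_n=(c_{n,j})_{j\in\mathbb Z^d}$ be a sequence of non-zero elements of $\ell^2(\mathbb Z^d)$ (real-valued) with $$\lim_{n\to\infty}\sup_{j\in\mathbb Z^d}\frac{|c_{n,j}|}{\|c_n\|}=0,$$ where $\|\cdot\|$ is the $\ell^2$ norm. Then for each $n$ the series $\sum_{j\in\mathbb Z^d}c_{n,j}X^*_j$ converges (unconditionally) in $L^2$, and $$\frac1{\|c_n\|}\sum_{j\in\mathbb Z^d}c_{n,j}X^*_j\Rightarrow\mathcal N(0,\sigma_X^2)\qquad\text{as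 }n\to\infty.$$ -/

import Mathlib

open MeasureTheory ProbabilityTheory Filter
open scoped Topology NNReal ENNReal

namespace GraphField

/-- The lattice `ℤ^d`. -/
abbrev Site (d : ℕ) : Type := Fin d → ℤ

/-- A step distribution: a law on `{1,2,…}^d` that is aperiodic, i.e. the additive group generated
by its support is all of `ℤ^d`. -/
structure IsStepLaw {d : ℕ} (μ : Measure (Site d)) : Prop where
  pos : ∀ᵐ z ∂μ, ∀ i, 0 < z i
  aperiodic : AddSubgroup.closure {z : Site d | μ {z} ≠ 0} = ⊤

/-- A measure on `ℝ^d` is full if it is not carried by any affine hyperplane. -/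
def IsFull {d : ℕ} (ν : Measure (Fin d → ℝ)) : Prop :=
  ∀ (a : Fin d → ℝ) (b : ℝ), a ≠ 0 → ¬ ∀ᵐ x ∂ν, ∑ i, a i * x i = b

/-- `μ` is in the strict domain of normal attraction of `(E, ν)`, `E = diag(1/α₁, …, 1/α_d)`:
if `ξ₀, ξ₁, …` are i.i.d. with law `μ` (here: the coordinates under the infinite product measure),
then `n^{-E} (ξ₀ + ⋯ + ξ_{n-1})` converges in distribution to `ν`. -/
def InStrictDomain {d : ℕ} (μ : Measure (Site d)) [IsProbabilityMeasure μ]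
    (α : Fin d → ℝ) (ν : Measure (Fin d → ℝ)) [IsProbabilityMeasure ν] : Prop :=
  TendstoInDistribution
    (fun (n : ℕ) (ξ : ℕ → Site d) (i : Fin d) =>
      (n : ℝ) ^ (-(1 / α i)) * ∑ k ∈ Finset.range n, ((ξ k i : ℤ) : ℝ))
    atTop id (fun _ => Measure.infinitePi (fun _ : ℕ => μ)) ν

/-- The directed edges: every site `a` has exactly one outgoing edge, from `a` to `a - z a`. -/
def Edge {d : ℕ} (z : Site d → Site d) (a b : Site d) : Prop := b = a - z a

/-- The ancestral line of `n`: all sites that can be reached from `n` along directed edges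
(including `n` itself). -/
def ancestralLine {d : ℕ} (z : Site d → Site d) (n : Site d) : Set (Site d) :=
  {k | Relation.ReflTransGen (Edge z) n k}

/-- The underlying undirected graph, whose connected components carry the values of the field. -/
def graph {d : ℕ} (z : Site d → Site d) : SimpleGraph (Site d) := SimpleGraph.fromRel (Edge z)

/-- A (measurable) numbering of the connected components of the graph: `N z j` is the number of the
component of `j`; different components have different numbers. -/
structure IsNumbering {d : ℕ} (N : (Site d → Site d) → Site d → ℕ) : Prop where
  measurable : ∀ j, Measurable fun z => N z j
  eq_iff : ∀ z j k, N z j = N z k ↔ (graph z).Reachable j k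

/-- The randomness of the model: i.i.d. edges `Z` with law `μ`, and, independent of them, i.i.d.
signs `ε` with `P(ε = 1) = p`, `P(ε = -1) = 1 - p`. -/
structure IsEnvironment {d : ℕ} {Ω : Type*} [MeasurableSpace Ω] (P : Measure Ω)
    (μ : Measure (Site d)) (p : ℝ) (Z : Site d → Ω → Site d) (ε : ℕ → Ω → ℝ) : Prop where
  measurable_edge : ∀ n, Measurable (Z n)
  law_edge : ∀ n, P.map (Z n) = μ
  indep_edge : iIndepFun Z P
  measurable_sign : ∀ i, Measurable (ε i)
  law_sign : ∀ i, P.map (ε i) =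
    ENNReal.ofReal p • Measure.dirac 1 + ENNReal.ofReal (1 - p) • Measure.dirac (-1)
  indep_sign : iIndepFun ε P
  indep : IndepFun (fun ω n => Z n ω) (fun ω i => ε i ω) P

/-- `q_n = P(0 ∈ A_n)`. -/
noncomputable def q {d : ℕ} {Ω : Type*} [MeasurableSpace Ω] (P : Measure Ω)
    (Z : Site d → Ω → Site d) (n : Site d) : ℝ :=
  P.real {ω | (0 : Site d) ∈ ancestralLine (fun m => Z m ω) n}

/-- The random field: `X_j` is the sign attached to the component of `j`. -/
def field {d : ℕ} {Ω : Type*} (N : (Site d → Site d) → Site d → ℕ)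
    (Z : Site d → Ω → Site d) (ε : ℕ → Ω → ℝ) (j : Site d) (ω : Ω) : ℝ :=
  ε (N (fun m => Z m ω) j) ω

/-- `σ_j`, the σ-field generated by the `X_k` with `k < j` in every coordinate. -/
abbrev past {d : ℕ} {Ω : Type*} (X : Site d → Ω → ℝ) (j : Site d) : MeasurableSpace Ω :=
  ⨆ (k : Site d) (_ : ∀ i, k i < j i), MeasurableSpace.comap (X k) inferInstance

/-- The innovation `X*_j = X_j - E(X_j | σ_j)`. -/
noncomputable def innovation {d : ℕ} {Ω : Type*} [MeasurableSpace Ω] (P : Measure Ω)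
    (X : Site d → Ω → ℝ) (j : Site d) : Ω → ℝ :=
  X j - P[X j | past X j]

/-- `σ_X² = Var(X_0) / ∑_{k ∈ ℕ^d} q_k²`. -/
noncomputable def sigmaSq {d : ℕ} {Ω : Type*} [MeasurableSpace Ω] (P : Measure Ω)
    (Z : Site d → Ω → Site d) (X : Site d → Ω → ℝ) : ℝ :=
  Var[X 0; P] / ∑' k : Fin d → ℕ, q P Z (fun i => (k i : ℤ)) ^ 2

/-- `T` is the sum in `L²(P)` of the (unconditionally convergent) series `∑_j f_j`. -/
def IsL2Sum {ι Ω : Type*} [MeasurableSpace Ω] (P : Measure Ω) (f : ι → Ω → ℝ) (T : Ω → ℝ) : Prop :=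
  MemLp T 2 P ∧
    Tendsto (fun s : Finset ι => eLpNorm (fun ω => (∑ j ∈ s, f j ω) - T ω) 2 P) atTop (𝓝 0)

end GraphField

/-! Let `g` be the Green function of the walk with step law `μ` and `φ` its characteristic function.
Steps are positive, so a walk visits a site at most once, and `g n` is the probability that the
ancestral line of `n` contains `0`. Square summability. The values of `g` are, after an Abel
regularization, the Fourier coefficients of `1 / (1 - φ)`, so by Parseval it is enough to integrate
`|1 - φ|⁻²` over the torus. The domain of attraction gives `|1 - φ(2πx)| ≥ c |x_i| ^ α_i` for every
`i`, near the origin by operator scaling and compactness, elsewhere by aperiodicity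
(`exists_le_norm_one_sub_latticeCF`). A weighted geometric mean of these bounds dominates `|1 -
φ|⁻²` by a product of integrable powers, because `∑ 1 / (2 α_i) > 1` (`tsum_green_sq_ne_top`).
Innovations. If `j ≠ k` is not strictly above `k`, the ancestral line of `j` never visits `k`. Hence
`Z k` is independent of the field on all such sites (`indepFun_field`), while `X_k = X_{k - Z_k}`.
So `E(X_k | σ_k) = ∫ X_{k-z} dμ(z)`, and the innovation `Y_k` is orthogonal to every bounded
function of the field on all sites that avoid `k`, not only on the past (`integral_innov_smul`).
Variance. Conditioning on one step shows that the probability that the lines of `j` and `k` meet,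
times `∑ g²`, equals `∑_m g(j-m) g(k-m)` (`measure_meet_mul`). On the diagonal the recursion for the
right side has defect one, so the lines of `k` and of `k - z`, averaged over `z`, meet with
probability `1 - 1 / ∑ g²`. This gives `Var Y_k` (`integral_innov_sq`). Central limit theorem, by
McLeish's method. The products `∏ (1 + i a_j Y_j)` have mean one: remove a site with maximal
coordinate sum, which all the others avoid (`integral_prod_one_add`). Since `e^{ix} = (1 + ix)
e^{-x²/2} + O(|x|³)`, it remains to show that `∑ b_j² Y_j²` is close to its mean in `L¹`. For
spread-out weights this follows from the decay of `Cov(Y_0², Y_k²)` (`tendsto_cov_innov_sq`), which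
comes from mixing of the edges and from the vanishing probability that distant lines meet. -/

namespace GraphField

/-! ### Characteristic functions in a domain of operator-stable attraction. -/

/-- The characteristic function of a measure on `ℝ^d`. -/
noncomputable def vcf {d : ℕ} (ν : Measure (Fin d → ℝ)) (θ : Fin d → ℝ) : ℂ :=
  ∫ x, Complex.exp (((∑ i, θ i * x i : ℝ) : ℂ) * Complex.I) ∂ν

/-- The characteristic function of a measure on the lattice. -/
noncomputable def latticeCF {d : ℕ} (μ : Measure (Site d)) (θ : Fin d → ℝ) : ℂ :=
  ∫ z, Complex.exp (((∑ i, θ i * (z i : ℝ) : ℝ) : ℂ) * Complex.I) ∂μ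

lemma norm_vcf_le_one {d : ℕ} (ν : Measure (Fin d → ℝ)) [IsProbabilityMeasure ν] (θ : Fin d → ℝ) :
    ‖vcf ν θ‖ ≤ 1 := by
  refine (norm_integral_le_of_norm_le_const (C := 1) (ae_of_all _ fun x => ?_)).trans (by simp)
  rw [Complex.norm_exp_ofReal_mul_I]

lemma norm_latticeCF_le_one {d : ℕ} (μ : Measure (Site d)) [IsProbabilityMeasure μ]
    (θ : Fin d → ℝ) : ‖latticeCF μ θ‖ ≤ 1 := by
  refine (norm_integral_le_of_norm_le_const (C := 1) (ae_of_all _ fun x => ?_)).trans (by simp)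
  rw [Complex.norm_exp_ofReal_mul_I]

lemma vcf_eq_charFun {d : ℕ} (ν : Measure (Fin d → ℝ)) (θ : Fin d → ℝ) :
    vcf ν θ = charFun (ν.map fun x => ∑ i, θ i * x i) 1 := by
  rw [charFun_apply_real, integral_map (by
    have : Continuous fun x : Fin d → ℝ => ∑ i, θ i * x i := by fun_prop
    exact this.aemeasurable) (by fun_prop)]
  simp [vcf]

lemma integral_exp_sum_infinitePi {d : ℕ} (μ : Measure (Site d)) [IsProbabilityMeasure μ]
    (n : ℕ) (t : Fin d → ℝ) :
    ∫ ξ, Complex.exp (((∑ i, t i * ∑ k ∈ Finset.range n, ((ξ k i : ℤ) : ℝ) : ℝ) : ℂ) * Complex.I)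
      ∂(Measure.infinitePi fun _ : ℕ => μ) = latticeCF μ t ^ n := by
  have hind : iIndepFun (fun (k : Fin n) (ξ : ℕ → Site d) =>
      Complex.exp (((∑ i, t i * ((ξ k i : ℤ) : ℝ) : ℝ) : ℂ) * Complex.I))
      (Measure.infinitePi fun _ : ℕ => μ) := by
    have := iIndepFun_infinitePi (P := fun _ : ℕ => μ) (X := fun _ (z : Site d) =>
      Complex.exp (((∑ i, t i * ((z i : ℤ) : ℝ) : ℝ) : ℂ) * Complex.I)) (fun _ => .of_discrete)
    exact this.precomp Fin.val_injective
  have h1 := hind.integral_fun_prod_eq_prod_integral (fun k => by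
    have : Measurable fun z : Site d =>
      Complex.exp (((∑ i, t i * ((z i : ℤ) : ℝ) : ℝ) : ℂ) * Complex.I) := .of_discrete
    exact (this.comp (measurable_pi_apply (k : ℕ))).aestronglyMeasurable)
  have h2 : ∀ k : ℕ, ∫ ξ, Complex.exp (((∑ i, t i * ((ξ k i : ℤ) : ℝ) : ℝ) : ℂ) * Complex.I)
      ∂(Measure.infinitePi fun _ : ℕ => μ) = latticeCF μ t := fun k => by
    conv_rhs => rw [latticeCF, ← Measure.infinitePi_map_eval (fun _ : ℕ => μ) k]
    rw [integral_map (measurable_pi_apply k).aemeasurable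
      (Measurable.of_discrete).aestronglyMeasurable]
  simp only [h2, Finset.prod_const, Finset.card_univ, Fintype.card_fin] at h1
  rw [← h1]
  congr 1 with ξ
  rw [← Complex.exp_sum, ← Finset.sum_mul]
  congr 2
  rw [← Complex.ofReal_sum]
  congr 1
  simp_rw [Finset.mul_sum]
  rw [Finset.sum_comm, Finset.sum_range]

/-- A Slutsky argument: the normalized sums converge jointly with the deterministic sequence `θ j`.
Moving frequencies and subsequences `n j` are needed for the compactness argument below. -/
lemma tendsto_latticeCF_pow {d : ℕ} {μ : Measure (Site d)} [IsProbabilityMeasure μ]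
    {α : Fin d → ℝ} {ν : Measure (Fin d → ℝ)} [IsProbabilityMeasure ν]
    (h : InStrictDomain μ α ν) {n : ℕ → ℕ} (hn : Tendsto n atTop atTop)
    {θ : ℕ → Fin d → ℝ} {θ₀ : Fin d → ℝ} (hθ : Tendsto θ atTop (𝓝 θ₀)) :
    Tendsto (fun j => latticeCF μ (fun i => (n j : ℝ) ^ (-(1 / α i)) * θ j i) ^ n j) atTop
      (𝓝 (vcf ν θ₀)) := by
  have h' : TendstoInDistribution
      (fun (j : ℕ) (ξ : ℕ → Site d) (i : Fin d) =>
        (n j : ℝ) ^ (-(1 / α i)) * ∑ k ∈ Finset.range (n j), ((ξ k i : ℤ) : ℝ))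
      atTop id (fun _ => Measure.infinitePi (fun _ : ℕ => μ)) ν :=
    ⟨fun j => h.forall_aemeasurable (n j), h.aemeasurable_limit, h.tendsto.comp hn⟩
  have hY : TendstoInMeasure (Measure.infinitePi (fun _ : ℕ => μ))
      (fun j (_ : ℕ → Site d) => θ j) atTop (fun _ => θ₀) :=
    tendstoInMeasure_of_tendsto_ae (fun _ => by fun_prop) (ae_of_all _ fun _ => hθ)
  have hg : Continuous fun p : (Fin d → ℝ) × (Fin d → ℝ) => ∑ i, p.2 i * p.1 i := by fun_prop
  have key := h'.continuous_comp_prodMk_of_tendstoInMeasure_const hg hY (fun _ => by fun_prop)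
  have := (ProbabilityMeasure.tendsto_iff_tendsto_charFun.1 key.tendsto) 1
  simp only [ProbabilityMeasure.coe_mk] at this
  rw [vcf_eq_charFun]
  refine Tendsto.congr (fun j => ?_) this
  rw [charFun_apply_real, integral_map (key.forall_aemeasurable j) (by fun_prop),
    ← integral_exp_sum_infinitePi]
  congr 1 with ξ
  congr 2
  simp only [Complex.ofReal_one, one_mul]
  congr 1
  refine Finset.sum_congr rfl fun i _ => ?_
  ring

/-- Strict operator stability of `ν`, in modulus: a sum of `m * k` steps consists of `m` independent
blocks of `k` steps, and `k` tends to infinity. -/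
lemma norm_vcf_scale {d : ℕ} {μ : Measure (Site d)} [IsProbabilityMeasure μ]
    {α : Fin d → ℝ} {ν : Measure (Fin d → ℝ)} [IsProbabilityMeasure ν]
    (h : InStrictDomain μ α ν) {m : ℕ} (hm : 0 < m) (θ : Fin d → ℝ) :
    ‖vcf ν (fun i => (m : ℝ) ^ (-(1 / α i)) * θ i)‖ ^ m = ‖vcf ν θ‖ := by
  have h1 := tendsto_latticeCF_pow h (n := fun k => m * k)
    (tendsto_id.const_mul_atTop' hm) (tendsto_const_nhds (x := θ))
  have h2 := (tendsto_latticeCF_pow h (n := fun k => k) tendsto_id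
    (tendsto_const_nhds (x := fun i => (m : ℝ) ^ (-(1 / α i)) * θ i))).pow m
  have h3 : (fun j : ℕ => (latticeCF μ (fun i => (j : ℝ) ^ (-(1 / α i)) *
      ((m : ℝ) ^ (-(1 / α i)) * θ i)) ^ j) ^ m) =
      (fun j : ℕ => latticeCF μ (fun i => ((m * j : ℕ) : ℝ) ^ (-(1 / α i)) * θ i) ^ (m * j)) := by
    funext j
    rw [← pow_mul, mul_comm j m]
    congr 2
    funext i
    rw [Nat.cast_mul, Real.mul_rpow (by positivity) (by positivity)]
    ring
  rw [h3] at h2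
  rw [← norm_pow, tendsto_nhds_unique h2 h1]

/-- If the characteristic function has modulus one then the symmetrized law is concentrated on
the lattice `cos = 1`. -/
lemma ae_cos_eq_one_of_norm_vcf_eq_one {d : ℕ} {ν : Measure (Fin d → ℝ)} [IsProbabilityMeasure ν]
    {θ : Fin d → ℝ} (h : ‖vcf ν θ‖ = 1) :
    ∀ᵐ p ∂(ν.prod ν), Real.cos (∑ i, θ i * (p.1 i - p.2 i)) = 1 := by
  have h1 : ∫ p, Complex.exp (((∑ i, θ i * (p.1 i - p.2 i) : ℝ) : ℂ) * Complex.I) ∂(ν.prod ν)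
      = vcf ν θ * (starRingEnd ℂ) (vcf ν θ) := by
    rw [vcf, ← integral_conj, ← integral_prod_mul]
    congr 1 with p
    rw [← Complex.exp_conj, ← Complex.exp_add]
    congr 1
    simp only [map_mul, Complex.conj_ofReal, Complex.conj_I]
    rw [mul_neg, ← sub_eq_add_neg, ← sub_mul, ← Complex.ofReal_sub, ← Finset.sum_sub_distrib]
    simp_rw [mul_sub]
  rw [Complex.mul_conj, Complex.normSq_eq_norm_sq, h] at h1
  have hintegrable : Integrable (fun p : (Fin d → ℝ) × (Fin d → ℝ) =>
      Complex.exp (((∑ i, θ i * (p.1 i - p.2 i) : ℝ) : ℂ) * Complex.I)) (ν.prod ν) :=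
    Integrable.of_bound (by fun_prop) 1 (ae_of_all _ fun x => by
      rw [Complex.norm_exp_ofReal_mul_I])
  have h2 := congrArg Complex.re h1
  have h3 : ∫ p, Real.cos (∑ i, θ i * (p.1 i - p.2 i)) ∂(ν.prod ν) = 1 := by
    have := integral_re hintegrable
    simp only [RCLike.re_to_complex] at this
    rw [h2] at this
    simp only [Complex.exp_ofReal_mul_I_re] at this
    simpa using this
  have hcos : Integrable (fun p : (Fin d → ℝ) × (Fin d → ℝ) =>
      Real.cos (∑ i, θ i * (p.1 i - p.2 i))) (ν.prod ν) :=
    Integrable.of_bound (by fun_prop) 1 (ae_of_all _ fun x => Real.abs_cos_le_one _)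
  have h4 : ∫ p, (1 - Real.cos (∑ i, θ i * (p.1 i - p.2 i))) ∂(ν.prod ν) = 0 := by
    rw [integral_sub (integrable_const _) hcos, h3]; simp
  rw [integral_eq_zero_iff_of_nonneg (fun p => sub_nonneg.2 (Real.cos_le_one _))
    ((integrable_const _).sub hcos)] at h4
  filter_upwards [h4] with p hp
  simp only [Pi.zero_apply] at hp
  linarith

/-- A continuous function with values in `2πℤ` is constant on an interval: otherwise `|h|` would
take the value `min |h 1| 1`, which lies strictly between `0` and `2π`. -/
lemma eq_zero_of_cos_eq_one {h : ℝ → ℝ} (hc : ContinuousOn h (Set.Icc 0 1)) (h0 : h 0 = 0)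
    (hcos : ∀ t ∈ Set.Icc (0 : ℝ) 1, Real.cos (h t) = 1) : h 1 = 0 := by
  by_contra hne
  have habs : ContinuousOn (fun t => |h t|) (Set.Icc 0 1) := hc.abs
  have hpos : 0 < |h 1| := abs_pos.2 hne
  obtain ⟨t, ht, hte⟩ := intermediate_value_Icc zero_le_one habs
    (show min |h 1| 1 ∈ Set.Icc |h 0| |h 1| by
      rw [h0, abs_zero]; exact ⟨by positivity, min_le_left _ _⟩)
  have h1 := hcos t ht
  rw [← Real.cos_abs] at h1
  simp only at hte
  rw [hte, Real.cos_eq_one_iff_of_lt_of_lt] at h1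
  · have : 0 < min |h 1| 1 := by positivity
    linarith
  · have : 0 < min |h 1| 1 := by positivity
    linarith [Real.pi_pos]
  · have : min |h 1| 1 ≤ 1 := min_le_right _ _
    linarith [Real.pi_gt_three]

/-- Modulus one at `θ` spreads along the whole curve `r ↦ r^E θ` by stability. On this curve the
phase of the symmetrized law is continuous, lies in `2πℤ` and starts at `0`, hence vanishes, and `ν`
would sit on a hyperplane. -/
lemma norm_vcf_lt_one {d : ℕ} {μ : Measure (Site d)} [IsProbabilityMeasure μ]
    {α : Fin d → ℝ} (hα : ∀ i, 0 < α i) {ν : Measure (Fin d → ℝ)} [IsProbabilityMeasure ν]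
    (hfull : IsFull ν) (h : InStrictDomain μ α ν) {θ : Fin d → ℝ} (hθ : θ ≠ 0) :
    ‖vcf ν θ‖ < 1 := by
  refine lt_of_le_of_ne (norm_vcf_le_one ν θ) fun h1 => ?_
  -- Scaling down by `b` and then up by `a` preserves modulus one, so it holds along all positive
  -- rational dilations.
  have hscale : ∀ a b : ℕ, 0 < a → 0 < b →
      ‖vcf ν (fun i => ((a : ℝ) / b) ^ (1 / α i) * θ i)‖ = 1 := by
    intro a b ha hb
    have hb' := norm_vcf_scale h hb θ
    rw [h1, pow_eq_one_iff_of_nonneg (norm_nonneg _) hb.ne'] at hb'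
    have ha' := norm_vcf_scale h ha (fun i => ((a : ℝ) / b) ^ (1 / α i) * θ i)
    rw [← ha']
    have : (fun i => (a : ℝ) ^ (-(1 / α i)) * (((a : ℝ) / b) ^ (1 / α i) * θ i)) =
        fun i => (b : ℝ) ^ (-(1 / α i)) * θ i := by
      funext i
      have ha0 : (0 : ℝ) < a := by exact_mod_cast ha
      have hb0 : (0 : ℝ) < b := by exact_mod_cast hb
      rw [Real.div_rpow ha0.le hb0.le, Real.rpow_neg ha0.le, Real.rpow_neg hb0.le]
      have := (Real.rpow_pos_of_pos ha0 (1 / α i)).ne'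
      field_simp
    rw [this, hb', one_pow]
  have hae : ∀ᵐ p ∂(ν.prod ν), ∀ a b : ℕ, 0 < a → 0 < b →
      Real.cos (∑ i, ((a : ℝ) / b) ^ (1 / α i) * θ i * (p.1 i - p.2 i)) = 1 := by
    simp only [ae_all_iff]
    intro a b ha hb
    exact ae_cos_eq_one_of_norm_vcf_eq_one (hscale a b ha hb)
  have hzero : ∀ᵐ p ∂(ν.prod ν), ∑ i, θ i * p.1 i = ∑ i, θ i * p.2 i := by
    filter_upwards [hae] with p hp
    have hcont : Continuous fun t : ℝ => ∑ i, |t| ^ (1 / α i) * θ i * (p.1 i - p.2 i) := by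
      refine continuous_finsetSum _ fun i _ => ?_
      have : Continuous fun t : ℝ => |t| ^ (1 / α i) :=
        continuous_abs.rpow_const fun x => Or.inr (by have := hα i; positivity)
      fun_prop
    -- From rational to real dilations by closedness and density; `|t|` makes the curve continuous
    -- on all of `ℝ`.
    have hall : ∀ t : ℝ, Real.cos (∑ i, |t| ^ (1 / α i) * θ i * (p.1 i - p.2 i)) = 1 := by
      have hcl : IsClosed {t : ℝ | Real.cos (∑ i, |t| ^ (1 / α i) * θ i * (p.1 i - p.2 i)) = 1} :=
        isClosed_eq (Real.continuous_cos.comp hcont) continuous_const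
      have hd : Dense {t : ℝ | Real.cos (∑ i, |t| ^ (1 / α i) * θ i * (p.1 i - p.2 i)) = 1} := by
        refine Rat.denseRange_cast.mono ?_
        rintro _ ⟨r, rfl⟩
        by_cases hr : r = 0
        · subst hr
          simp only [Set.mem_ofPred_eq, Rat.cast_zero, abs_zero]
          rw [Finset.sum_eq_zero, Real.cos_zero]
          intro i _
          rw [Real.zero_rpow (by have := hα i; positivity)]; ring
        · have := hp r.num.natAbs r.den (Int.natAbs_pos.2 (Rat.num_ne_zero.2 hr)) r.den_pos
          have hr' : |(r : ℝ)| = (r.num.natAbs : ℝ) / r.den := by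
            rw [Nat.cast_natAbs, Int.cast_abs, Rat.cast_def, abs_div]
            simp
          simpa [hr'] using this
      intro t
      have := hcl.closure_eq ▸ hd t
      exact this
    have := eq_zero_of_cos_eq_one hcont.continuousOn (by
      rw [abs_zero]
      refine Finset.sum_eq_zero fun i _ => ?_
      rw [Real.zero_rpow (by have := hα i; positivity)]; ring) (fun t _ => hall t)
    simp only [abs_one, Real.one_rpow, one_mul, mul_sub, Finset.sum_sub_distrib] at this
    linarith
  -- Freezing one of the two independent copies leaves a hyperplane that carries `ν`.
  have h2 := Measure.ae_ae_of_ae_prod hzero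
  obtain ⟨y, hy⟩ := h2.exists
  exact hfull θ (∑ i, θ i * y i) hθ (hy.mono fun _ h => h.symm)

/-- Otherwise frequencies `θ j` and indices tending to infinity would have moduli tending to one. A
limit point of the `θ j` is non-zero because of the lower bound on some coordinate, and there `‖vcf
ν θ₀‖ = 1`, which is impossible. -/
lemma exists_norm_latticeCF_pow_le {d : ℕ} {μ : Measure (Site d)} [IsProbabilityMeasure μ]
    {α : Fin d → ℝ} (hα : ∀ i, 0 < α i) {ν : Measure (Fin d → ℝ)} [IsProbabilityMeasure ν]
    (hfull : IsFull ν) (h : InStrictDomain μ α ν) :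
    ∃ η > 0, ∃ n₀ : ℕ, ∀ n ≥ n₀, ∀ θ : Fin d → ℝ, (∀ i, |θ i| ≤ 1) →
      (∃ i, 1 / 2 ≤ |θ i| ^ α i) →
      ‖latticeCF μ (fun i => (n : ℝ) ^ (-(1 / α i)) * θ i)‖ ^ n ≤ 1 - η := by
  by_contra! hcon
  have hcon' : ∀ j : ℕ, ∃ n ≥ j, ∃ θ : Fin d → ℝ, (∀ i, |θ i| ≤ 1) ∧
      (∃ i, 1 / 2 ≤ |θ i| ^ α i) ∧
      1 - 1 / ((j : ℝ) + 1) < ‖latticeCF μ (fun i => (n : ℝ) ^ (-(1 / α i)) * θ i)‖ ^ n :=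
    fun j => hcon _ (by positivity) j
  choose n hn θ hθ1 hθ2 hlt using hcon'
  have hK : IsCompact (Set.pi Set.univ fun _ : Fin d => Set.Icc (-1 : ℝ) 1) :=
    isCompact_univ_pi fun _ => isCompact_Icc
  obtain ⟨θ₀, -, φ, hφ, hlim⟩ := hK.tendsto_subseq (x := θ)
    (fun j i _ => abs_le.1 (hθ1 j i))
  have hclosed : IsClosed {θ : Fin d → ℝ | ∃ i, 1 / 2 ≤ |θ i| ^ α i} := by
    have : {θ : Fin d → ℝ | ∃ i, 1 / 2 ≤ |θ i| ^ α i} =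
        ⋃ i, {θ : Fin d → ℝ | 1 / 2 ≤ |θ i| ^ α i} := by ext; simp
    rw [this]
    refine isClosed_iUnion_of_finite fun i => isClosed_le continuous_const ?_
    exact (continuous_apply i).abs.rpow_const fun _ => Or.inr (hα i).le
  have hmem : ∃ i, 1 / 2 ≤ |θ₀ i| ^ α i :=
    hclosed.mem_of_tendsto hlim (Eventually.of_forall fun j => hθ2 (φ j))
  have hne : θ₀ ≠ 0 := by
    rintro rfl
    obtain ⟨i, hi⟩ := hmem
    simp only [Pi.zero_apply, abs_zero, Real.zero_rpow (hα i).ne'] at hi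
    norm_num at hi
  have ht := (tendsto_latticeCF_pow h (n := n ∘ φ)
    (tendsto_atTop_mono (fun j => (hφ.id_le j).trans (hn (φ j))) tendsto_id) hlim).norm
  have ht2 : Tendsto (fun j : ℕ => 1 - 1 / ((φ j : ℝ) + 1)) atTop (𝓝 (1 - 0)) :=
    tendsto_const_nhds.sub (tendsto_one_div_add_atTop_nhds_zero_nat.comp hφ.tendsto_atTop)
  have := le_of_tendsto_of_tendsto' ht2 ht fun j => by
    rw [norm_pow]; exact (hlt (φ j)).le
  linarith [norm_vcf_lt_one hα hfull h hne]

/-- Each small `t` is dilated by a suitable `n^E` into the compact shell on which the previous bound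
is uniform. -/
lemma exists_le_one_sub_norm_latticeCF {d : ℕ} {μ : Measure (Site d)} [IsProbabilityMeasure μ]
    {α : Fin d → ℝ} (hα : ∀ i, 0 < α i) {ν : Measure (Fin d → ℝ)} [IsProbabilityMeasure ν]
    (hfull : IsFull ν) (h : InStrictDomain μ α ν) :
    ∃ η > 0, ∃ δ > 0, ∀ t : Fin d → ℝ, (∀ i, |t i| ^ α i ≤ δ) →
      ∀ i, η * |t i| ^ α i ≤ 1 - ‖latticeCF μ t‖ := by
  obtain ⟨η, hη, n₀, hn₀⟩ := exists_norm_latticeCF_pow_le hα hfull h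
  refine ⟨η, hη, 1 / ((n₀ : ℝ) + 1), by positivity, fun t ht i => ?_⟩
  obtain ⟨i₀, -, hi₀⟩ := Finset.exists_max_image Finset.univ (fun i => |t i| ^ α i)
    ⟨i, Finset.mem_univ i⟩
  refine le_trans (mul_le_mul_of_nonneg_left (hi₀ i (Finset.mem_univ i)) hη.le) ?_
  set ρ := |t i₀| ^ α i₀ with hρ
  have hρ0 : 0 ≤ ρ := by positivity
  rcases hρ0.eq_or_lt with h0 | hpos
  · rw [← h0, mul_zero]
    linarith [norm_latticeCF_le_one μ t]
  have hρ1 : (n₀ : ℝ) + 1 ≤ 1 / ρ := by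
    rw [le_div_iff₀ hpos, mul_comm, ← le_div_iff₀ (by positivity)]; exact ht i₀
  -- With this `n` the dilated frequency has `max_i |θ_i| ^ α_i = n ρ`, a number in `[1/2, 1]`.
  set n := ⌊1 / ρ⌋₊ with hn
  have hnle : (n : ℝ) ≤ 1 / ρ := Nat.floor_le (by positivity)
  have hnlt : 1 / ρ < n + 1 := Nat.lt_floor_add_one _
  have hn1 : n₀ + 1 ≤ n := Nat.le_floor (by exact_mod_cast hρ1)
  have hn1' : (1 : ℝ) ≤ n := by exact_mod_cast (by omega : 1 ≤ n)
  have hnpos : (0 : ℝ) < n := by linarith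
  have hnρ : n * ρ ≤ 1 := by rwa [le_div_iff₀ hpos] at hnle
  have hnρ2 : 1 / 2 ≤ n * ρ := by
    rw [div_lt_iff₀ hpos] at hnlt
    nlinarith
  have habs : ∀ i, |(n : ℝ) ^ (1 / α i) * t i| ^ α i = n * |t i| ^ α i := fun i => by
    rw [abs_mul, Real.mul_rpow (abs_nonneg _) (abs_nonneg _),
      abs_of_nonneg (by positivity : (0 : ℝ) ≤ (n : ℝ) ^ (1 / α i)), ← Real.rpow_mul hnpos.le,
      one_div_mul_cancel (hα i).ne', Real.rpow_one]
  have key := hn₀ n (by omega) (fun i => (n : ℝ) ^ (1 / α i) * t i) (fun i => by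
      by_contra! hgt
      have h1 := Real.one_lt_rpow hgt (hα i)
      rw [habs i] at h1
      have : (n : ℝ) * |t i| ^ α i ≤ n * ρ :=
        mul_le_mul_of_nonneg_left (hi₀ i (Finset.mem_univ i)) hnpos.le
      linarith) ⟨i₀, by rw [habs i₀]; exact hnρ2⟩
  have hcancel : (fun i => (n : ℝ) ^ (-(1 / α i)) * ((n : ℝ) ^ (1 / α i) * t i)) = t := by
    funext i
    rw [← mul_assoc, ← Real.rpow_add hnpos]; simp
  rw [hcancel] at key
  -- Bernoulli's inequality turns `‖φ‖ ^ n ≤ 1 - η` into `η ≤ n (1 - ‖φ‖)`; multiplying by `ρ` and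
  -- using `n ρ ≤ 1` finishes.
  have hb := one_add_mul_le_pow (a := ‖latticeCF μ t‖ - 1)
    (by linarith [norm_nonneg (latticeCF μ t)]) n
  rw [add_sub_cancel] at hb
  have h5 : η ≤ n * (1 - ‖latticeCF μ t‖) := by nlinarith
  have h6 : 0 ≤ 1 - ‖latticeCF μ t‖ := by linarith [norm_latticeCF_le_one μ t]
  calc η * ρ ≤ n * (1 - ‖latticeCF μ t‖) * ρ := by gcongr
    _ = (n * ρ) * (1 - ‖latticeCF μ t‖) := by ring
    _ ≤ 1 * (1 - ‖latticeCF μ t‖) := by gcongr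
    _ = _ := one_mul _

lemma continuous_latticeCF {d : ℕ} (μ : Measure (Site d)) [IsProbabilityMeasure μ] :
    Continuous (latticeCF μ) := by
  refine continuous_of_dominated (bound := fun _ => 1) (fun t => Measurable.of_discrete.aestronglyMeasurable)
    (fun t => ae_of_all _ fun z => by rw [Complex.norm_exp_ofReal_mul_I]) (integrable_const _)
    (ae_of_all _ fun z => by fun_prop)

/-- Mean one forces the phase `⟨x, z⟩` to be an integer on the support. The `z` with this property
form a subgroup, which is everything by aperiodicity. -/
lemma exists_int_of_latticeCF_eq_one {d : ℕ} {μ : Measure (Site d)} [IsProbabilityMeasure μ]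
    (hap : AddSubgroup.closure {z : Site d | μ {z} ≠ 0} = ⊤) {x : Fin d → ℝ}
    (h : latticeCF μ (fun i => 2 * Real.pi * x i) = 1) (i : Fin d) : ∃ m : ℤ, x i = m := by
  have hintegrable : Integrable (fun z : Site d =>
      Complex.exp (((∑ i, 2 * Real.pi * x i * (z i : ℝ) : ℝ) : ℂ) * Complex.I)) μ :=
    Integrable.of_bound Measurable.of_discrete.aestronglyMeasurable 1 (ae_of_all _ fun z => by
      rw [Complex.norm_exp_ofReal_mul_I])
  have hre : ∫ z : Site d, Real.cos (∑ i, 2 * Real.pi * x i * (z i : ℝ)) ∂μ = 1 := by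
    have := integral_re hintegrable
    simp only [RCLike.re_to_complex, Complex.exp_ofReal_mul_I_re] at this
    rw [this]
    exact (congrArg Complex.re h).trans Complex.one_re
  have hcos : Integrable (fun z : Site d => Real.cos (∑ i, 2 * Real.pi * x i * (z i : ℝ))) μ :=
    Integrable.of_bound Measurable.of_discrete.aestronglyMeasurable 1
      (ae_of_all _ fun z => Real.abs_cos_le_one _)
  have h4 : ∫ z : Site d, (1 - Real.cos (∑ i, 2 * Real.pi * x i * (z i : ℝ))) ∂μ = 0 := by
    rw [integral_sub (integrable_const _) hcos, hre]; simp
  rw [integral_eq_zero_iff_of_nonneg (fun p => sub_nonneg.2 (Real.cos_le_one _))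
    ((integrable_const _).sub hcos)] at h4
  let H : AddSubgroup (Site d) :=
    { carrier := {z | ∃ m : ℤ, ∑ i, x i * (z i : ℝ) = m}
      zero_mem' := ⟨0, by simp⟩
      add_mem' := by
        rintro a b ⟨m, hm⟩ ⟨k, hk⟩
        exact ⟨m + k, by simp [mul_add, Finset.sum_add_distrib, hm, hk]⟩
      neg_mem' := by
        rintro a ⟨m, hm⟩
        exact ⟨-m, by simp [hm]⟩ }
  have hsub : {z : Site d | μ {z} ≠ 0} ⊆ H := by
    intro z hz
    have hz1 : Real.cos (∑ i, 2 * Real.pi * x i * (z i : ℝ)) = 1 := by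
      by_contra hne
      refine hz (measure_mono_null ?_ h4)
      rintro _ rfl
      simp only [Set.mem_compl_iff, Set.mem_ofPred_eq, Pi.zero_apply]
      intro hh
      exact hne (by linarith)
    rw [Real.cos_eq_one_iff] at hz1
    obtain ⟨m, hm⟩ := hz1
    refine ⟨m, ?_⟩
    have : ∑ i, 2 * Real.pi * x i * (z i : ℝ) = (2 * Real.pi) * ∑ i, x i * (z i : ℝ) := by
      rw [Finset.mul_sum]; exact Finset.sum_congr rfl fun i _ => by ring
    rw [this, mul_comm] at hm
    exact (mul_left_cancel₀ Real.two_pi_pos.ne' hm).symm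
  have htop : H = ⊤ := by
    rw [eq_top_iff, ← hap]; exact (AddSubgroup.closure_le H).2 hsub
  have : (Pi.single i 1 : Site d) ∈ H := by rw [htop]; trivial
  obtain ⟨m, hm⟩ := this
  refine ⟨m, ?_⟩
  rw [← hm, Finset.sum_eq_single i (fun j _ hj => by simp [hj]) (by simp)]
  simp

/-- Near the origin this is the scaling bound. On the rest of the cube, a compact set whose only
candidate lattice point `0` has been removed, `1 - φ` has no zero. -/
lemma exists_le_norm_one_sub_latticeCF {d : ℕ} {μ : Measure (Site d)} [IsProbabilityMeasure μ]
    (hap : AddSubgroup.closure {z : Site d | μ {z} ≠ 0} = ⊤)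
    {α : Fin d → ℝ} (hα : ∀ i, 0 < α i) {ν : Measure (Fin d → ℝ)} [IsProbabilityMeasure ν]
    (hfull : IsFull ν) (h : InStrictDomain μ α ν) :
    ∃ c > 0, ∀ x : Fin d → ℝ, (∀ i, |x i| ≤ 1 / 2) →
      ∀ i, c * |x i| ^ α i ≤ ‖1 - latticeCF μ (fun i => 2 * Real.pi * x i)‖ := by
  obtain ⟨η, hη, δ, hδ, hnear⟩ := exists_le_one_sub_norm_latticeCF hα hfull h
  let C : Set (Fin d → ℝ) := (Set.pi Set.univ fun _ => Set.Icc (-(1 / 2)) (1 / 2)) ∩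
    {x | ∃ i, δ ≤ |2 * Real.pi * x i| ^ α i}
  have hclosed : IsClosed {x : Fin d → ℝ | ∃ i, δ ≤ |2 * Real.pi * x i| ^ α i} := by
    have : {x : Fin d → ℝ | ∃ i, δ ≤ |2 * Real.pi * x i| ^ α i} =
        ⋃ i, {x : Fin d → ℝ | δ ≤ |2 * Real.pi * x i| ^ α i} := by ext; simp
    rw [this]
    refine isClosed_iUnion_of_finite fun i => isClosed_le continuous_const ?_
    exact (continuous_const.mul (continuous_apply i)).abs.rpow_const fun _ => Or.inr (hα i).le
  have hC : IsCompact C := (isCompact_univ_pi fun _ => isCompact_Icc).inter_right hclosed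
  have hcont : Continuous fun x : Fin d → ℝ => ‖1 - latticeCF μ (fun i => 2 * Real.pi * x i)‖ :=
    (continuous_const.sub ((continuous_latticeCF μ).comp (by fun_prop))).norm
  have hfar : ∃ m > 0, ∀ x ∈ C, m ≤ ‖1 - latticeCF μ (fun i => 2 * Real.pi * x i)‖ := by
    rcases C.eq_empty_or_nonempty with he | hne
    · exact ⟨1, one_pos, fun x hx => by simp [he] at hx⟩
    · obtain ⟨x₀, hx₀, hmin⟩ := hC.exists_isMinOn hne hcont.continuousOn
      refine ⟨_, ?_, fun x hx => hmin hx⟩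
      refine norm_pos_iff.2 (sub_ne_zero.2 fun h1 => ?_)
      obtain ⟨hx1, i, hi⟩ := hx₀
      obtain ⟨m, hm⟩ := exists_int_of_latticeCF_eq_one hap h1.symm i
      have h2 := hx1 i trivial
      rw [hm] at h2
      have h3 : m = 0 := by
        have h4 : (m : ℝ) < 1 := by linarith [h2.2]
        have h5 : (-1 : ℝ) < m := by linarith [h2.1]
        have h4' : m < 1 := by exact_mod_cast h4
        have h5' : -1 < m := by exact_mod_cast h5
        omega
      rw [hm, h3] at hi
      simp only [Int.cast_zero, mul_zero, abs_zero, Real.zero_rpow (hα i).ne'] at hi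
      linarith
  obtain ⟨m, hm, hfar⟩ := hfar
  refine ⟨min η m, lt_min hη hm, fun x hx i => ?_⟩
  by_cases hxC : ∃ i, δ ≤ |2 * Real.pi * x i| ^ α i
  · refine le_trans ?_ (hfar x ⟨fun i _ => abs_le.1 (hx i), hxC⟩)
    have : |x i| ^ α i ≤ 1 := Real.rpow_le_one (abs_nonneg _) (by linarith [hx i]) (hα i).le
    calc min η m * |x i| ^ α i ≤ m * 1 := by gcongr; exact min_le_right _ _
      _ = m := mul_one m
  · push Not at hxC
    have h1 := hnear (fun i => 2 * Real.pi * x i) (fun i => (hxC i).le) i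
    have h2 : |x i| ^ α i ≤ |2 * Real.pi * x i| ^ α i := by
      refine Real.rpow_le_rpow (abs_nonneg _) ?_ (hα i).le
      rw [abs_mul, abs_of_pos (by positivity : 0 < 2 * Real.pi)]
      nlinarith [abs_nonneg (x i), Real.pi_gt_three]
    calc min η m * |x i| ^ α i ≤ η * |2 * Real.pi * x i| ^ α i := by gcongr; exact min_le_left _ _
      _ ≤ _ := h1
      _ ≤ _ := by
        have := norm_sub_norm_le (1 : ℂ) (latticeCF μ (fun i => 2 * Real.pi * x i))
        simpa using this

/-! ### The random walk, its Green function and Fourier series on the torus. -/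

/-- The `u`-step transition probabilities of the random walk with step law `μ`. -/
noncomputable def walk {d : ℕ} (μ : Measure (Site d)) : ℕ → Site d → ℝ≥0∞
  | 0, n => if n = 0 then 1 else 0
  | u + 1, n => ∑' z, μ {z} * walk μ u (n - z)

/-- The Green function of the random walk with step law `μ`. -/
noncomputable def green {d : ℕ} (μ : Measure (Site d)) (n : Site d) : ℝ≥0∞ := ∑' u, walk μ u n

lemma tsum_measure_singleton {d : ℕ} (μ : Measure (Site d)) [IsProbabilityMeasure μ] :
    ∑' z, μ {z} = 1 := by
  have := lintegral_countable' (μ := μ) (fun _ => 1)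
  simpa using this.symm

lemma walk_le_one {d : ℕ} (μ : Measure (Site d)) [IsProbabilityMeasure μ] (u : ℕ) (n : Site d) :
    walk μ u n ≤ 1 := by
  induction u generalizing n with
  | zero => rw [walk]; split_ifs <;> simp
  | succ u ih =>
    rw [walk, ← tsum_measure_singleton μ]
    exact ENNReal.tsum_le_tsum fun z => mul_le_of_le_one_right' (ih _)

section Fourier

noncomputable local instance : MeasureSpace UnitAddCircle := ⟨AddCircle.haarAddCircle⟩

local instance : IsProbabilityMeasure (volume : Measure UnitAddCircle) :=
  inferInstanceAs (IsProbabilityMeasure AddCircle.haarAddCircle)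

open UnitAddTorus

lemma summable_real_singleton {d : ℕ} (μ : Measure (Site d)) [IsProbabilityMeasure μ] :
    Summable fun z => μ.real {z} := by
  refine ENNReal.summable_toReal ?_
  rw [tsum_measure_singleton]; simp

lemma tsum_real_singleton {d : ℕ} (μ : Measure (Site d)) [IsProbabilityMeasure μ] :
    ∑' z, μ.real {z} = 1 := by
  simp only [measureReal_def]
  rw [← ENNReal.tsum_toReal_eq (fun z => measure_ne_top μ _), tsum_measure_singleton]; simp

/-- The Fourier series of the step law, as a continuous function on the torus. -/
noncomputable def torusCF {d : ℕ} (μ : Measure (Site d)) : C(UnitAddTorus (Fin d), ℂ) :=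
  ∑' z : Site d, (μ.real {z} : ℂ) • mFourier z

lemma summable_torusCF {d : ℕ} (μ : Measure (Site d)) [IsProbabilityMeasure μ] :
    Summable fun z : Site d => (μ.real {z} : ℂ) • mFourier z := by
  refine Summable.of_norm ?_
  simpa [norm_smul, mFourier_norm, abs_of_nonneg measureReal_nonneg] using
      summable_real_singleton μ

lemma norm_torusCF_le {d : ℕ} (μ : Measure (Site d)) [IsProbabilityMeasure μ] :
    ‖torusCF μ‖ ≤ 1 := by
  have h : Summable fun z : Site d => ‖(μ.real {z} : ℂ) • mFourier z‖ := by
    simpa [norm_smul, mFourier_norm, abs_of_nonneg measureReal_nonneg] using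
      summable_real_singleton μ
  refine (norm_tsum_le_tsum_norm h).trans ?_
  refine le_of_eq (Eq.trans (tsum_congr fun z => ?_) (tsum_real_singleton μ))
  simp [norm_smul, mFourier_norm, abs_of_nonneg measureReal_nonneg]

lemma torusCF_coe {d : ℕ} (μ : Measure (Site d)) [IsProbabilityMeasure μ] (x : Fin d → ℝ) :
    torusCF μ (fun i => (x i : UnitAddCircle)) = latticeCF μ (fun i => 2 * Real.pi * x i) := by
  have h1 := (summable_torusCF μ).hasSum.mapL
    (ContinuousMap.evalCLM ℂ (fun i => (x i : UnitAddCircle)))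
  have hintegrable : Integrable (fun z : Site d =>
      Complex.exp (((∑ i, 2 * Real.pi * x i * (z i : ℝ) : ℝ) : ℂ) * Complex.I)) μ :=
    Integrable.of_bound Measurable.of_discrete.aestronglyMeasurable 1 (ae_of_all _ fun z => by
      rw [Complex.norm_exp_ofReal_mul_I])
  rw [latticeCF, integral_countable hintegrable]
  refine h1.tsum_eq.symm.trans (tsum_congr fun z => ?_)
  rw [map_smul, ContinuousMap.evalCLM_apply]
  simp only [mFourier, ContinuousMap.coe_mk, fourier_coe_apply]
  rw [← Complex.exp_sum, Complex.real_smul, smul_eq_mul, Complex.ofReal_sum, Finset.sum_mul]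
  congr 2
  refine Finset.sum_congr rfl fun i _ => ?_
  push_cast
  ring

/-- The `n`-th Fourier coefficient as a continuous linear functional. -/
noncomputable def coeffCLM {d : ℕ} (n : Site d) : C(UnitAddTorus (Fin d), ℂ) →L[ℂ] ℂ :=
  (innerSL ℂ (mFourierBasis n)).comp (ContinuousMap.toLp 2 volume ℂ)

lemma coeffCLM_apply {d : ℕ} (n : Site d) (f : C(UnitAddTorus (Fin d), ℂ)) :
    coeffCLM n f = mFourierCoeff f n := by
  rw [← mFourierCoeff_toLp, ← mFourierBasis_repr, HilbertBasis.repr_apply_apply]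
  rfl

lemma coeffCLM_mFourier_mul {d : ℕ} (n z : Site d) (f : C(UnitAddTorus (Fin d), ℂ)) :
    coeffCLM n (mFourier z * f) = coeffCLM (n - z) f := by
  rw [coeffCLM_apply, coeffCLM_apply, mFourierCoeff, mFourierCoeff]
  congr 1 with t
  rw [ContinuousMap.mul_apply, smul_eq_mul, smul_eq_mul, ← mul_assoc, ← mFourier_add]
  congr 3
  abel

lemma coeffCLM_torusCF_mul {d : ℕ} (μ : Measure (Site d)) [IsProbabilityMeasure μ] (n : Site d)
    (f : C(UnitAddTorus (Fin d), ℂ)) :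
    coeffCLM n (torusCF μ * f) = ∑' z, (μ.real {z} : ℂ) * coeffCLM (n - z) f := by
  have h := ((summable_torusCF μ).hasSum.mul_right f).mapL (coeffCLM n)
  rw [torusCF, ← h.tsum_eq]
  refine tsum_congr fun z => ?_
  rw [smul_mul_assoc, map_smul, coeffCLM_mFourier_mul, smul_eq_mul]

/-- Multiplication by the Fourier series of `μ` is convolution with `μ` on the side of the
coefficients. -/
lemma coeffCLM_torusCF_pow {d : ℕ} (μ : Measure (Site d)) [IsProbabilityMeasure μ] (u : ℕ)
    (n : Site d) : coeffCLM n (torusCF μ ^ u) = ((walk μ u n).toReal : ℂ) := by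
  induction u generalizing n with
  | zero =>
    rw [pow_zero, ← mFourier_zero, coeffCLM]
    simp only [ContinuousLinearMap.comp_apply, innerSL_apply_apply]
    have := orthonormal_iff_ite.1 (orthonormal_mFourier (d := Fin d)) n 0
    rw [coe_mFourierBasis]
    refine this.trans ?_
    rw [walk]; split_ifs <;> simp
  | succ u ih =>
    rw [pow_succ', coeffCLM_torusCF_mul, walk, ENNReal.tsum_toReal_eq, Complex.ofReal_tsum]
    · refine tsum_congr fun z => ?_
      rw [ih, ENNReal.toReal_mul, Complex.ofReal_mul, measureReal_def]
    · intro z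
      exact ENNReal.mul_ne_top (measure_ne_top _ _) (ne_top_of_le_ne_top (by simp) (walk_le_one μ u _))

/-- The resolvent of the walk, as a continuous function on the torus. -/
noncomputable def resolvent {d : ℕ} (μ : Measure (Site d)) (r : ℝ) :
    C(UnitAddTorus (Fin d), ℂ) := ∑' u : ℕ, ((r : ℂ) • torusCF μ) ^ u

lemma norm_smul_torusCF_lt {d : ℕ} (μ : Measure (Site d)) [IsProbabilityMeasure μ] {r : ℝ}
    (hr0 : 0 ≤ r) (hr1 : r < 1) : ‖(r : ℂ) • torusCF μ‖ < 1 := by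
  rw [norm_smul, Complex.norm_real, Real.norm_of_nonneg hr0]
  calc r * ‖torusCF μ‖ ≤ r * 1 := by gcongr; exact norm_torusCF_le μ
    _ < 1 := by linarith

lemma hasSum_coeffCLM_resolvent {d : ℕ} (μ : Measure (Site d)) [IsProbabilityMeasure μ] {r : ℝ}
    (hr0 : 0 ≤ r) (hr1 : r < 1) (n : Site d) :
    HasSum (fun u : ℕ => ((r ^ u * (walk μ u n).toReal : ℝ) : ℂ)) (coeffCLM n (resolvent μ r)) := by
  have h := (summable_geometric_of_norm_lt_one (norm_smul_torusCF_lt μ hr0 hr1)).hasSum.mapL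
    (coeffCLM n)
  refine h.congr_fun fun u => ?_
  rw [smul_pow, map_smul, coeffCLM_torusCF_pow]
  push_cast
  rfl

/-- The bound does not depend on `r`: since `1 - r ≤ |1 - r φ|`, one has `|1 - φ| ≤ |1 - r φ| + (1 -
r) ≤ 2 |1 - r φ|`. -/
lemma norm_resolvent_le {d : ℕ} (μ : Measure (Site d)) [IsProbabilityMeasure μ] {r : ℝ}
    (hr0 : 0 ≤ r) (hr1 : r < 1) (x : UnitAddTorus (Fin d)) :
    ‖resolvent μ r x‖ * ‖1 - torusCF μ x‖ ≤ 2 := by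
  have h := congrArg (fun f : C(UnitAddTorus (Fin d), ℂ) => f x)
    (geom_series_mul_neg _ (norm_smul_torusCF_lt μ hr0 hr1))
  have h1 : resolvent μ r x * (1 - r * torusCF μ x) = 1 := h
  have hφ : ‖torusCF μ x‖ ≤ 1 := (ContinuousMap.norm_coe_le_norm _ x).trans (norm_torusCF_le μ)
  have h2 : ‖resolvent μ r x‖ * ‖1 - r * torusCF μ x‖ = 1 := by rw [← norm_mul, h1, norm_one]
  have h3 : 1 - r ≤ ‖1 - r * torusCF μ x‖ := by
    have := norm_sub_norm_le (1 : ℂ) (r * torusCF μ x)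
    rw [norm_one, norm_mul, Complex.norm_real, Real.norm_of_nonneg hr0] at this
    nlinarith
  have h4 : ‖1 - torusCF μ x‖ ≤ ‖1 - r * torusCF μ x‖ + (1 - r) := by
    have : 1 - torusCF μ x = (1 - r * torusCF μ x) - (1 - r) * torusCF μ x := by ring
    rw [this]
    refine (norm_sub_le _ _).trans ?_
    gcongr
    rw [norm_mul]
    have : ‖(1 - r : ℂ)‖ = 1 - r := by
      rw [← Complex.ofReal_one, ← Complex.ofReal_sub, Complex.norm_real,
        Real.norm_of_nonneg (by linarith)]
    rw [this]
    exact mul_le_of_le_one_right (by linarith) hφ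
  calc ‖resolvent μ r x‖ * ‖1 - torusCF μ x‖
      ≤ ‖resolvent μ r x‖ * (2 * ‖1 - r * torusCF μ x‖) := by gcongr; linarith
    _ = 2 * (‖resolvent μ r x‖ * ‖1 - r * torusCF μ x‖) := by ring
    _ = 2 := by rw [h2, mul_one]

lemma hasSum_sq_coeffCLM {d : ℕ} (f : C(UnitAddTorus (Fin d), ℂ)) :
    HasSum (fun n => ‖coeffCLM n f‖ ^ 2)
      (∫ x in {x : Fin d → ℝ | ∀ i, x i ∈ Set.Ioc (-(1 / 2) : ℝ) (-(1 / 2) + 1)},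
        ‖f (fun i => (x i : UnitAddCircle))‖ ^ 2) := by
  have h := hasSum_sq_mFourierCoeff (f.toLp 2 volume ℂ)
  simp only [mFourierCoeff_toLp, ← coeffCLM_apply] at h
  convert h using 1
  rw [← integral_preimage (fun x => ‖f x‖ ^ 2) (fun _ => -(1 / 2))]
  refine integral_congr_ae ?_
  filter_upwards [ContinuousMap.coeFn_toLp (p := 2) (𝕜 := ℂ) volume f] with x hx
  rw [hx]

end Fourier

/-! ### Square summability of the Green function. -/

lemma integrable_abs_rpow {β : ℝ} (hβ : β < 1) :
    Integrable (fun x : ℝ => |x| ^ (-β)) (volume.restrict (Set.Ioc (-(1 / 2) : ℝ) (-(1 / 2) + 1))) := by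
  have h1 : IntervalIntegrable (fun x : ℝ => |x| ^ (-β)) volume 0 (1 / 2) := by
    refine (intervalIntegral.intervalIntegrable_rpow' (by linarith : -1 < -β)).congr ?_
    intro x hx
    rw [Set.uIoc_of_le (by norm_num)] at hx
    simp only
    rw [abs_of_pos hx.1]
  have h2 : IntervalIntegrable (fun x : ℝ => |x| ^ (-β)) volume (-(1 / 2)) 0 := by
    have := (IntervalIntegrable.iff_comp_neg (by simp)).1 h1
    simp only [abs_neg, neg_zero] at this
    exact this.symm
  have := h2.trans h1
  rw [intervalIntegrable_iff_integrableOn_Ioc_of_le (by norm_num)] at this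
  have e : (-(1 / 2) + 1 : ℝ) = 1 / 2 := by norm_num
  rw [e]
  exact this

/-- The Green function is square summable. -/
theorem tsum_green_sq_ne_top {d : ℕ} (hd : 1 ≤ d) {μ : Measure (Site d)} [IsProbabilityMeasure μ]
    (hap : AddSubgroup.closure {z : Site d | μ {z} ≠ 0} = ⊤)
    {α : Fin d → ℝ} (hα : ∀ i, 0 < α i ∧ α i < 1) (hα1 : d = 1 → ∀ i, α i < 1 / 2)
    {ν : Measure (Fin d → ℝ)} [IsProbabilityMeasure ν]
    (hfull : IsFull ν) (h : InStrictDomain μ α ν) :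
    ∑' n, green μ n ^ 2 ≠ ∞ := by
  obtain ⟨c, hc, hlow⟩ := exists_le_norm_one_sub_latticeCF hap (fun i => (hα i).1) hfull h
  set S : ℝ := ∑ i, 1 / (2 * α i) with hS
  -- The only place where the bounds on `α` from above matter: each term exceeds `1/2`, which is
  -- enough for `d ≥ 2`, while for `d = 1` the single term exceeds `1` since `α < 1/2`.
  have hS1 : 1 < S := by
    have hpt : ∀ i, 1 / 2 < 1 / (2 * α i) := fun i => by
      have := hα i
      rw [div_lt_div_iff₀ (by norm_num) (by linarith)]; linarith
    rcases hd.eq_or_lt with h1 | h1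
    · subst h1
      have h2 := hα1 rfl 0
      have h3 := (hα 0).1
      rw [hS, Fin.sum_univ_one, lt_div_iff₀ (by linarith)]; linarith
    · have : ∑ _i : Fin d, (1 / 2 : ℝ) < S :=
        Finset.sum_lt_sum_of_nonempty ⟨⟨0, by omega⟩, Finset.mem_univ _⟩ fun i _ => hpt i
      rw [Finset.sum_const, Finset.card_univ, Fintype.card_fin, nsmul_eq_mul] at this
      have h2 : (2 : ℝ) ≤ d := by exact_mod_cast h1
      linarith
  -- The exponent is chosen so that `∑ β / α_i = 2`; then `β < 1` makes each factor `|x_i| ^ (-β)`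
  -- integrable.
  set β : ℝ := 1 / S with hβ
  have hβ0 : 0 < β := by positivity
  have hβ1 : β < 1 := by rw [hβ, div_lt_one (by linarith)]; exact hS1
  have hintegrable : Integrable (fun x : Fin d → ℝ => ∏ i, |x i| ^ (-β))
      (volume.restrict {x : Fin d → ℝ | ∀ i, x i ∈ Set.Ioc (-(1 / 2) : ℝ) (-(1 / 2) + 1)}) := by
    have hset : {x : Fin d → ℝ | ∀ i, x i ∈ Set.Ioc (-(1 / 2) : ℝ) (-(1 / 2) + 1)} =
        Set.univ.pi fun _ => Set.Ioc (-(1 / 2) : ℝ) (-(1 / 2) + 1) := by ext; simp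
    rw [hset, volume_pi, Measure.restrict_pi_pi]
    exact Integrable.fintype_prod fun i => integrable_abs_rpow hβ1
  have hae : ∀ᵐ x ∂(volume.restrict
      {x : Fin d → ℝ | ∀ i, x i ∈ Set.Ioc (-(1 / 2) : ℝ) (-(1 / 2) + 1)}), ∀ i, x i ≠ 0 := by
    refine ae_restrict_of_ae (ae_all_iff.2 fun i => ?_)
    exact Measure.ae_eval_ne (μ := fun _ : Fin d => (volume : Measure ℝ)) i 0
  set K : ℝ := ∫ x in {x : Fin d → ℝ | ∀ i, x i ∈ Set.Ioc (-(1 / 2) : ℝ) (-(1 / 2) + 1)},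
    4 / c ^ 2 * ∏ i, |x i| ^ (-β) with hK
  have hmeas : MeasurableSet {x : Fin d → ℝ | ∀ i, x i ∈ Set.Ioc (-(1 / 2) : ℝ) (-(1 / 2) + 1)} := by
    have hset : {x : Fin d → ℝ | ∀ i, x i ∈ Set.Ioc (-(1 / 2) : ℝ) (-(1 / 2) + 1)} =
        Set.univ.pi fun _ => Set.Ioc (-(1 / 2) : ℝ) (-(1 / 2) + 1) := by ext; simp
    rw [hset]; exact MeasurableSet.univ_pi fun _ => measurableSet_Ioc
  have hbound : ∀ r : ℝ, 0 ≤ r → r < 1 →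
      ∫ x in {x : Fin d → ℝ | ∀ i, x i ∈ Set.Ioc (-(1 / 2) : ℝ) (-(1 / 2) + 1)},
        ‖resolvent μ r (fun i => (x i : UnitAddCircle))‖ ^ 2 ≤ K := by
    intro r hr0 hr1
    refine integral_mono_of_nonneg (ae_of_all _ fun x => by positivity) (hintegrable.const_mul _) ?_
    filter_upwards [hae, ae_restrict_mem hmeas] with x hx0 hx
    have hx2 : ∀ i, |x i| ≤ 1 / 2 := fun i => by
      have := hx i
      rw [abs_le]; constructor <;> linarith [this.1, this.2]
    have h1 := norm_resolvent_le μ hr0 hr1 (fun i => (x i : UnitAddCircle))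
    rw [torusCF_coe] at h1
    set M := ‖1 - latticeCF μ (fun i => 2 * Real.pi * x i)‖ with hM
    set R := ‖resolvent μ r (fun i => (x i : UnitAddCircle))‖ with hR
    have hl := hlow x hx2
    have hMpos : 0 < M := by
      refine lt_of_lt_of_le ?_ (hl ⟨0, by omega⟩)
      have := abs_pos.2 (hx0 ⟨0, by omega⟩)
      positivity
    -- The bounds `|x_i| ^ α_i ≤ M / c`, raised to the powers `β / α_i` and multiplied, give
    -- exponent `2`.
    have hprod : ∏ i, |x i| ^ β ≤ (M / c) ^ 2 := by
      have e1 : ∀ i, |x i| ^ β ≤ (M / c) ^ (β / α i) := fun i => by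
        have hαi := (hα i).1
        have : |x i| ^ β = (|x i| ^ α i) ^ (β / α i) := by
          rw [← Real.rpow_mul (abs_nonneg _), mul_div_cancel₀ _ hαi.ne']
        rw [this]
        refine Real.rpow_le_rpow (by positivity) ?_ (by positivity)
        rw [le_div_iff₀ hc, mul_comm]; exact hl i
      refine (Finset.prod_le_prod (fun i _ => by positivity) fun i _ => e1 i).trans ?_
      rw [← Real.rpow_sum_of_pos (by positivity)]
      have : ∑ i, β / α i = 2 := by
        have e2 : ∑ i, β / α i = 2 * β * S := by
          rw [hS, Finset.mul_sum]
          refine Finset.sum_congr rfl fun i _ => ?_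
          have hαi := (hα i).1.ne'
          field_simp
        rw [e2, hβ]
        have : S ≠ 0 := by linarith
        field_simp
      rw [this, Real.rpow_two]
    have hpos : 0 < ∏ i, |x i| ^ β := Finset.prod_pos fun i _ => by
      have := abs_pos.2 (hx0 i); positivity
    have hinv : ∏ i, |x i| ^ (-β) = (∏ i, |x i| ^ β)⁻¹ := by
      rw [← Finset.prod_inv_distrib]
      exact Finset.prod_congr rfl fun i _ => Real.rpow_neg (abs_nonneg _) _
    rw [hinv, ← div_eq_mul_inv, le_div_iff₀ hpos]
    calc R ^ 2 * ∏ i, |x i| ^ β ≤ R ^ 2 * (M / c) ^ 2 := by gcongr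
      _ = (R * M) ^ 2 / c ^ 2 := by ring
      _ ≤ 2 ^ 2 / c ^ 2 := by gcongr
      _ = 4 / c ^ 2 := by norm_num
  have hfin : ∀ (s : Finset (Site d)) (l : ℕ),
      ∑ n ∈ s, (∑ u ∈ Finset.range l, (walk μ u n).toReal) ^ 2 ≤ K := by
    intro s l
    -- Bessel's inequality for the resolvent; truncation at `l` only decreases the non-negative
    -- coefficients. The finite sums are polynomials in `r`, so `r → 1` afterwards is harmless.
    have hr : ∀ r : ℝ, 0 ≤ r → r < 1 →
        ∑ n ∈ s, (∑ u ∈ Finset.range l, r ^ u * (walk μ u n).toReal) ^ 2 ≤ K := by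
      intro r hr0 hr1
      have hP := hasSum_sq_coeffCLM (resolvent μ r)
      refine le_trans ?_ ((sum_le_hasSum s (fun n _ => by positivity) hP).trans (hbound r hr0 hr1))
      refine Finset.sum_le_sum fun n _ => ?_
      have hc1 := hasSum_coeffCLM_resolvent μ hr0 hr1 n
      have hc2 := (Complex.hasSum_re hc1)
      simp only [Complex.ofReal_re] at hc2
      have h1 : ∑ u ∈ Finset.range l, r ^ u * (walk μ u n).toReal ≤ (coeffCLM n (resolvent μ r)).re :=
        sum_le_hasSum _ (fun u _ => by positivity) hc2
      have h0 : 0 ≤ ∑ u ∈ Finset.range l, r ^ u * (walk μ u n).toReal :=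
        Finset.sum_nonneg fun u _ => by positivity
      have h2 := Complex.abs_re_le_norm (coeffCLM n (resolvent μ r))
      have h3 := le_abs_self (coeffCLM n (resolvent μ r)).re
      gcongr
      linarith
    have hcont : Continuous fun r : ℝ =>
        ∑ n ∈ s, (∑ u ∈ Finset.range l, r ^ u * (walk μ u n).toReal) ^ 2 := by fun_prop
    have ht := (hcont.tendsto 1).mono_left (nhdsWithin_le_nhds (s := Set.Iio 1))
    have := le_of_tendsto ht (by
      filter_upwards [Ioo_mem_nhdsLT (zero_lt_one (α := ℝ))] with r hr1
      exact hr r hr1.1.le hr1.2)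
    simpa using this
  refine ne_top_of_le_ne_top (ENNReal.ofReal_ne_top (r := K)) ?_
  rw [ENNReal.tsum_eq_iSup_sum]
  refine iSup_le fun s => ?_
  have ht : Tendsto (fun l : ℕ => ∑ n ∈ s, (∑ u ∈ Finset.range l, walk μ u n) ^ 2) atTop
      (𝓝 (∑ n ∈ s, green μ n ^ 2)) := by
    refine tendsto_finsetSum _ fun n _ => ?_
    exact ENNReal.Tendsto.pow (ENNReal.tendsto_nat_tsum _)
  refine le_of_tendsto' ht fun l => ?_
  rw [← ENNReal.ofReal_toReal (a := ∑ n ∈ s, (∑ u ∈ Finset.range l, walk μ u n) ^ 2)]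
  · refine ENNReal.ofReal_le_ofReal ?_
    have hw : ∀ u n, walk μ u n ≠ ∞ := fun u n => ne_top_of_le_ne_top (by simp) (walk_le_one μ u n)
    rw [ENNReal.toReal_sum (fun n _ => by
      exact ENNReal.pow_ne_top (ENNReal.sum_ne_top.2 fun u _ => hw u n))]
    simp only [ENNReal.toReal_pow]
    refine le_trans (le_of_eq ?_) (hfin s l)
    refine Finset.sum_congr rfl fun n _ => ?_
    rw [ENNReal.toReal_sum fun u _ => hw u n]
  · exact ENNReal.sum_ne_top.2 fun n _ => ENNReal.pow_ne_top (ENNReal.sum_ne_top.2 fun u _ =>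
      ne_top_of_le_ne_top (by simp) (walk_le_one μ u n))

/-! ### Ancestral lines: meeting and avoiding. -/

/-- The end point of the edge that leaves `a`. -/
def parent {d : ℕ} (z : Site d → Site d) (a : Site d) : Site d := a - z a

/-- The ancestral lines of `j` and `k` meet. -/
def Meet {d : ℕ} (z : Site d → Site d) (j k : Site d) : Prop :=
  ∃ u v, (parent z)^[u] j = (parent z)^[v] k

/-- The ancestral lines of `j` and `k` meet after at most `n` steps in total. -/
def MeetIn {d : ℕ} (z : Site d → Site d) (n : ℕ) (j k : Site d) : Prop :=
  ∃ u v, u + v ≤ n ∧ (parent z)^[u] j = (parent z)^[v] k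

/-- No path with positive steps leads from `j` down to `k`. -/
def Avoids {d : ℕ} (k j : Site d) : Prop := j ≠ k ∧ ¬ ∀ i, k i < j i

section Paths

variable {d : ℕ} {z : Site d → Site d}

lemma mem_ancestralLine_iff {n k : Site d} :
    k ∈ ancestralLine z n ↔ ∃ u, (parent z)^[u] n = k := by
  constructor
  · intro h
    have h' : Relation.ReflTransGen (Edge z) n k := h
    induction h' with
    | refl => exact ⟨0, rfl⟩
    | tail _ hbc ih =>
      obtain ⟨u, hu⟩ := ih ‹_›
      refine ⟨u + 1, ?_⟩
      rw [Function.iterate_succ_apply', hu]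
      exact hbc.symm
  · rintro ⟨u, rfl⟩
    change Relation.ReflTransGen (Edge z) n _
    induction u with
    | zero => exact .refl
    | succ u ih =>
      rw [Function.iterate_succ_apply']
      exact ih.tail rfl

lemma Meet.symm {j k : Site d} (h : Meet z j k) : Meet z k j := by
  obtain ⟨u, v, h⟩ := h
  exact ⟨v, u, h.symm⟩

lemma meet_comm {j k : Site d} : Meet z j k ↔ Meet z k j := ⟨Meet.symm, Meet.symm⟩

lemma meet_refl (j : Site d) : Meet z j j := ⟨0, 0, rfl⟩

lemma meetIn_comm {n : ℕ} {j k : Site d} : MeetIn z n j k ↔ MeetIn z n k j := by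
  constructor <;> rintro ⟨u, v, h, e⟩ <;> exact ⟨v, u, by omega, e.symm⟩

/-- Every site has one outgoing edge, so two lines through a common site coincide from there on;
continuing each meeting past the other merges all three lines. -/
lemma Meet.trans {i j k : Site d} (h₁ : Meet z i j) (h₂ : Meet z j k) : Meet z i k := by
  obtain ⟨a, b, h₁⟩ := h₁
  obtain ⟨c, e, h₂⟩ := h₂
  refine ⟨c + a, b + e, ?_⟩
  rw [Function.iterate_add_apply, h₁, ← Function.iterate_add_apply, add_comm,
    Function.iterate_add_apply, h₂, ← Function.iterate_add_apply]

lemma meet_parent (j : Site d) : Meet z j (parent z j) := ⟨1, 0, rfl⟩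

/-- Components are merging classes of ancestral lines, since meeting is an equivalence relation that
contains every edge. -/
lemma reachable_iff_meet {j k : Site d} : (graph z).Reachable j k ↔ Meet z j k := by
  constructor
  · rintro ⟨p⟩
    induction p with
    | nil => exact meet_refl _
    | cons h _ ih =>
      refine Meet.trans ?_ ih
      rw [graph, SimpleGraph.fromRel_adj] at h
      rcases h.2 with h | h
      · rw [show _ = parent z _ from h]; exact meet_parent _
      · rw [show _ = parent z _ from h]; exact (meet_parent _).symm
  · have hit : ∀ (u : ℕ) (j : Site d), (graph z).Reachable j ((parent z)^[u] j) := by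
      intro u
      induction u with
      | zero => intro j; exact .refl _
      | succ u ih =>
        intro j
        rw [Function.iterate_succ_apply]
        refine SimpleGraph.Reachable.trans ?_ (ih _)
        by_cases h : j = parent z j
        · rw [← h]
        · refine SimpleGraph.Adj.reachable ?_
          rw [graph, SimpleGraph.fromRel_adj]
          exact ⟨h, Or.inl rfl⟩
    rintro ⟨u, v, h⟩
    exact (hit u j).trans (h ▸ (hit v k).symm)

lemma Avoids.sub {k j x : Site d} (h : Avoids k j) (hx : ∀ i, 0 < x i) : Avoids k (j - x) := by
  refine ⟨fun e => h.2 fun i => ?_, fun e => h.2 fun i => ?_⟩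
  · have := congrFun e i
    simp only [Pi.sub_apply] at this
    linarith [hx i]
  · have := e i
    simp only [Pi.sub_apply] at this
    linarith [hx i]

lemma avoids_self_sub (hd : 1 ≤ d) (k : Site d) {x : Site d} (hx : ∀ i, 0 < x i) :
    Avoids k (k - x) := by
  refine ⟨fun e => ?_, fun e => ?_⟩
  · have := congrFun e ⟨0, hd⟩
    simp only [Pi.sub_apply] at this
    linarith [hx ⟨0, hd⟩]
  · have := e ⟨0, hd⟩
    simp only [Pi.sub_apply] at this
    linarith [hx ⟨0, hd⟩]

/-- Two sites cannot be strictly above each other. So a first-step analysis of a pair can always be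
run at a site that the other line never visits. -/
lemma avoids_or_avoids (hd : 1 ≤ d) {j k : Site d} (h : j ≠ k) : Avoids k j ∨ Avoids j k := by
  by_cases h1 : ∀ i, k i < j i
  · exact Or.inr ⟨h.symm, fun h2 => lt_asymm (h1 ⟨0, hd⟩) (h2 ⟨0, hd⟩)⟩
  · exact Or.inl ⟨h, h1⟩

lemma avoids_iterate (hz : ∀ a i, 0 < z a i) {k j : Site d} (h : Avoids k j) (u : ℕ) :
    Avoids k ((parent z)^[u] j) := by
  induction u generalizing j with
  | zero => exact h
  | succ u ih => rw [Function.iterate_succ_apply]; exact ih (h.sub (hz j))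

/-- The line from `j` never uses the edge that leaves `k`, so the new value `v` may be arbitrary,
even non-positive. -/
lemma iterate_update (hz : ∀ a i, 0 < z a i) {k j : Site d} (h : Avoids k j) (v : Site d) (u : ℕ) :
    (parent (Function.update z k v))^[u] j = (parent z)^[u] j := by
  induction u generalizing j with
  | zero => rfl
  | succ u ih =>
    rw [Function.iterate_succ_apply, Function.iterate_succ_apply]
    have : parent (Function.update z k v) j = parent z j := by
      simp [parent, Function.update_of_ne h.1]
    rw [this]
    exact ih (h.sub (hz j))

lemma iterate_lt (hz : ∀ a i, 0 < z a i) (j : Site d) {u : ℕ} (hu : 0 < u) (i : Fin d) :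
    (parent z)^[u] j i < j i := by
  induction u, hu using Nat.le_induction with
  | base => simp [parent, hz j i]
  | succ u hu ih =>
    rw [Function.iterate_succ_apply']
    refine lt_trans ?_ ih
    simp [parent, hz _ i]

/-- A line visits each site at most once, which turns expected numbers of visits into probabilities.
-/
lemma iterate_injective (hd : 1 ≤ d) (hz : ∀ a i, 0 < z a i) (j : Site d) :
    Function.Injective fun u => (parent z)^[u] j := by
  have : ∀ u v, u < v → (parent z)^[u] j ≠ (parent z)^[v] j := by
    intro u v huv e
    have h1 := iterate_lt hz ((parent z)^[u] j) (Nat.sub_pos_of_lt huv) ⟨0, hd⟩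
    rw [← Function.iterate_add_apply, Nat.sub_add_cancel huv.le, ← e] at h1
    exact lt_irrefl _ h1
  intro u v h
  rcases lt_trichotomy u v with h1 | h1 | h1
  · exact absurd h (this u v h1)
  · exact h1
  · exact absurd h.symm (this v u h1)

/-- The meeting point cannot be `k`, which the line from `j` avoids, so the line from `k` must have
taken at least one step. -/
lemma meetIn_succ_iff (hz : ∀ a i, 0 < z a i) {k j : Site d} (h : Avoids k j) (n : ℕ) :
    MeetIn z (n + 1) j k ↔ MeetIn z n j (k - z k) := by
  constructor
  · rintro ⟨u, v, huv, e⟩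
    cases v with
    | zero => exact absurd e (avoids_iterate hz h u).1
    | succ v => exact ⟨u, v, by omega, by rw [e, Function.iterate_succ_apply]; rfl⟩
  · rintro ⟨u, v, huv, e⟩
    exact ⟨u, v + 1, by omega, by rw [e, Function.iterate_succ_apply]; rfl⟩

lemma meet_iff_exists_meetIn {j k : Site d} : Meet z j k ↔ ∃ n, MeetIn z n j k :=
  ⟨fun ⟨u, v, h⟩ => ⟨u + v, u, v, le_rfl, h⟩, fun ⟨_, u, v, _, h⟩ => ⟨u, v, h⟩⟩

lemma meet_parent_right {j k : Site d} : Meet z j k ↔ Meet z j (k - z k) :=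
  ⟨fun h => h.trans (meet_parent k), fun h => h.trans (meet_parent k).symm⟩

lemma meetIn_update (hz : ∀ a i, 0 < z a i) {k j l : Site d} (hj : Avoids k j) (hl : Avoids k l)
    (v : Site d) (n : ℕ) : MeetIn (Function.update z k v) n j l ↔ MeetIn z n j l := by
  simp only [MeetIn, iterate_update hz hj, iterate_update hz hl]

lemma meet_update (hz : ∀ a i, 0 < z a i) {k j l : Site d} (hj : Avoids k j) (hl : Avoids k l)
    (v : Site d) : Meet (Function.update z k v) j l ↔ Meet z j l := by
  simp only [Meet, iterate_update hz hj, iterate_update hz hl]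

lemma measurable_iterate_parent (u : ℕ) (j : Site d) :
    Measurable fun z : Site d → Site d => (parent z)^[u] j := by
  induction u generalizing j with
  | zero => exact measurable_const
  | succ u ih =>
    have h1 : Measurable fun p : (Site d → Site d) × Site d => (parent p.1)^[u] p.2 :=
      measurable_from_prod_countable_left fun y => ih y
    have h2 : Measurable fun z : Site d → Site d => (z, parent z j) := by
      refine measurable_id.prodMk ?_
      have : Measurable fun x : Site d => j - x := .of_discrete
      exact this.comp (measurable_pi_apply j)
    exact h1.comp h2

lemma measurableSet_iterate_eq (u : ℕ) (j m : Site d) :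
    MeasurableSet {z : Site d → Site d | (parent z)^[u] j = m} :=
  measurable_iterate_parent u j (measurableSet_singleton m)

lemma measurableSet_meet (j k : Site d) : MeasurableSet {z : Site d → Site d | Meet z j k} := by
  have : {z : Site d → Site d | Meet z j k} =
      ⋃ u : ℕ, ⋃ v : ℕ, {z | (parent z)^[u] j = (parent z)^[v] k} := by
    ext; simp [Meet]
  rw [this]
  exact MeasurableSet.iUnion fun u => MeasurableSet.iUnion fun v =>
    measurableSet_eq_fun (measurable_iterate_parent u j) (measurable_iterate_parent v k)

lemma measurableSet_meetIn (n : ℕ) (j k : Site d) :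
    MeasurableSet {z : Site d → Site d | MeetIn z n j k} := by
  have : {z : Site d → Site d | MeetIn z n j k} =
      ⋃ u : ℕ, ⋃ v : ℕ, ⋃ _ : u + v ≤ n, {z | (parent z)^[u] j = (parent z)^[v] k} := by
    ext; simp [MeetIn]
  rw [this]
  exact MeasurableSet.iUnion fun u => MeasurableSet.iUnion fun v => MeasurableSet.iUnion fun _ =>
    measurableSet_eq_fun (measurable_iterate_parent u j) (measurable_iterate_parent v k)

end Paths

/-! ### Recursions for the Green function and for `common`. -/

section Green

variable {d : ℕ} {μ : Measure (Site d)}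

lemma IsStepLaw.pos_of_ne_zero (hμ : IsStepLaw μ) {z : Site d} (hz : μ {z} ≠ 0) (i : Fin d) :
    0 < z i := by
  by_contra hi
  refine hz (measure_mono_null ?_ hμ.pos)
  rintro _ rfl
  exact fun h => hi (h i)

lemma walk_eq_zero (hμ : IsStepLaw μ) (u : ℕ) {n : Site d} (hn : Avoids 0 n) : walk μ u n = 0 := by
  induction u generalizing n with
  | zero => rw [walk, if_neg hn.1]
  | succ u ih =>
    rw [walk, ENNReal.tsum_eq_zero]
    intro z
    by_cases hz : μ {z} = 0
    · rw [hz, zero_mul]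
    · rw [ih (hn.sub (hμ.pos_of_ne_zero hz)), mul_zero]

/-- The Green function of the walk stopped after `l` steps. -/
noncomputable def greenUpTo (μ : Measure (Site d)) (l : ℕ) (n : Site d) : ℝ≥0∞ :=
  ∑ u ∈ Finset.range l, walk μ u n

lemma greenUpTo_succ (l : ℕ) (n : Site d) :
    greenUpTo μ (l + 1) n = (if n = 0 then 1 else 0) + ∑' z, μ {z} * greenUpTo μ l (n - z) := by
  rw [greenUpTo, Finset.sum_range_succ']
  simp only [walk]
  rw [add_comm]
  congr 1
  simp only [greenUpTo, Finset.mul_sum]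
  rw [Summable.tsum_finsetSum fun _ _ => ENNReal.summable]

lemma green_eq (n : Site d) :
    green μ n = (if n = 0 then 1 else 0) + ∑' z, μ {z} * green μ (n - z) := by
  rw [green, tsum_eq_zero_add' ENNReal.summable]
  simp only [walk, green, ← ENNReal.tsum_mul_left]
  rw [ENNReal.tsum_comm]

lemma greenUpTo_le_green (l : ℕ) (n : Site d) : greenUpTo μ l n ≤ green μ n :=
  ENNReal.sum_le_tsum _

lemma tendsto_greenUpTo (n : Site d) :
    Tendsto (fun l => greenUpTo μ l n) atTop (𝓝 (green μ n)) :=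
  ENNReal.tendsto_nat_tsum _

lemma greenUpTo_eq_zero (hμ : IsStepLaw μ) (l : ℕ) {n : Site d} (hn : Avoids 0 n) :
    greenUpTo μ l n = 0 := Finset.sum_eq_zero fun u _ => walk_eq_zero hμ u hn

lemma green_eq_zero (hμ : IsStepLaw μ) {n : Site d} (hn : Avoids 0 n) : green μ n = 0 := by
  rw [green, ENNReal.tsum_eq_zero]; exact fun u => walk_eq_zero hμ u hn

/-- The expected number of common points of independent walks started at `j` and `k`. -/
noncomputable def common (μ : Measure (Site d)) (j k : Site d) : ℝ≥0∞ :=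
  ∑' m, green μ (j - m) * green μ (k - m)

lemma common_self (μ : Measure (Site d)) (j : Site d) : common μ j j = ∑' n, green μ n ^ 2 := by
  rw [common, ← (Equiv.subLeft j).tsum_eq (fun n => green μ n ^ 2)]
  exact tsum_congr fun m => (sq _).symm

lemma common_comm (μ : Measure (Site d)) (j k : Site d) : common μ j k = common μ k j :=
  tsum_congr fun _ => mul_comm _ _

/-- The renewal equation `g = δ_0 + μ * g` in the second factor, with the contribution of `δ_0`
dropped. -/
lemma tsum_common_sub_le (μ : Measure (Site d)) (j k : Site d) :
    ∑' z, μ {z} * common μ j (k - z) ≤ common μ j k := by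
  simp only [common, ← ENNReal.tsum_mul_left]
  rw [ENNReal.tsum_comm]
  refine ENNReal.tsum_le_tsum fun m => ?_
  calc ∑' z, μ {z} * (green μ (j - m) * green μ (k - z - m))
      = green μ (j - m) * ∑' z, μ {z} * green μ (k - m - z) := by
        rw [← ENNReal.tsum_mul_left]
        refine tsum_congr fun z => ?_
        rw [sub_right_comm]; ring
    _ ≤ green μ (j - m) * green μ (k - m) := by
        gcongr
        conv_rhs => rw [green_eq]
        exact le_add_self

/-- On the diagonal the contribution of `δ_0` is `g(0) = 1`, the only common point being `m = k`.
This unit is the source of the factor `1 / ∑ q²` in the innovation variance. -/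
lemma tsum_common_sub (hμ : IsStepLaw μ) (hd : 1 ≤ d) (k : Site d) :
    ∑' z, μ {z} * common μ k (k - z) + 1 = common μ k k := by
  have h0 : green μ (0 : Site d) = 1 := by
    rw [green_eq, if_pos rfl, ENNReal.tsum_eq_zero.2, add_zero]
    intro z
    by_cases hz : μ {z} = 0
    · rw [hz, zero_mul]
    · rw [green_eq_zero hμ (avoids_self_sub hd 0 (hμ.pos_of_ne_zero hz)), mul_zero]
  have h1 : common μ k k = ∑' m, (green μ (k - m) * (if k - m = 0 then 1 else 0) +
      ∑' z, μ {z} * (green μ (k - m) * green μ (k - z - m))) := by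
    rw [common]
    refine tsum_congr fun m => ?_
    conv_lhs => enter [2]; rw [green_eq (k - m)]
    rw [mul_add, ← ENNReal.tsum_mul_left]
    congr 1
    refine tsum_congr fun z => ?_
    rw [sub_right_comm]; ring
  have h2 : ∑' m : Site d, green μ (k - m) * (if k - m = 0 then 1 else 0) = 1 := by
    rw [tsum_eq_single k fun m hm => by
      rw [if_neg (sub_ne_zero.2 hm.symm), mul_zero]]
    simp [h0]
  rw [h1, ENNReal.tsum_add, h2, ENNReal.tsum_comm, add_comm]
  congr 1
  refine tsum_congr fun z => ?_
  rw [ENNReal.tsum_mul_left]; rfl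

end Green

/-! ### First-step analysis and the meeting probability. -/

section Probability

variable {d : ℕ} {μ : Measure (Site d)} {p : ℝ} {Ω : Type*} [MeasurableSpace Ω] {P : Measure Ω}
  {Z : Site d → Ω → Site d} {ε : ℕ → Ω → ℝ}

lemma IsEnvironment.measurable_edges (henv : IsEnvironment P μ p Z ε) :
    Measurable fun ω m => Z m ω := measurable_pi_lambda _ henv.measurable_edge

/-- Once the edge at `k` is overwritten by a constant, the environment is a function of the other
edges only. -/
lemma IsEnvironment.indepFun_update (henv : IsEnvironment P μ p Z ε) (k v : Site d) :
    IndepFun (Z k) (fun ω => Function.update (fun m => Z m ω) k v) P := by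
  have h := indep_iSup_of_disjoint (fun i => (henv.measurable_edge i).comap_le)
    henv.indep_edge.iIndep (S := {k}) (T := {k}ᶜ) disjoint_compl_right
  rw [IndepFun_iff_Indep]
  refine indep_of_indep_of_le_left (indep_of_indep_of_le_right h ?_) ?_
  · rw [← measurable_iff_comap_le]
    refine @measurable_pi_lambda _ _ _ (_) _ _ fun i => ?_
    by_cases hi : i = k
    · subst hi; simp only [Function.update_self]; exact @measurable_const _ _ _ (_) _
    · simp only [Function.update_of_ne hi]
      rw [measurable_iff_comap_le]
      exact le_iSup₂ (f := fun (i : Site d) (_ : i ∈ ({k}ᶜ : Set (Site d))) =>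
        MeasurableSpace.comap (Z i) inferInstance) i hi
  · exact le_iSup₂ (f := fun (i : Site d) (_ : i ∈ ({k} : Set (Site d))) =>
        MeasurableSpace.comap (Z i) inferInstance) k rfl

/-- Decomposition of an event according to the edge that leaves `k`. -/
lemma IsEnvironment.measure_first_step [IsProbabilityMeasure P] (henv : IsEnvironment P μ p Z ε)
    (k v : Site d) (E : Site d → Set (Site d → Site d)) (hE : ∀ x, MeasurableSet (E x))
    {A : Set Ω} {B : Site d → Set Ω} (hA : ∀ ω, ω ∈ A ↔ ω ∈ B (Z k ω))
    (hB : ∀ x, μ {x} ≠ 0 → ∀ ω, ω ∈ B x ↔ Function.update (fun m => Z m ω) k v ∈ E x) :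
    P A = ∑' x, μ {x} * P (B x) := by
  have h1 : P A = ∑' x, P (Z k ⁻¹' {x} ∩ A) := by
    have := measure_iUnion (μ := P.restrict A) (f := fun x => Z k ⁻¹' {x})
      (fun x y hxy => Disjoint.preimage _ (by simpa using hxy))
      (fun x => henv.measurable_edge k (measurableSet_singleton x))
    have hu : ⋃ x, Z k ⁻¹' {x} = Set.univ := by ext; simp
    rw [hu, Measure.restrict_apply_univ] at this
    rw [this]
    exact tsum_congr fun x => Measure.restrict_apply
      (henv.measurable_edge k (measurableSet_singleton x))
  rw [h1]
  refine tsum_congr fun x => ?_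
  have hlaw : P (Z k ⁻¹' {x}) = μ {x} := by
    rw [← henv.law_edge k, Measure.map_apply (henv.measurable_edge k) (measurableSet_singleton x)]
  by_cases hx : μ {x} = 0
  · rw [hx, zero_mul]
    exact measure_mono_null Set.inter_subset_left (hlaw.trans hx)
  -- On `Z k = x` the event `A` depends only on the overwritten environment, which is independent of
  -- `Z k`.
  have e1 : Z k ⁻¹' {x} ∩ A =
      Z k ⁻¹' {x} ∩ (fun ω => Function.update (fun m => Z m ω) k v) ⁻¹' E x := by
    ext ω
    simp only [Set.mem_inter_iff, Set.mem_preimage, Set.mem_singleton_iff]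
    refine and_congr_right fun h => ?_
    rw [hA, h, hB x hx]
  have e2 : B x = (fun ω => Function.update (fun m => Z m ω) k v) ⁻¹' E x := by
    ext ω; exact hB x hx ω
  rw [e1, e2, (henv.indepFun_update k v).measure_inter_preimage_eq_mul _ _
    (measurableSet_singleton x) (hE x), hlaw]

variable [IsProbabilityMeasure P]

lemma IsEnvironment.measure_iterate_eq (henv : IsEnvironment P μ p Z ε) (hμ : IsStepLaw μ)
    (hd : 1 ≤ d) (hpos : ∀ n ω i, 0 < Z n ω i) (u : ℕ) (j m : Site d) :
    P {ω | (parent fun m => Z m ω)^[u] j = m} = walk μ u (j - m) := by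
  induction u generalizing j with
  | zero =>
    simp only [Function.iterate_zero, id, walk, sub_eq_zero]
    split_ifs with h <;> simp [h]
  | succ u ih =>
    rw [henv.measure_first_step j 1 (fun x => {z | (parent z)^[u] (j - x) = m})
      (B := fun x => {ω | (parent fun m => Z m ω)^[u] (j - x) = m})
      (fun x => measurableSet_iterate_eq u _ m), walk]
    · refine tsum_congr fun x => ?_
      rw [ih, sub_right_comm]
    · intro ω; rfl
    · intro x hx ω
      simp only [Set.mem_ofPred_eq]
      rw [iterate_update (fun a i => hpos a ω i) (avoids_self_sub hd j (hμ.pos_of_ne_zero hx))]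

lemma IsEnvironment.q_eq_green (henv : IsEnvironment P μ p Z ε) (hμ : IsStepLaw μ)
    (hd : 1 ≤ d) (hpos : ∀ n ω i, 0 < Z n ω i) (n : Site d) :
    q P Z n = (green μ n).toReal := by
  rw [q, measureReal_def]
  congr 1
  have : {ω | (0 : Site d) ∈ ancestralLine (fun m => Z m ω) n} =
      ⋃ u : ℕ, {ω | (parent fun m => Z m ω)^[u] n = 0} := by
    ext ω; simp [mem_ancestralLine_iff]
  rw [this, measure_iUnion]
  · refine tsum_congr fun u => ?_
    rw [henv.measure_iterate_eq hμ hd hpos, sub_zero]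
  · intro u v huv
    rw [Function.onFun, Set.disjoint_left]
    intro ω h1 h2
    exact huv (iterate_injective hd (fun a i => hpos a ω i) n (h1.trans h2.symm))
  · exact fun u => henv.measurable_edges (measurableSet_iterate_eq u n 0)

lemma IsEnvironment.measure_meetIn_succ (henv : IsEnvironment P μ p Z ε) (hμ : IsStepLaw μ)
    (hd : 1 ≤ d) (hpos : ∀ n ω i, 0 < Z n ω i) (n : ℕ) {j k : Site d} (h : Avoids k j) :
    P {ω | MeetIn (fun m => Z m ω) (n + 1) j k} =
      ∑' x, μ {x} * P {ω | MeetIn (fun m => Z m ω) n j (k - x)} := by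
  refine henv.measure_first_step k 1 (fun x => {z | MeetIn z n j (k - x)})
    (fun x => measurableSet_meetIn n j _) (fun ω => ?_) fun x hx ω => ?_
  · exact meetIn_succ_iff (fun a i => hpos a ω i) h n
  · exact (meetIn_update (fun a i => hpos a ω i) h
      (avoids_self_sub hd k (hμ.pos_of_ne_zero hx)) 1 n).symm

lemma IsEnvironment.measure_meet_step (henv : IsEnvironment P μ p Z ε) (hμ : IsStepLaw μ)
    (hd : 1 ≤ d) (hpos : ∀ n ω i, 0 < Z n ω i) {j k : Site d} (h : Avoids k j) :
    P {ω | Meet (fun m => Z m ω) j k} =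
      ∑' x, μ {x} * P {ω | Meet (fun m => Z m ω) j (k - x)} := by
  refine henv.measure_first_step k 1 (fun x => {z | Meet z j (k - x)})
    (fun x => measurableSet_meet j _) (fun ω => ?_) fun x hx ω => ?_
  · exact meet_parent_right
  · exact (meet_update (fun a i => hpos a ω i) h
      (avoids_self_sub hd k (hμ.pos_of_ne_zero hx)) 1).symm

/-- Upper half of the meeting formula. Truncated meeting probabilities start from the indicator of
the diagonal and obey the first-step recursion, for which `common` is a supersolution off the
diagonal. -/
lemma IsEnvironment.measure_meetIn_mul_le (henv : IsEnvironment P μ p Z ε) (hμ : IsStepLaw μ)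
    (hd : 1 ≤ d) (hpos : ∀ n ω i, 0 < Z n ω i) (n : ℕ) (j k : Site d) :
    P {ω | MeetIn (fun m => Z m ω) n j k} * (∑' n, green μ n ^ 2) ≤ common μ j k := by
  induction n generalizing j k with
  | zero =>
    by_cases hjk : j = k
    · subst hjk
      rw [common_self]
      exact mul_le_of_le_one_left' prob_le_one
    · have : {ω | MeetIn (fun m => Z m ω) 0 j k} = ∅ := by
        ext ω
        simp only [Set.mem_ofPred_eq, Set.mem_empty_iff_false, iff_false]
        rintro ⟨u, v, h, e⟩
        obtain rfl : u = 0 := by omega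
        obtain rfl : v = 0 := by omega
        exact hjk e
      rw [this]; simp
  | succ n ih =>
    by_cases hjk : j = k
    · subst hjk
      rw [common_self]
      exact mul_le_of_le_one_left' prob_le_one
    · have key : ∀ j k, Avoids k j → P {ω | MeetIn (fun m => Z m ω) (n + 1) j k} *
          (∑' n, green μ n ^ 2) ≤ common μ j k := fun j k h => by
        rw [henv.measure_meetIn_succ hμ hd hpos n h, ← ENNReal.tsum_mul_right]
        refine le_trans (ENNReal.tsum_le_tsum fun x => ?_) (tsum_common_sub_le μ j k)
        rw [mul_assoc]
        exact mul_le_mul_right (ih j (k - x)) _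
      rcases avoids_or_avoids hd hjk with h | h
      · exact key j k h
      · have := key k j h
        simp only [meetIn_comm (j := k)] at this
        rwa [common_comm] at this

/-- Lower half. Now the Green functions are truncated instead, separately for the two walks, so that
either walk can take the step and the induction runs on the total `a + b`. -/
lemma IsEnvironment.tsum_greenUpTo_le (henv : IsEnvironment P μ p Z ε) (hμ : IsStepLaw μ)
    (hd : 1 ≤ d) (hpos : ∀ n ω i, 0 < Z n ω i) (n a b : ℕ) (hab : a + b ≤ n) (j k : Site d) :
    ∑' m, greenUpTo μ a (j - m) * greenUpTo μ b (k - m) ≤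
      P {ω | Meet (fun m => Z m ω) j k} * (∑' n, green μ n ^ 2) := by
  induction n generalizing a b j k with
  | zero =>
    obtain rfl : a = 0 := by omega
    simp [greenUpTo]
  | succ n ih =>
    by_cases hjk : j = k
    · subst hjk
      have : {ω | Meet (fun m => Z m ω) j j} = Set.univ := by
        ext ω; simp [meet_refl]
      rw [this, measure_univ, one_mul, ← common_self μ j]
      exact ENNReal.tsum_le_tsum fun m =>
        mul_le_mul' (greenUpTo_le_green _ _) (greenUpTo_le_green _ _)
    · have key : ∀ (a b : ℕ) (j k : Site d), a + b ≤ n + 1 → Avoids k j →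
          ∑' m, greenUpTo μ a (j - m) * greenUpTo μ b (k - m) ≤
            P {ω | Meet (fun m => Z m ω) j k} * (∑' n, green μ n ^ 2) := by
        intro a b j k hab h
        cases b with
        | zero => simp [greenUpTo]
        | succ b =>
          rw [henv.measure_meet_step hμ hd hpos h, ← ENNReal.tsum_mul_right]
          have e1 : ∑' m, greenUpTo μ a (j - m) * greenUpTo μ (b + 1) (k - m) =
              ∑' x, μ {x} * ∑' m, greenUpTo μ a (j - m) * greenUpTo μ b (k - x - m) := by
            simp only [← ENNReal.tsum_mul_left]
            rw [ENNReal.tsum_comm]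
            refine tsum_congr fun m => ?_
            rw [greenUpTo_succ, mul_add]
            -- The `δ_0` part of the renewal equation requires `m = k`, a site that the walk from
            -- `j` cannot hit.
            have e2 : greenUpTo μ a (j - m) * (if k - m = 0 then 1 else 0) = 0 := by
              split_ifs with hm
              · rw [← sub_eq_zero.1 hm, greenUpTo_eq_zero hμ, zero_mul]
                refine ⟨sub_ne_zero.2 h.1, fun h2 => h.2 fun i => ?_⟩
                have := h2 i
                simp only [Pi.zero_apply, Pi.sub_apply] at this
                linarith
              · rw [mul_zero]
            rw [e2, zero_add, ← ENNReal.tsum_mul_left]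
            refine tsum_congr fun x => ?_
            rw [sub_right_comm k x m]; ring
          rw [e1]
          refine ENNReal.tsum_le_tsum fun x => ?_
          rw [mul_assoc]
          exact mul_le_mul_right (ih a b (by omega) j (k - x)) _
      rcases avoids_or_avoids hd hjk with h | h
      · exact key a b j k hab h
      · have := key b a k j (by omega) h
        simp only [meet_comm (j := k)] at this
        simpa only [mul_comm (greenUpTo μ a _)] using this

/-- The probability that two ancestral lines meet. -/
theorem IsEnvironment.measure_meet_mul (henv : IsEnvironment P μ p Z ε) (hμ : IsStepLaw μ)
    (hd : 1 ≤ d) (hpos : ∀ n ω i, 0 < Z n ω i) (j k : Site d) :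
    P {ω | Meet (fun m => Z m ω) j k} * (∑' n, green μ n ^ 2) = common μ j k := by
  refine le_antisymm ?_ ?_
  · have : {ω | Meet (fun m => Z m ω) j k} = ⋃ n, {ω | MeetIn (fun m => Z m ω) n j k} := by
      ext ω; simp [meet_iff_exists_meetIn]
    rw [this, Monotone.measure_iUnion, ENNReal.iSup_mul]
    · exact iSup_le fun n => henv.measure_meetIn_mul_le hμ hd hpos n j k
    · rintro n m hnm ω ⟨u, v, h, e⟩
      exact ⟨u, v, h.trans hnm, e⟩
  · rw [common, ENNReal.tsum_eq_iSup_sum]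
    refine iSup_le fun s => ?_
    -- Finiteness is needed to pass to the limit in products in `ℝ≥0∞`; it holds because the sum is
    -- the probability of a disjoint union.
    have hfin : ∀ n, green μ n ≠ ∞ := fun n => by
      have h0 : green μ n = ∑' u, P {ω | (parent fun m => Z m ω)^[u] n = 0} :=
        tsum_congr fun u => by rw [henv.measure_iterate_eq hμ hd hpos, sub_zero]
      rw [h0, ← measure_iUnion]
      · exact measure_ne_top _ _
      · intro u v huv
        rw [Function.onFun, Set.disjoint_left]
        intro ω h1 h2
        exact huv (iterate_injective hd (fun a i => hpos a ω i) n (h1.trans h2.symm))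
      · exact fun u => henv.measurable_edges (measurableSet_iterate_eq u n 0)
    have ht : Tendsto (fun l => ∑ m ∈ s, greenUpTo μ l (j - m) * greenUpTo μ l (k - m)) atTop
        (𝓝 (∑ m ∈ s, green μ (j - m) * green μ (k - m))) :=
      tendsto_finsetSum _ fun m _ => ENNReal.Tendsto.mul (tendsto_greenUpTo _) (Or.inr (hfin _))
        (tendsto_greenUpTo _) (Or.inr (hfin _))
    refine le_of_tendsto' ht fun l => ?_
    exact (ENNReal.sum_le_tsum s).trans (henv.tsum_greenUpTo_le hμ hd hpos _ l l le_rfl j k)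

end Probability

/-! ### Distant ancestral lines rarely meet. -/

lemma ENNReal_mul_le_add_sq {a b : ℝ≥0∞} (ha : a ≠ ∞) (hb : b ≠ ∞) {c : ℝ≥0} (hc : c ≠ 0) :
    a * b ≤ c * a ^ 2 + (c⁻¹ : ℝ≥0) * b ^ 2 := by
  lift a to ℝ≥0 using ha
  lift b to ℝ≥0 using hb
  norm_cast
  rw [← NNReal.coe_le_coe]
  push_cast
  have hc' : (0 : ℝ) < c := by positivity
  have h1 : (c : ℝ) * (a : ℝ) ^ 2 + (c : ℝ)⁻¹ * (b : ℝ) ^ 2 - a * b =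
      (c : ℝ)⁻¹ * ((c * a - b / 2) ^ 2 + 3 / 4 * (b : ℝ) ^ 2) := by field_simp; ring
  have h2 : 0 ≤ (c : ℝ)⁻¹ * ((c * a - b / 2) ^ 2 + 3 / 4 * (b : ℝ) ^ 2) := by positivity
  linarith

/-- A weighted Cauchy inequality off `F`. The tail around `j` is small for large `F`, and the
uncontrolled sum around `k` carries the factor `c⁻¹`. -/
lemma common_le_of_finset {d : ℕ} {μ : Measure (Site d)} (hfin : ∀ n, green μ n ≠ ∞)
    {c : ℝ≥0} (hc : c ≠ 0) (F : Finset (Site d)) (j k : Site d) :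
    common μ j k ≤ ∑ m ∈ F, green μ (j - m) * green μ (k - m) +
      (c * ∑' m : {m // m ∉ F}, green μ (j - m) ^ 2 + (c⁻¹ : ℝ≥0) * ∑' n, green μ n ^ 2) := by
  have hsplit : common μ j k = ∑ m ∈ F, green μ (j - m) * green μ (k - m) +
      ∑' m : {m // m ∉ F}, green μ (j - m) * green μ (k - m) := by
    rw [common]
    exact (ENNReal.sum_add_tsum_compl F fun m => green μ (j - m) * green μ (k - m)).symm
  rw [hsplit]
  refine add_le_add_right ?_ _
  calc ∑' m : {m // m ∉ F}, green μ (j - m) * green μ (k - m)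
      ≤ ∑' m : {m // m ∉ F}, (c * green μ (j - m) ^ 2 + (c⁻¹ : ℝ≥0) * green μ (k - m) ^ 2) :=
        ENNReal.tsum_le_tsum fun m => ENNReal_mul_le_add_sq (hfin _) (hfin _) hc
    _ = c * ∑' m : {m // m ∉ F}, green μ (j - m) ^ 2 +
        (c⁻¹ : ℝ≥0) * ∑' m : {m // m ∉ F}, green μ (k - m) ^ 2 := by
        rw [ENNReal.tsum_add, ENNReal.tsum_mul_left, ENNReal.tsum_mul_left]
    _ ≤ _ := by
        refine add_le_add_right (mul_le_mul_right ?_ _) _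
        refine (ENNReal.tsum_comp_le_tsum_of_injective
          (Subtype.val_injective (p := fun m => m ∉ F)) (fun m => green μ (k - m) ^ 2)).trans ?_
        exact ((Equiv.subLeft k).tsum_eq (fun n => green μ n ^ 2)).le

theorem tendsto_common_cofinite {d : ℕ} {μ : Measure (Site d)} (h : ∑' n, green μ n ^ 2 ≠ ∞)
    (j : Site d) : Tendsto (fun k => common μ j k) cofinite (𝓝 0) := by
  set g₀ := ∑' n, green μ n ^ 2 with hg₀
  have hfin : ∀ n, green μ n ≠ ∞ := fun n hn => by
    refine ENNReal.ne_top_of_tsum_ne_top h n ?_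
    rw [hn]; simp
  have hgreen : Tendsto (green μ) cofinite (𝓝 0) := by
    have h1 := ENNReal.tendsto_cofinite_zero_of_tsum_ne_top h
    have h2 := (ENNReal.continuous_rpow_const (y := 1 / 2)).tendsto 0 |>.comp h1
    simp only [Function.comp_def] at h2
    rw [ENNReal.zero_rpow_of_pos (by norm_num)] at h2
    refine h2.congr fun n => ?_
    rw [← ENNReal.rpow_natCast, ← ENNReal.rpow_mul]
    norm_num
  rw [ENNReal.tendsto_nhds_zero]
  intro e he
  have he3 : e / 3 ≠ 0 := by simp [he.ne']
  -- Order of choices: a large `c` for the sum around `k`, then `F` for the tail around `j`, then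
  -- `k` far away for the finitely many remaining terms.
  obtain ⟨c, hc0, hc⟩ : ∃ c : ℝ≥0, c ≠ 0 ∧ ((c⁻¹ : ℝ≥0) : ℝ≥0∞) * g₀ ≤ e / 3 := by
    obtain ⟨c, hc, hlt⟩ := ENNReal.exists_nnreal_pos_mul_lt h he3
    exact ⟨c⁻¹, inv_ne_zero hc.ne', by rw [inv_inv]; exact hlt.le⟩
  have hsum : ∑' m, green μ (j - m) ^ 2 = g₀ :=
    (Equiv.subLeft j).tsum_eq (fun n => green μ n ^ 2)
  have htail : Tendsto (fun F : Finset (Site d) =>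
      (c : ℝ≥0∞) * ∑' m : {m // m ∉ F}, green μ (j - m) ^ 2) atTop (𝓝 0) := by
    have := ENNReal.Tendsto.const_mul (a := (c : ℝ≥0∞))
      (ENNReal.tendsto_tsum_compl_atTop_zero (f := fun m => green μ (j - m) ^ 2)
        (by rw [hsum]; exact h)) (Or.inr ENNReal.coe_ne_top)
    simpa using this
  obtain ⟨F, hF⟩ := ((ENNReal.tendsto_nhds_zero.1 htail) (e / 3) (pos_iff_ne_zero.2 he3)).exists
  have hmain : Tendsto (fun k => ∑ m ∈ F, green μ (j - m) * green μ (k - m)) cofinite (𝓝 0) := by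
    rw [← Finset.sum_const_zero (s := F)]
    refine tendsto_finsetSum _ fun m _ => ?_
    have h1 : Tendsto (fun k => green μ (k - m)) cofinite (𝓝 0) :=
      hgreen.comp (sub_left_injective (b := m)).tendsto_cofinite
    have := ENNReal.Tendsto.const_mul (a := green μ (j - m)) h1 (Or.inr (hfin _))
    simpa using this
  filter_upwards [(ENNReal.tendsto_nhds_zero.1 hmain) (e / 3) (pos_iff_ne_zero.2 he3)] with k hk
  refine (common_le_of_finset hfin hc0 F j k).trans ?_
  calc _ ≤ e / 3 + (e / 3 + e / 3) := add_le_add hk (add_le_add hF hc)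
    _ = e := by rw [← add_assoc]; exact ENNReal.add_thirds e

/-! ### I.i.d. sequences read along index maps. -/

section Laws

lemma map_infinitePi_comp_injective {ι κ E : Type*} [MeasurableSpace E] (s : Measure E)
    [IsProbabilityMeasure s] {f : ι → κ} (hf : f.Injective) :
    (Measure.infinitePi fun _ : κ => s).map (fun e i => e (f i)) =
      Measure.infinitePi fun _ : ι => s := by
  have h := (iIndepFun_infinitePi (P := fun _ : κ => s) (X := fun _ x => x)
    (fun _ => measurable_id)).precomp hf
  have h2 := h.map_fun_eq_infinitePi_map (fun i => measurable_pi_apply (f i))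
  refine h2.trans ?_
  congr 1
  funext i
  exact Measure.infinitePi_map_eval (fun _ : κ => s) (f i)

/-- The law of an i.i.d. sequence read along `n` depends only on the coincidences of `n`. -/
lemma map_infinitePi_comp_eq {ι κ E : Type*} [MeasurableSpace E] (s : Measure E)
    [IsProbabilityMeasure s] {n n' : ι → κ} (h : ∀ a b, n a = n b ↔ n' a = n' b) :
    (Measure.infinitePi fun _ : κ => s).map (fun e i => e (n i)) =
      (Measure.infinitePi fun _ : κ => s).map (fun e i => e (n' i)) := by
  -- Both index maps factor injectively through the same quotient, on which the values are again
  -- i.i.d.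
  let r : Setoid ι := Setoid.ker n
  let N : Quotient r → κ := Quotient.lift n fun _ _ hab => hab
  let N' : Quotient r → κ := Quotient.lift n' fun a b hab => (h a b).1 hab
  have hN : N.Injective := by
    rintro ⟨a⟩ ⟨b⟩ hab
    exact Quotient.sound hab
  have hN' : N'.Injective := by
    rintro ⟨a⟩ ⟨b⟩ hab
    exact Quotient.sound ((h a b).2 hab)
  have hg : Measurable fun (e : Quotient r → E) (i : ι) => e (Quotient.mk r i) := by fun_prop
  have key : ∀ M : Quotient r → κ, (Measure.infinitePi fun _ : κ => s).map
      (fun e i => e (M (Quotient.mk r i))) =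
      ((Measure.infinitePi fun _ : κ => s).map (fun e x => e (M x))).map
        (fun (e : Quotient r → E) (i : ι) => e (Quotient.mk r i)) := fun M => by
    rw [Measure.map_map hg (by fun_prop)]; rfl
  have e1 := key N
  have e2 := key N'
  rw [map_infinitePi_comp_injective s hN] at e1
  rw [map_infinitePi_comp_injective s hN'] at e2
  exact e1.trans e2.symm

end Laws

/-! ### Mixing of the shift on a product space. -/

section Mixing

variable {G E : Type*} [AddGroup G] [MeasurableSpace E] (s : Measure E)
  [IsProbabilityMeasure s]

lemma measurePreserving_shift (k : G) :
    MeasurePreserving (fun (z : G → E) m => z (m + k)) (Measure.infinitePi fun _ => s)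
      (Measure.infinitePi fun _ => s) :=
  ⟨by fun_prop, map_infinitePi_comp_injective s (add_left_injective k)⟩

/-- For all but finitely many shifts the two cylinders involve disjoint sets of coordinates, and the
product formula is exact. -/
lemma tendsto_shift_cylinder {A B : Set (G → E)}
    (hA : A ∈ squareCylinders fun _ : G => {t : Set E | MeasurableSet t})
    (hB : B ∈ squareCylinders fun _ : G => {t : Set E | MeasurableSet t}) :
    Tendsto (fun k : G => (Measure.infinitePi fun _ => s).real
        (A ∩ (fun z m => z (m + k)) ⁻¹' B)) cofinite
      (𝓝 ((Measure.infinitePi fun _ => s).real A * (Measure.infinitePi fun _ => s).real B)) := by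
  classical
  obtain ⟨I, (t : G → Set E), ht, rfl⟩ := hA
  obtain ⟨J, (t' : G → Set E), ht', rfl⟩ := hB
  have htm : ∀ i, MeasurableSet (t i) := fun i => ht i trivial
  have htm' : ∀ i, MeasurableSet (t' i) := fun i => ht' i trivial
  refine tendsto_const_nhds.congr' ?_
  have hev : ∀ᶠ k : G in cofinite, ∀ m ∈ J, m + k ∉ I := by
    rw [eventually_all_finset]
    intro m _
    have hfin : (((fun k => m + k) ⁻¹' (I : Set G))).Finite :=
      I.finite_toSet.preimage (add_right_injective m).injOn
    filter_upwards [hfin.compl_mem_cofinite] with k hk using hk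
  filter_upwards [hev] with k hk
  set J' := J.map ⟨fun m => m + k, add_left_injective k⟩ with hJ'
  have hdisj : Disjoint I J' := by
    rw [Finset.disjoint_left]
    intro x hx hx'
    obtain ⟨m, hm, rfl⟩ := Finset.mem_map.1 hx'
    exact hk m hm hx
  have hset : (I : Set G).pi t ∩ (fun z m => z (m + k)) ⁻¹' (J : Set G).pi t' =
      ((I ∪ J' : Finset G) : Set G).pi (fun x => if x ∈ I then t x else t' (x - k)) := by
    ext z
    simp only [Set.mem_inter_iff, Set.mem_pi, Set.mem_preimage, SetLike.mem_coe, Finset.mem_union]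
    constructor
    · rintro ⟨h1, h2⟩ x hx
      split_ifs with hxI
      · exact h1 x hxI
      · rcases hx with hx | hx
        · exact absurd hx hxI
        · obtain ⟨m, hm, rfl⟩ := Finset.mem_map.1 hx
          simpa using h2 m hm
    · intro h
      refine ⟨fun x hx => ?_, fun m hm => ?_⟩
      · simpa [hx] using h x (Or.inl hx)
      · have := h (m + k) (Or.inr (Finset.mem_map.2 ⟨m, hm, rfl⟩))
        simpa [hk m hm] using this
  rw [hset, measureReal_def, measureReal_def, measureReal_def, ← ENNReal.toReal_mul]
  congr 1
  rw [Measure.infinitePi_pi _ (fun i _ => htm i), Measure.infinitePi_pi _ (fun i _ => htm' i),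
    Measure.infinitePi_pi _ (fun i _ => by split_ifs; exacts [htm i, htm' _]),
    Finset.prod_union hdisj]
  congr 1
  · exact Finset.prod_congr rfl fun i hi => by rw [if_pos hi]
  · rw [hJ', Finset.prod_map]
    refine Finset.prod_congr rfl fun m hm => ?_
    simp [hk m hm]

/-- The π-λ argument in one of the two sets. It is used twice: with `T` the identity to free the
unshifted set, then with `T` the shift to free the other. -/
lemma tendsto_measureReal_preimage_inter {Ω κ : Type*} [MeasurableSpace Ω] (M : Measure Ω)
    [IsProbabilityMeasure M] {l : Filter κ} {T : κ → Ω → Ω} {a : ℝ}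
    (hT : ∀ k, MeasurePreserving (T k) M M)
    {D : κ → Set Ω} (hD : ∀ k, MeasurableSet (D k)) (hDa : ∀ k, M.real (D k) = a)
    {S : Set (Set Ω)} (hgen : ‹MeasurableSpace Ω› = MeasurableSpace.generateFrom S)
    (hpi : IsPiSystem S)
    (hS : ∀ A ∈ S, Tendsto (fun k => M.real (T k ⁻¹' A ∩ D k)) l (𝓝 (M.real A * a)))
    {A : Set Ω} (hA : MeasurableSet A) :
    Tendsto (fun k => M.real (T k ⁻¹' A ∩ D k)) l (𝓝 (M.real A * a)) := by
  induction A, hA using MeasurableSpace.induction_on_inter hgen hpi with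
  | empty => simpa using tendsto_const_nhds
  | basic t ht => exact hS t ht
  | compl t htm ih =>
    have h1 : ∀ k, M.real (T k ⁻¹' tᶜ ∩ D k) = a - M.real (T k ⁻¹' t ∩ D k) := fun k => by
      have := measureReal_inter_add_sdiff (μ := M) (s := D k) ((hT k).measurable htm)
      rw [hDa, Set.inter_comm] at this
      rw [← this, Set.preimage_compl, Set.inter_comm (T k ⁻¹' t)ᶜ, ← Set.sdiff_eq]
      ring
    simp only [h1]
    rw [probReal_compl_eq_one_sub htm, sub_mul, one_mul]
    exact tendsto_const_nhds.sub ih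
  | iUnion f hdisj hfm ih =>
    have h1 : ∀ k, M.real (T k ⁻¹' (⋃ i, f i) ∩ D k) = ∑' i, M.real (T k ⁻¹' (f i) ∩ D k) :=
      fun k => by
        rw [Set.preimage_iUnion, Set.iUnion_inter, measureReal_def, measure_iUnion
          (fun i j hij => ((hdisj hij).preimage (T k)).mono Set.inter_subset_left
            Set.inter_subset_left)
          (fun i => ((hT k).measurable (hfm i)).inter (hD k)), ENNReal.tsum_toReal_eq
          fun i => measure_ne_top _ _]
        rfl
    have hsum : Summable fun i => M.real (f i) := by
      refine ENNReal.summable_toReal ?_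
      rw [← measure_iUnion hdisj hfm]; exact measure_ne_top _ _
    have h2 : M.real (⋃ i, f i) = ∑' i, M.real (f i) := by
      rw [measureReal_def, measure_iUnion hdisj hfm, ENNReal.tsum_toReal_eq
        fun i => measure_ne_top _ _]
      rfl
    simp only [h1]
    rw [h2, ← tsum_mul_right]
    -- Since `T k` preserves `M`, the terms are dominated by `M.real (f i)` uniformly in `k`.
    refine tendsto_tsum_of_dominated_convergence hsum ih (Eventually.of_forall fun k i => ?_)
    rw [Real.norm_of_nonneg measureReal_nonneg]
    refine (measureReal_mono Set.inter_subset_left).trans ?_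
    rw [measureReal_def, (hT k).measure_preimage (hfm i).nullMeasurableSet, measureReal_def]

/-- The shift on a product space is mixing. -/
theorem tendsto_shift_mixing {A B : Set (G → E)} (hA : MeasurableSet A) (hB : MeasurableSet B) :
    Tendsto (fun k : G => (Measure.infinitePi fun _ => s).real
        (A ∩ (fun z m => z (m + k)) ⁻¹' B)) cofinite
      (𝓝 ((Measure.infinitePi fun _ => s).real A * (Measure.infinitePi fun _ => s).real B)) := by
  have hgen := (generateFrom_squareCylinders (ι := G) (α := fun _ => E)).symm
  have hpi : IsPiSystem (squareCylinders fun _ : G => {t : Set E | MeasurableSet t}) :=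
    isPiSystem_squareCylinders (fun _ => MeasurableSpace.isPiSystem_measurableSet)
      (fun _ => MeasurableSet.univ)
  have hmeas : ∀ C ∈ squareCylinders fun _ : G => {t : Set E | MeasurableSet t},
      MeasurableSet C := fun C hC => by
    rw [hgen]; exact MeasurableSpace.measurableSet_generateFrom hC
  have hstep : ∀ B ∈ squareCylinders fun _ : G => {t : Set E | MeasurableSet t},
      Tendsto (fun k : G => (Measure.infinitePi fun _ => s).real
        (A ∩ (fun z m => z (m + k)) ⁻¹' B)) cofinite
      (𝓝 ((Measure.infinitePi fun _ => s).real A * (Measure.infinitePi fun _ => s).real B)) := by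
    intro B hB
    refine tendsto_measureReal_preimage_inter (Measure.infinitePi fun _ : G => s)
      (T := fun _ => id) (D := fun k : G => (fun (z : G → E) m => z (m + k)) ⁻¹' B)
      (fun _ => MeasurePreserving.id _) (fun k => (measurePreserving_shift s k).measurable
      (hmeas B hB)) (fun k => ?_) hgen hpi (fun A hA => tendsto_shift_cylinder s hA hB) hA
    rw [measureReal_def, (measurePreserving_shift s k).measure_preimage
      (hmeas B hB).nullMeasurableSet, measureReal_def]
  have := tendsto_measureReal_preimage_inter (Measure.infinitePi fun _ : G => s) (l := cofinite)
      (T := fun (k : G) (z : G → E) m => z (m + k)) (D := fun _ => A)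
      (measurePreserving_shift s)
      (fun k => hA) (fun k => rfl) hgen hpi (fun B hB => by
        have := hstep B hB
        simpa only [Set.inter_comm, mul_comm] using this) hB
  simpa only [Set.inter_comm, mul_comm] using this

end Mixing

/-! ### The field: conditional laws, stationarity and innovations. -/

/-- An environment whose steps are positive and whose signs are `±1` everywhere, not only almost
surely. -/
structure IsRegularEnvironment {d : ℕ} {Ω : Type*} [MeasurableSpace Ω] (P : Measure Ω)
    (μ : Measure (Site d)) (p : ℝ) (Z : Site d → Ω → Site d) (ε : ℕ → Ω → ℝ) : Prop
    extends IsEnvironment P μ p Z ε where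
  pos : ∀ n ω i, 0 < Z n ω i
  sign : ∀ i ω, ε i ω = 1 ∨ ε i ω = -1

/-- `X_k - ∫ X_{k-z} dμ(z)`. -/
noncomputable def innov {d : ℕ} {Ω : Type*} (μ : Measure (Site d)) (X : Site d → Ω → ℝ)
    (k : Site d) (ω : Ω) : ℝ := X k ω - ∫ z, X (k - z) ω ∂μ

section Field

variable {d : ℕ} {μ : Measure (Site d)} {p : ℝ} {Ω : Type*} [MeasurableSpace Ω] {P : Measure Ω}
  {Z : Site d → Ω → Site d} {ε : ℕ → Ω → ℝ}
  {N : (Site d → Site d) → Site d → ℕ}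

lemma iterate_parent_shift (z : Site d → Site d) (k : Site d) (u : ℕ) (a : Site d) :
    (parent z)^[u] (a + k) = (parent fun m => z (m + k))^[u] a + k := by
  induction u generalizing a with
  | zero => rfl
  | succ u ih =>
    rw [Function.iterate_succ_apply, Function.iterate_succ_apply, ← ih]
    congr 1
    simp only [parent]
    abel

lemma meet_shift (z : Site d → Site d) (k a b : Site d) :
    Meet (fun m => z (m + k)) a b ↔ Meet z (a + k) (b + k) := by
  simp only [Meet, iterate_parent_shift, add_left_inj]

lemma IsNumbering.eq_iff_meet (hN : IsNumbering N) (z : Site d → Site d) (j k : Site d) :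
    N z j = N z k ↔ Meet z j k := (hN.eq_iff z j k).trans reachable_iff_meet

lemma IsNumbering.measurable_eval (hN : IsNumbering N) (j : Site d) :
    Measurable fun q : (Site d → Site d) × (ℕ → ℝ) => q.2 (N q.1 j) := by
  have h1 : Measurable fun q : (ℕ → ℝ) × ℕ => q.1 q.2 :=
    measurable_from_prod_countable_left fun n => measurable_pi_apply n
  exact h1.comp (measurable_snd.prodMk ((hN.measurable j).comp measurable_fst))

lemma IsEnvironment.measurable_signs (henv : IsEnvironment P μ p Z ε) :
    Measurable fun ω i => ε i ω := measurable_pi_lambda _ henv.measurable_sign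

lemma IsEnvironment.measurable_field (henv : IsEnvironment P μ p Z ε) (hN : IsNumbering N)
    (j : Site d) : Measurable (field N Z ε j) :=
  (hN.measurable_eval j).comp (henv.measurable_edges.prodMk henv.measurable_signs)

lemma IsRegularEnvironment.field_sq (henv : IsRegularEnvironment P μ p Z ε) (j : Site d) (ω : Ω) :
    field N Z ε j ω * field N Z ε j ω = 1 := by
  rw [field]
  rcases henv.sign (N (fun m => Z m ω) j) ω with h | h <;> rw [h] <;> norm_num

lemma IsRegularEnvironment.abs_field (henv : IsRegularEnvironment P μ p Z ε) (j : Site d) (ω : Ω) :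
    |field N Z ε j ω| = 1 := by
  rw [field]
  rcases henv.sign (N (fun m => Z m ω) j) ω with h | h <;> rw [h] <;> norm_num

lemma IsNumbering.field_parent {Ω : Type*} {Z : Site d → Ω → Site d} {ε : ℕ → Ω → ℝ}
    (hN : IsNumbering N) (j : Site d) (ω : Ω) :
    field N Z ε (j - Z j ω) ω = field N Z ε j ω := by
  rw [field, field, (hN.eq_iff_meet _ j (j - Z j ω)).2 (meet_parent j)]

lemma IsEnvironment.measurable_field_uncurry (henv : IsEnvironment P μ p Z ε)
    (hN : IsNumbering N) (k : Site d) :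
    Measurable fun q : Ω × Site d => field N Z ε (k - q.2) q.1 :=
  measurable_from_prod_countable_left fun z => henv.measurable_field hN (k - z)

lemma IsEnvironment.measurable_mean [IsProbabilityMeasure μ] (henv : IsEnvironment P μ p Z ε)
    (hN : IsNumbering N) (k : Site d) :
    Measurable fun ω => ∫ z, field N Z ε (k - z) ω ∂μ :=
  ((henv.measurable_field_uncurry hN k).stronglyMeasurable.integral_prod_right').measurable

lemma IsRegularEnvironment.abs_mean_le [IsProbabilityMeasure μ]
    (henv : IsRegularEnvironment P μ p Z ε) (k : Site d) (ω : Ω) :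
    |∫ z, field N Z ε (k - z) ω ∂μ| ≤ 1 := by
  have h := norm_integral_le_of_norm_le_const (μ := μ) (f := fun z => field N Z ε (k - z) ω)
    (C := 1) (ae_of_all _ fun z => by rw [Real.norm_eq_abs, henv.abs_field])
  simpa using h

lemma IsEnvironment.measurable_innov [IsProbabilityMeasure μ] (henv : IsEnvironment P μ p Z ε)
    (hN : IsNumbering N) (k : Site d) : Measurable (innov μ (field N Z ε) k) :=
  (henv.measurable_field hN k).sub (henv.measurable_mean hN k)

lemma IsRegularEnvironment.abs_innov_le [IsProbabilityMeasure μ]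
    (henv : IsRegularEnvironment P μ p Z ε) (k : Site d) (ω : Ω) :
    |innov μ (field N Z ε) k ω| ≤ 2 := by
  rw [innov]
  refine (abs_sub _ _).trans ?_
  rw [henv.abs_field]
  linarith [henv.abs_mean_le (N := N) k ω]

lemma IsEnvironment.map_edges (henv : IsEnvironment P μ p Z ε) :
    P.map (fun ω m => Z m ω) = Measure.infinitePi fun _ : Site d => μ := by
  rw [henv.indep_edge.map_fun_eq_infinitePi_map henv.measurable_edge]
  congr 1
  funext i
  rw [henv.law_edge]

variable [IsProbabilityMeasure P]

lemma IsEnvironment.map_joint (henv : IsEnvironment P μ p Z ε) :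
    P.map (fun ω => ((fun m => Z m ω), fun i => ε i ω)) =
      (P.map fun ω m => Z m ω).prod (P.map fun ω i => ε i ω) :=
  (indepFun_iff_map_prod_eq_prod_map_map henv.measurable_edges.aemeasurable
    henv.measurable_signs.aemeasurable).1 henv.indep

lemma IsEnvironment.measure_joint (henv : IsEnvironment P μ p Z ε)
    {C : Set ((Site d → Site d) × (ℕ → ℝ))} (hC : MeasurableSet C) :
    P {ω | ((fun m => Z m ω), fun i => ε i ω) ∈ C} =
      ∫⁻ ω, P {ω' | ((fun m => Z m ω), fun i => ε i ω') ∈ C} ∂P := by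
  have h := DFunLike.congr_fun henv.map_joint C
  rw [Measure.map_apply (henv.measurable_edges.prodMk henv.measurable_signs) hC,
    Measure.prod_apply hC, lintegral_map (measurable_measure_prodMk_left hC)
    henv.measurable_edges] at h
  refine h.trans (lintegral_congr fun ω => ?_)
  rw [Measure.map_apply henv.measurable_signs (measurable_prodMk_left hC)]
  rfl

lemma IsEnvironment.integral_joint (henv : IsEnvironment P μ p Z ε)
    {f : (Site d → Site d) × (ℕ → ℝ) → ℝ} (hf : Measurable f) {c : ℝ}
    (hc : ∀ ω ω', |f ((fun m => Z m ω), fun i => ε i ω')| ≤ c) :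
    ∫ ω, f ((fun m => Z m ω), fun i => ε i ω) ∂P =
      ∫ ω, ∫ ω', f ((fun m => Z m ω), fun i => ε i ω') ∂P ∂P := by
  have hm := henv.measurable_edges.prodMk henv.measurable_signs
  have h1 : Integrable f (P.map (fun ω => ((fun m => Z m ω), fun i => ε i ω))) :=
    (integrable_map_measure hf.aestronglyMeasurable hm.aemeasurable).2
      (Integrable.of_bound (hf.comp hm).aestronglyMeasurable c (ae_of_all _ fun ω => hc ω ω))
  calc ∫ ω, f ((fun m => Z m ω), fun i => ε i ω) ∂P
      = ∫ q, f q ∂(P.map (fun ω => ((fun m => Z m ω), fun i => ε i ω))) :=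
        (integral_map hm.aemeasurable hf.aestronglyMeasurable).symm
    _ = ∫ z, ∫ e, f (z, e) ∂(P.map fun ω i => ε i ω) ∂(P.map fun ω m => Z m ω) := by
        rw [henv.map_joint] at h1 ⊢
        exact integral_prod _ h1
    _ = _ := by
        rw [integral_map henv.measurable_edges.aemeasurable
          (hf.stronglyMeasurable.integral_prod_right').aestronglyMeasurable]
        congr 1 with ω
        exact integral_map henv.measurable_signs.aemeasurable
          (hf.comp measurable_prodMk_left).aestronglyMeasurable

/-- The conditional law of the field given the graph depends only on the partition. -/
lemma IsEnvironment.measure_signs_eq (henv : IsEnvironment P μ p Z ε) (hN : IsNumbering N)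
    {ι : Type*} {z w : Site d → Site d} {a b : ι → Site d}
    (h : ∀ x y, Meet z (a x) (a y) ↔ Meet w (b x) (b y)) {B : Set (ι → ℝ)}
    (hB : MeasurableSet B) :
    P {ω | (fun i => ε (N z (a i)) ω) ∈ B} = P {ω | (fun i => ε (N w (b i)) ω) ∈ B} := by
  have : IsProbabilityMeasure (P.map (ε 0)) :=
    Measure.isProbabilityMeasure_map (henv.measurable_sign 0).aemeasurable
  have hlaw : P.map (fun ω i => ε i ω) = Measure.infinitePi fun _ : ℕ => P.map (ε 0) := by
    rw [henv.indep_sign.map_fun_eq_infinitePi_map henv.measurable_sign]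
    congr 1
    funext i
    rw [henv.law_sign, henv.law_sign]
  have key := map_infinitePi_comp_eq (P.map (ε 0)) (n := fun i => N z (a i))
    (n' := fun i => N w (b i)) (fun x y => by
      rw [hN.eq_iff_meet, hN.eq_iff_meet, h])
  have h2 : ∀ n : ι → ℕ, P {ω | (fun i => ε (n i) ω) ∈ B} =
      (Measure.infinitePi fun _ : ℕ => P.map (ε 0)).map (fun e i => e (n i)) B := fun n => by
    rw [← hlaw, Measure.map_map (by fun_prop) henv.measurable_signs, Measure.map_apply
      ((by fun_prop : Measurable fun (e : ℕ → ℝ) i => e (n i)).comp henv.measurable_signs) hB]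
    rfl
  rw [h2, h2, key]

/-- The edge that leaves `k` is independent of the field on the sites that avoid `k`. -/
theorem IsRegularEnvironment.indepFun_field (henv : IsRegularEnvironment P μ p Z ε)
    (hN : IsNumbering N) (k : Site d) :
    IndepFun (Z k) (fun ω (j : {j // Avoids k j}) => field N Z ε j ω) P := by
  rw [indepFun_iff_measure_inter_preimage_eq_mul]
  intro A B hA hB
  let C : Set ((Site d → Site d) × (ℕ → ℝ)) :=
    {q | (fun j : {j // Avoids k j} => q.2 (N q.1 j)) ∈ B}
  have hC : MeasurableSet C :=
    (measurable_pi_lambda _ fun j : {j // Avoids k j} => hN.measurable_eval (j : Site d)) hB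
  let ψ : (Site d → Site d) → ℝ≥0∞ := fun z => P {ω' | (z, fun i => ε i ω') ∈ C}
  have hψm : Measurable ψ := by
    have : ψ = fun z => (P.map fun ω i => ε i ω) (Prod.mk z ⁻¹' C) := by
      funext z
      rw [Measure.map_apply henv.measurable_signs (measurable_prodMk_left hC)]
      rfl
    rw [this]
    exact measurable_measure_prodMk_left hC
  -- The numbering itself may change when the edge at `k` changes, but the partition of the sites
  -- that avoid `k` does not, and only the partition matters for the law given the graph.
  have hψ : ∀ ω, ψ (fun m => Z m ω) = ψ (Function.update (fun m => Z m ω) k 1) := fun ω =>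
    henv.measure_signs_eq hN (a := fun j : {j // Avoids k j} => (j : Site d)) (b := fun j => j)
      (fun x y => (meet_update (fun a i => henv.pos a ω i) x.2 y.2 1).symm) hB
  have hind : IndepFun (fun ω => A.indicator (1 : Site d → ℝ≥0∞) (Z k ω))
      (fun ω => ψ (Function.update (fun m => Z m ω) k 1)) P :=
    (henv.indepFun_update k 1).comp (measurable_one.indicator hA) hψm
  have hupd : Measurable fun ω => Function.update (fun m => Z m ω) k (1 : Site d) := by
    refine measurable_pi_lambda _ fun m => ?_
    by_cases hm : m = k
    · subst hm; simp only [Function.update_self]; exact measurable_const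
    · simp only [Function.update_of_ne hm]; exact henv.measurable_edge m
  have h1 : P (Z k ⁻¹' A ∩ (fun ω (j : {j // Avoids k j}) => field N Z ε j ω) ⁻¹' B) =
      ∫⁻ ω, A.indicator (1 : Site d → ℝ≥0∞) (Z k ω) *
        ψ (Function.update (fun m => Z m ω) k 1) ∂P := by
    have hC' : MeasurableSet ({q : (Site d → Site d) × (ℕ → ℝ) | q.1 k ∈ A} ∩ C) :=
      (((measurable_pi_apply k).comp measurable_fst) hA).inter hC
    refine (henv.measure_joint hC').trans (lintegral_congr fun ω => ?_)
    by_cases hω : Z k ω ∈ A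
    · rw [Set.indicator_of_mem hω, Pi.one_apply, one_mul, ← hψ]
      congr 1
      ext ω'
      exact and_iff_right hω
    · rw [Set.indicator_of_notMem hω, zero_mul]
      refine measure_mono_null (t := ∅) ?_ measure_empty
      rintro ω' ⟨h, -⟩
      exact hω h
  have h2 : P ((fun ω (j : {j // Avoids k j}) => field N Z ε j ω) ⁻¹' B) =
      ∫⁻ ω, ψ (Function.update (fun m => Z m ω) k 1) ∂P := by
    refine (henv.measure_joint hC).trans (lintegral_congr fun ω => ?_)
    rw [← hψ]
  have h3 : P (Z k ⁻¹' A) = ∫⁻ ω, A.indicator (1 : Site d → ℝ≥0∞) (Z k ω) ∂P := by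
    have : (fun ω => A.indicator (1 : Site d → ℝ≥0∞) (Z k ω)) = (Z k ⁻¹' A).indicator 1 := rfl
    rw [this, lintegral_indicator_one (henv.measurable_edge k hA)]
  rw [h1, h2, h3]
  exact lintegral_mul_eq_lintegral_mul_lintegral_of_indepFun
    ((measurable_one.indicator hA).comp (henv.measurable_edge k)) (hψm.comp hupd) hind

/-- The law of the field is shift invariant. -/
theorem IsEnvironment.measure_field_shift (henv : IsEnvironment P μ p Z ε)
    [IsProbabilityMeasure μ] (hN : IsNumbering N) (k : Site d) {B : Set (Site d → ℝ)}
    (hB : MeasurableSet B) :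
    P {ω | (fun j => field N Z ε (j + k) ω) ∈ B} = P {ω | (fun j => field N Z ε j ω) ∈ B} := by
  let C : Site d → Set ((Site d → Site d) × (ℕ → ℝ)) := fun k =>
    {q | (fun j => q.2 (N q.1 (j + k))) ∈ B}
  have hC : ∀ k, MeasurableSet (C k) := fun k =>
    (measurable_pi_lambda _ fun j => hN.measurable_eval (j + k)) hB
  have hlaw := henv.map_edges
  have hψm : Measurable fun z => P {ω' | (z, fun i => ε i ω') ∈ C 0} := by
    have : (fun z => P {ω' | (z, fun i => ε i ω') ∈ C 0}) =
        fun z => (P.map fun ω i => ε i ω) (Prod.mk z ⁻¹' C 0) := by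
      funext z
      rw [Measure.map_apply henv.measurable_signs (measurable_prodMk_left (hC 0))]
      rfl
    rw [this]
    exact measurable_measure_prodMk_left (hC 0)
  -- Numberings need not be compatible with shifts; only the induced partitions are compared.
  have hmeet : ∀ (z : Site d → Site d) (a b : Site d),
      Meet z (a + k) (b + k) ↔ Meet (fun m => z (m + k)) (a + 0) (b + 0) := fun z a b => by
    rw [add_zero, add_zero, meet_shift]
  calc P {ω | (fun j => field N Z ε (j + k) ω) ∈ B}
      = ∫⁻ ω, P {ω' | ((fun m => Z m ω), fun i => ε i ω') ∈ C k} ∂P := henv.measure_joint (hC k)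
    _ = ∫⁻ ω, P {ω' | ((fun m => Z (m + k) ω), fun i => ε i ω') ∈ C 0} ∂P :=
        lintegral_congr fun ω => henv.measure_signs_eq hN (a := fun j => j + k)
          (b := fun j => j + 0) (hmeet _) hB
    _ = ∫⁻ z, P {ω' | ((fun m => z (m + k)), fun i => ε i ω') ∈ C 0}
          ∂(P.map fun ω m => Z m ω) :=
        (lintegral_map (hψm.comp (measurePreserving_shift μ k).measurable)
          henv.measurable_edges).symm
    _ = ∫⁻ z, P {ω' | (z, fun i => ε i ω') ∈ C 0} ∂(P.map fun ω m => Z m ω) := by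
        rw [hlaw]
        exact (measurePreserving_shift μ k).lintegral_comp hψm
    _ = ∫⁻ ω, P {ω' | ((fun m => Z m ω), fun i => ε i ω') ∈ C 0} ∂P :=
        lintegral_map hψm henv.measurable_edges
    _ = P {ω | (fun j => field N Z ε j ω) ∈ B} := by
        rw [← henv.measure_joint (hC 0)]
        simp only [C, add_zero]
        rfl

/-- The innovation at `k` is orthogonal to every bounded function of the field on the sites that
avoid `k`. -/
theorem IsRegularEnvironment.integral_innov_smul [IsProbabilityMeasure μ]
    (henv : IsRegularEnvironment P μ p Z ε) (hμ : IsStepLaw μ) (hd : 1 ≤ d) (hN : IsNumbering N)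
    {E : Type*} [NormedAddCommGroup E] [NormedSpace ℝ E] [CompleteSpace E] (k : Site d)
    {F : ({j // Avoids k j} → ℝ) → E} (hF : StronglyMeasurable F) {c : ℝ}
    (hc : ∀ ω, ‖F fun j => field N Z ε j ω‖ ≤ c) :
    ∫ ω, innov μ (field N Z ε) k ω • F (fun j => field N Z ε j ω) ∂P = 0 := by
  classical
  set X := field N Z ε with hX
  let W : Ω → {j // Avoids k j} → ℝ := fun ω j => X j ω
  have hW : Measurable W := measurable_pi_lambda _ fun j => henv.measurable_field hN j
  -- Reads off `X (k - z)` from the sites that avoid `k`. The default `0` is never seen on the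
  -- support of `μ`.
  let g : Site d → ({j // Avoids k j} → ℝ) → ℝ := fun z x =>
    if h : Avoids k (k - z) then x ⟨k - z, h⟩ else 0
  have hgm : Measurable fun q : Site d × ({j // Avoids k j} → ℝ) => g q.1 q.2 := by
    refine measurable_from_prod_countable_right fun z => ?_
    by_cases h : Avoids k (k - z)
    · simp only [g, h, dif_pos]; exact measurable_pi_apply _
    · simp only [g, h, dif_neg, not_false_eq_true]; exact measurable_const
  have hgX : ∀ z, μ {z} ≠ 0 → ∀ ω, g z (W ω) = X (k - z) ω := fun z hz ω => by
    simp only [g, dif_pos (avoids_self_sub hd k (hμ.pos_of_ne_zero hz)), W]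
  have hgX' : ∀ ω, ∀ᵐ z ∂μ, g z (W ω) = X (k - z) ω := fun ω => by
    rw [ae_iff_of_countable]
    exact fun z hz => hgX z hz ω
  have hgZ : ∀ ω, g (Z k ω) (W ω) = X k ω := fun ω => by
    have : Avoids k (k - Z k ω) := avoids_self_sub hd k (henv.pos k ω)
    simp only [g, dif_pos this, W]
    exact hN.field_parent k ω
  have hmap : P.map (fun ω => (Z k ω, W ω)) = μ.prod (P.map W) := by
    rw [← henv.law_edge k]
    exact (indepFun_iff_map_prod_eq_prod_map_map (henv.measurable_edge k).aemeasurable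
      hW.aemeasurable).1 (henv.indepFun_field hN k)
  have hpm : Measurable fun ω => (Z k ω, W ω) := (henv.measurable_edge k).prodMk hW
  have hfm : StronglyMeasurable fun q : Site d × ({j // Avoids k j} → ℝ) => g q.1 q.2 • F q.2 :=
    hgm.stronglyMeasurable.smul (hF.comp_measurable measurable_snd)
  have hXF : Integrable (fun ω => X k ω • F (W ω)) P := by
    refine Integrable.of_bound (((henv.measurable_field hN k).stronglyMeasurable.smul
      (hF.comp_measurable hW)).aestronglyMeasurable) c (ae_of_all _ fun ω => ?_)
    rw [norm_smul, Real.norm_eq_abs, henv.abs_field, one_mul]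
    exact hc ω
  have hintegrable : Integrable (fun q : Site d × ({j // Avoids k j} → ℝ) => g q.1 q.2 • F q.2)
      (μ.prod (P.map W)) := by
    rw [← hmap, integrable_map_measure hfm.aestronglyMeasurable hpm.aemeasurable]
    refine hXF.congr (ae_of_all _ fun ω => ?_)
    simp only [Function.comp_apply, hgZ]
  have hMF : Integrable (fun ω => (∫ z, X (k - z) ω ∂μ) • F (W ω)) P := by
    refine Integrable.of_bound (((henv.measurable_mean hN k).stronglyMeasurable.smul
      (hF.comp_measurable hW)).aestronglyMeasurable) (1 * c) (ae_of_all _ fun ω => ?_)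
    rw [norm_smul, Real.norm_eq_abs]
    have h0 : 0 ≤ ‖F (W ω)‖ := norm_nonneg _
    exact mul_le_mul (henv.abs_mean_le k ω) (hc ω) h0 zero_le_one
  -- Since `X_k = X_{k - Z_k}` and `Z k` has law `μ` independently of `W`, integrating out `Z k`
  -- replaces `X_k` by its mean over `μ`.
  have h1 : ∫ ω, X k ω • F (W ω) ∂P = ∫ ω, (∫ z, X (k - z) ω ∂μ) • F (W ω) ∂P := by
    calc ∫ ω, X k ω • F (W ω) ∂P
        = ∫ q, g q.1 q.2 • F q.2 ∂(P.map (fun ω => (Z k ω, W ω))) := by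
          rw [integral_map hpm.aemeasurable hfm.aestronglyMeasurable]
          simp only [hgZ]
      _ = ∫ x, ∫ z, g z x • F x ∂μ ∂(P.map W) := by
          rw [hmap]; exact integral_prod_symm _ hintegrable
      _ = ∫ ω, ∫ z, g z (W ω) • F (W ω) ∂μ ∂P :=
          integral_map hW.aemeasurable
            (hfm.integral_prod_left').aestronglyMeasurable
      _ = _ := by
          congr 1 with ω
          rw [integral_smul_const]
          congr 1
          exact integral_congr_ae (hgX' ω)
  have h2 : ∀ ω, innov μ X k ω • F (W ω) =
      X k ω • F (W ω) - (∫ z, X (k - z) ω ∂μ) • F (W ω) := fun ω => by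
    rw [innov, sub_smul]
  change ∫ ω, innov μ X k ω • F (W ω) ∂P = 0
  simp only [h2]
  rw [integral_sub hXF hMF, h1, sub_self]

/-- The conditional expectation given the past, for a modification of the field. -/
theorem IsRegularEnvironment.innovation_ae_eq [IsProbabilityMeasure μ]
    (henv : IsRegularEnvironment P μ p Z ε) (hμ : IsStepLaw μ) (hd : 1 ≤ d) (hN : IsNumbering N)
    {X : Site d → Ω → ℝ} (hXm : ∀ k, Measurable (X k)) (hX : ∀ k, X k =ᵐ[P] field N Z ε k)
    (j : Site d) : innovation P X j =ᵐ[P] innov μ (field N Z ε) j := by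
  classical
  set X' := field N Z ε with hX'
  let T := {k : Site d // ∀ i, k i < j i}
  let R : Ω → T → ℝ := fun ω k => X k ω
  let R' : Ω → T → ℝ := fun ω k => X' k ω
  have hpast_le : past X j ≤ ‹MeasurableSpace Ω› :=
    iSup₂_le fun k _ => (hXm k).comap_le
  have hR : Measurable[past X j] R := by
    refine @measurable_pi_lambda _ _ _ (past X j) _ _ fun k => ?_
    rw [measurable_iff_comap_le]
    exact le_iSup₂ (f := fun (k : Site d) (_ : ∀ i, k i < j i) =>
      MeasurableSpace.comap (X k) inferInstance) k.1 k.2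
  have hle : past X j ≤ MeasurableSpace.comap R inferInstance := by
    refine iSup₂_le fun k hk => ?_
    rw [← measurable_iff_comap_le]
    exact (measurable_pi_apply (⟨k, hk⟩ : T)).comp (comap_measurable R)
  have hall : ∀ᵐ ω ∂P, ∀ k, X k ω = X' k ω := ae_all_iff.2 hX
  let g : Site d → (T → ℝ) → ℝ := fun z x =>
    if h : ∀ i, (j - z) i < j i then x ⟨j - z, h⟩ else 0
  have hgm : Measurable fun q : (T → ℝ) × Site d => g q.2 q.1 := by
    refine measurable_from_prod_countable_left fun z => ?_
    by_cases h : ∀ i, (j - z) i < j i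
    · simp only [g, h, dif_pos, implies_true]; exact measurable_pi_apply _
    · simp only [g, h, dif_neg, not_false_eq_true]; exact measurable_const
  let G : (T → ℝ) → ℝ := fun x => ∫ z, g z x ∂μ
  have hG : Measurable G := (hgm.stronglyMeasurable.integral_prod_right').measurable
  have hGR' : ∀ ω, G (R' ω) = ∫ z, X' (j - z) ω ∂μ := fun ω => by
    refine integral_congr_ae ?_
    change ∀ᵐ z ∂μ, g z (R' ω) = X' (j - z) ω
    rw [ae_iff_of_countable]
    intro z hz
    have : ∀ i, (j - z) i < j i := fun i => by
      have := hμ.pos_of_ne_zero hz i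
      simp only [Pi.sub_apply]; linarith
    simp only [g, R', dif_pos this]
  have hRR' : ∀ᵐ ω ∂P, R ω = R' ω := by
    filter_upwards [hall] with ω hω
    funext k; exact hω k
  have hGR : (fun ω => G (R ω)) =ᵐ[P] fun ω => ∫ z, X' (j - z) ω ∂μ := by
    filter_upwards [hRR'] with ω hω
    rw [hω, hGR']
  have hintM : Integrable (fun ω => ∫ z, X' (j - z) ω ∂μ) P :=
    Integrable.of_bound (henv.measurable_mean hN j).aestronglyMeasurable 1
      (ae_of_all _ fun ω => henv.abs_mean_le j ω)
  have hintX' : Integrable (X' j) P :=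
    Integrable.of_bound (henv.measurable_field hN j).aestronglyMeasurable 1
      (ae_of_all _ fun ω => (henv.abs_field j ω).le)
  -- The mean over `μ` is a function of the past, because positive steps lead below `j`;
  -- orthogonality to events of the past then identifies the conditional expectation.
  have hcond : (fun ω => G (R ω)) =ᵐ[P] P[X j | past X j] := by
    refine ae_eq_condExp_of_forall_setIntegral_eq hpast_le (hintX'.congr (hX j).symm)
      (fun s _ _ => (hintM.congr hGR.symm).integrableOn) (fun s hs _ => ?_)
      ((hG.comp hR).stronglyMeasurable.aestronglyMeasurable)
    obtain ⟨B, hB, rfl⟩ := hle s hs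
    have hRm : Measurable R := measurable_pi_lambda _ fun k => hXm k
    have hBm : MeasurableSet (R ⁻¹' B) := hRm hB
    have hR'm : Measurable R' := measurable_pi_lambda _ fun k => henv.measurable_field hN k
    have hBm' : MeasurableSet (R' ⁻¹' B) := hR'm hB
    have hset : (R ⁻¹' B : Set Ω) =ᵐ[P] R' ⁻¹' B := by
      filter_upwards [hRR'] with ω hω
      exact propext (by
        change R ω ∈ B ↔ R' ω ∈ B
        rw [hω])
    rw [setIntegral_congr_set hset, setIntegral_congr_set hset]
    have e1 : ∫ ω in R' ⁻¹' B, G (R ω) ∂P = ∫ ω in R' ⁻¹' B, ∫ z, X' (j - z) ω ∂μ ∂P :=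
      integral_congr_ae (ae_restrict_of_ae hGR)
    have e2 : ∫ ω in R' ⁻¹' B, X j ω ∂P = ∫ ω in R' ⁻¹' B, X' j ω ∂P :=
      integral_congr_ae (ae_restrict_of_ae (hX j))
    rw [e1, e2]
    -- The past of `j` is contained in the sites that avoid `j`.
    have hav : ∀ k : T, Avoids j k.1 := fun k =>
      ⟨fun e => by simpa [e] using k.2 ⟨0, hd⟩,
        fun h => lt_asymm (k.2 ⟨0, hd⟩) (h ⟨0, hd⟩)⟩
    let F : ({k // Avoids j k} → ℝ) → ℝ := fun x =>
      B.indicator 1 (fun k : T => x ⟨k.1, hav k⟩)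
    have hF : Measurable F := (measurable_one.indicator hB).comp
      (measurable_pi_lambda _ fun k => measurable_pi_apply _)
    have key := henv.integral_innov_smul hμ hd hN j hF.stronglyMeasurable (c := 1) (fun ω => by
      simp only [F, Set.indicator]; split_ifs <;> simp)
    have e3 : ∀ ω, innov μ X' j ω • F (fun k => X' k ω) =
        (R' ⁻¹' B).indicator (fun ω => X' j ω - ∫ z, X' (j - z) ω ∂μ) ω := fun ω => by
      by_cases hω : R' ω ∈ B
      · rw [Set.indicator_of_mem (show ω ∈ R' ⁻¹' B from hω)]
        have : F (fun k => X' k ω) = 1 := Set.indicator_of_mem hω _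
        rw [this, smul_eq_mul, mul_one]; rfl
      · rw [Set.indicator_of_notMem (show ω ∉ R' ⁻¹' B from hω)]
        have : F (fun k => X' k ω) = 0 := Set.indicator_of_notMem hω _
        rw [this, smul_zero]
    simp only [hX'.symm, e3] at key
    rw [integral_indicator hBm', integral_sub hintX'.integrableOn hintM.integrableOn] at key
    linarith
  filter_upwards [hcond, hGR, hX j] with ω h1 h2 h3
  rw [innovation, Pi.sub_apply, ← h1, h2, h3, innov]

end Field

/-! ### Second and fourth moments of the field. -/

/-- The conditional expectation of `X_a X_b` given the graph, for signs whose squared mean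
is `c`. -/
noncomputable def pairMean {d : ℕ} (c : ℝ) (a b : Site d) (z : Site d → Site d) : ℝ :=
  c + (1 - c) * {z : Site d → Site d | Meet z a b}.indicator 1 z

lemma measurable_pairMean {d : ℕ} (c : ℝ) (a b : Site d) : Measurable (pairMean c a b) :=
  (((measurable_one.indicator (measurableSet_meet a b)).const_mul _).const_add _)

lemma pairMean_mem {d : ℕ} {c : ℝ} (hc : 0 ≤ c) (hc' : c ≤ 1) (a b : Site d)
    (z : Site d → Site d) : 0 ≤ pairMean c a b z ∧ pairMean c a b z ≤ 1 := by
  rw [pairMean, Set.indicator]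
  split_ifs
  · simp
  · simpa using ⟨hc, hc'⟩

section Moments

variable {d : ℕ} {μ : Measure (Site d)} {p : ℝ} {Ω : Type*} [MeasurableSpace Ω] {P : Measure Ω}
  {Z : Site d → Ω → Site d} {ε : ℕ → Ω → ℝ}
  {N : (Site d → Site d) → Site d → ℕ}

lemma IsEnvironment.integral_sign (henv : IsEnvironment P μ p Z ε) (hp : 0 < p ∧ p < 1) (i : ℕ) :
    ∫ ω, ε i ω ∂P = 2 * p - 1 := by
  have h := integral_map (μ := P) (henv.measurable_sign i).aemeasurable
    (f := fun x : ℝ => x) measurable_id.aestronglyMeasurable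
  rw [← h, henv.law_sign, integral_add_measure, integral_smul_measure, integral_smul_measure,
    integral_dirac, integral_dirac, ENNReal.toReal_ofReal hp.1.le,
    ENNReal.toReal_ofReal (by linarith [hp.2])]
  · simp only [smul_eq_mul]; ring
  · exact (integrable_dirac (by simp)).smul_measure ENNReal.ofReal_ne_top
  · exact (integrable_dirac (by simp)).smul_measure ENNReal.ofReal_ne_top

variable [IsProbabilityMeasure P]

lemma IsRegularEnvironment.integral_sign_mul (henv : IsRegularEnvironment P μ p Z ε)
    (hp : 0 < p ∧ p < 1) (hN : IsNumbering N) (z : Site d → Site d) (a b : Site d) :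
    ∫ ω, ε (N z a) ω * ε (N z b) ω ∂P = pairMean ((2 * p - 1) ^ 2) a b z := by
  rw [pairMean]
  by_cases h : Meet z a b
  · rw [Set.indicator_of_mem (show z ∈ {z | Meet z a b} from h)]
    have : ∀ ω, ε (N z a) ω * ε (N z b) ω = 1 := fun ω => by
      rw [(hN.eq_iff_meet z a b).2 h]
      rcases henv.sign (N z b) ω with h | h <;> rw [h] <;> norm_num
    simp [this]
  · rw [Set.indicator_of_notMem (show z ∉ {z | Meet z a b} from h)]
    have hne : N z a ≠ N z b := fun e => h ((hN.eq_iff_meet z a b).1 e)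
    rw [(henv.indep_sign.indepFun hne).integral_fun_mul_eq_mul_integral
      (henv.measurable_sign _).aestronglyMeasurable (henv.measurable_sign _).aestronglyMeasurable,
      henv.integral_sign hp, henv.integral_sign hp]
    ring

lemma IsRegularEnvironment.integral_sign_mul_mul (henv : IsRegularEnvironment P μ p Z ε)
    (hp : 0 < p ∧ p < 1) (hN : IsNumbering N) (z : Site d → Site d) {a b a' b' : Site d}
    (h₁ : ¬ Meet z a a') (h₂ : ¬ Meet z a b') (h₃ : ¬ Meet z b a') (h₄ : ¬ Meet z b b') :
    ∫ ω, (ε (N z a) ω * ε (N z b) ω) * (ε (N z a') ω * ε (N z b') ω) ∂P =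
      pairMean ((2 * p - 1) ^ 2) a b z * pairMean ((2 * p - 1) ^ 2) a' b' z := by
  have hind := (henv.indep_sign.indepFun_prodMk_prodMk henv.measurable_sign (N z a) (N z b)
    (N z a') (N z b') (fun e => h₁ ((hN.eq_iff_meet _ _ _).1 e))
    (fun e => h₂ ((hN.eq_iff_meet _ _ _).1 e)) (fun e => h₃ ((hN.eq_iff_meet _ _ _).1 e))
    (fun e => h₄ ((hN.eq_iff_meet _ _ _).1 e))).comp
    (φ := fun q : ℝ × ℝ => q.1 * q.2) (ψ := fun q : ℝ × ℝ => q.1 * q.2)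
    (by fun_prop) (by fun_prop)
  have hm : ∀ i j, AEStronglyMeasurable (fun ω => ε i ω * ε j ω) P := fun i j =>
    ((henv.measurable_sign i).mul (henv.measurable_sign j)).aestronglyMeasurable
  have := hind.integral_fun_mul_eq_mul_integral (hm _ _) (hm _ _)
  simp only [Function.comp_apply] at this
  rw [this, henv.integral_sign_mul hp hN, henv.integral_sign_mul hp hN]

lemma IsRegularEnvironment.integral_field (henv : IsRegularEnvironment P μ p Z ε)
    (hp : 0 < p ∧ p < 1) (hN : IsNumbering N) (a : Site d) :
    ∫ ω, field N Z ε a ω ∂P = 2 * p - 1 := by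
  have h := henv.integral_joint (hN.measurable_eval a) (c := 1) (fun ω ω' => by
    rcases henv.sign (N (fun m => Z m ω) a) ω' with h | h <;> simp [h])
  refine h.trans ?_
  simp [henv.integral_sign hp]

lemma IsRegularEnvironment.integral_field_mul_eq (henv : IsRegularEnvironment P μ p Z ε)
    (hp : 0 < p ∧ p < 1) (hN : IsNumbering N) (a b : Site d) :
    ∫ ω, field N Z ε a ω * field N Z ε b ω ∂P =
      ∫ ω, pairMean ((2 * p - 1) ^ 2) a b (fun m => Z m ω) ∂P := by
  have h := henv.integral_joint ((hN.measurable_eval a).mul (hN.measurable_eval b)) (c := 1)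
    (fun ω ω' => by
      simp only [Pi.mul_apply]
      rcases henv.sign (N (fun m => Z m ω) a) ω' with h | h <;>
      rcases henv.sign (N (fun m => Z m ω) b) ω' with h' | h' <;> simp [h, h'])
  refine h.trans ?_
  congr 1 with ω
  exact henv.integral_sign_mul hp hN _ a b

lemma IsEnvironment.integral_pairMean (henv : IsEnvironment P μ p Z ε) (c : ℝ) (a b : Site d) :
    ∫ ω, pairMean c a b (fun m => Z m ω) ∂P =
      c + (1 - c) * P.real {ω | Meet (fun m => Z m ω) a b} := by
  have hm : MeasurableSet {ω | Meet (fun m => Z m ω) a b} :=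
    henv.measurable_edges (measurableSet_meet a b)
  have h1 : ∀ ω, {z : Site d → Site d | Meet z a b}.indicator (1 : (Site d → Site d) → ℝ) (fun m => Z m ω) =
      {ω | Meet (fun m => Z m ω) a b}.indicator 1 ω := fun ω => rfl
  have hi : Integrable (fun ω => (1 - c) *
      {ω | Meet (fun m => Z m ω) a b}.indicator (1 : Ω → ℝ) ω) P :=
    ((integrable_const (1 : ℝ)).indicator hm).const_mul _
  simp only [pairMean, h1]
  rw [integral_add (integrable_const _) hi, integral_const_mul,
    integral_indicator_one hm]
  simp

lemma IsEnvironment.integral_pairMean_mul (henv : IsEnvironment P μ p Z ε) (c : ℝ)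
    (a b a' b' : Site d) :
    ∫ ω, pairMean c a b (fun m => Z m ω) * pairMean c a' b' (fun m => Z m ω) ∂P -
      (∫ ω, pairMean c a b (fun m => Z m ω) ∂P) * ∫ ω, pairMean c a' b' (fun m => Z m ω) ∂P =
      (1 - c) ^ 2 * (P.real ({ω | Meet (fun m => Z m ω) a b} ∩ {ω | Meet (fun m => Z m ω) a' b'}) -
        P.real {ω | Meet (fun m => Z m ω) a b} * P.real {ω | Meet (fun m => Z m ω) a' b'}) := by
  set A := {ω | Meet (fun m => Z m ω) a b} with hA
  set B := {ω | Meet (fun m => Z m ω) a' b'} with hB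
  have hmA : MeasurableSet A := henv.measurable_edges (measurableSet_meet a b)
  have hmB : MeasurableSet B := henv.measurable_edges (measurableSet_meet a' b')
  rw [henv.integral_pairMean, henv.integral_pairMean, ← hA, ← hB]
  have h1 : ∀ ω, pairMean c a b (fun m => Z m ω) * pairMean c a' b' (fun m => Z m ω) =
      c * c + (c * (1 - c) * A.indicator 1 ω + (c * (1 - c) * B.indicator 1 ω +
        (1 - c) ^ 2 * (A ∩ B).indicator 1 ω)) := fun ω => by
    have e1 : pairMean c a b (fun m => Z m ω) = c + (1 - c) * A.indicator 1 ω := rfl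
    have e2 : pairMean c a' b' (fun m => Z m ω) = c + (1 - c) * B.indicator 1 ω := rfl
    rw [e1, e2, Set.inter_indicator_one, Pi.mul_apply]
    ring
  have hi : ∀ (s : Set Ω), MeasurableSet s → ∀ t : ℝ,
      Integrable (fun ω => t * s.indicator (1 : Ω → ℝ) ω) P := fun s hs t =>
    ((integrable_const (1 : ℝ)).indicator hs).const_mul t
  have h2 : Integrable (fun ω => c * (1 - c) * B.indicator 1 ω +
      (1 - c) ^ 2 * (A ∩ B).indicator 1 ω) P := (hi B hmB _).add (hi _ (hmA.inter hmB) _)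
  have h3 : Integrable (fun ω => c * (1 - c) * A.indicator 1 ω + (c * (1 - c) * B.indicator 1 ω +
      (1 - c) ^ 2 * (A ∩ B).indicator 1 ω)) P := (hi A hmA _).add h2
  simp only [h1]
  rw [integral_add (integrable_const _) h3, integral_add (hi A hmA _) h2, integral_add (hi B hmB _) (hi _ (hmA.inter hmB) _),
    integral_const, integral_const_mul, integral_const_mul, integral_const_mul,
    integral_indicator_one hmA,
    integral_indicator_one hmB, integral_indicator_one (hmA.inter hmB)]
  simp only [probReal_univ, smul_eq_mul, one_mul]
  ring

lemma IsRegularEnvironment.memLp_field_mul (henv : IsRegularEnvironment P μ p Z ε)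
    (hN : IsNumbering N) (a b : Site d) :
    MemLp (fun ω => field N Z ε a ω * field N Z ε b ω) 2 P := by
  refine MemLp.of_bound ((henv.measurable_field hN a).mul
    (henv.measurable_field hN b)).aestronglyMeasurable 1 (ae_of_all _ fun ω => ?_)
  rw [norm_mul, Real.norm_eq_abs, Real.norm_eq_abs, henv.abs_field, henv.abs_field, one_mul]

/-- The covariance of products of the field at two pairs of sites. -/
lemma IsRegularEnvironment.abs_cov_field_le (henv : IsRegularEnvironment P μ p Z ε)
    (hp : 0 < p ∧ p < 1) (hN : IsNumbering N) (a b a' b' : Site d) :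
    |cov[fun ω => field N Z ε a ω * field N Z ε b ω,
        fun ω => field N Z ε a' ω * field N Z ε b' ω; P]| ≤
      2 * (P.real {ω | Meet (fun m => Z m ω) a a'} + P.real {ω | Meet (fun m => Z m ω) a b'} +
        P.real {ω | Meet (fun m => Z m ω) b a'} + P.real {ω | Meet (fun m => Z m ω) b b'}) +
      |P.real ({ω | Meet (fun m => Z m ω) a b} ∩ {ω | Meet (fun m => Z m ω) a' b'}) -
        P.real {ω | Meet (fun m => Z m ω) a b} * P.real {ω | Meet (fun m => Z m ω) a' b'}| := by
  set c := (2 * p - 1) ^ 2 with hc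
  have hc0 : 0 ≤ c := sq_nonneg _
  have hc1 : c ≤ 1 := by rw [hc]; nlinarith [hp.1, hp.2]
  rw [covariance_eq_sub (henv.memLp_field_mul hN a b) (henv.memLp_field_mul hN a' b'),
    henv.integral_field_mul_eq hp hN, henv.integral_field_mul_eq hp hN]
  have hf : Measurable fun q : (Site d → Site d) × (ℕ → ℝ) =>
      (q.2 (N q.1 a) * q.2 (N q.1 b)) * (q.2 (N q.1 a') * q.2 (N q.1 b')) :=
    ((hN.measurable_eval a).mul (hN.measurable_eval b)).mul
      ((hN.measurable_eval a').mul (hN.measurable_eval b'))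
  have habs : ∀ i ω, |ε i ω| = 1 := fun i ω => by
    rcases henv.sign i ω with h | h <;> rw [h] <;> norm_num
  have hbd : ∀ (z : Site d → Site d) ω', |(ε (N z a) ω' * ε (N z b) ω') *
      (ε (N z a') ω' * ε (N z b') ω')| ≤ 1 := fun z ω' => by
    simp only [abs_mul, habs, mul_one, le_refl]
  have hjoint := henv.integral_joint hf (c := 1) (fun ω ω' => hbd _ ω')
  let I : (Site d → Site d) → ℝ := fun z =>
    ∫ ω', (ε (N z a) ω' * ε (N z b) ω') * (ε (N z a') ω' * ε (N z b') ω') ∂P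
  have hI : ∫ ω, ((fun ω => field N Z ε a ω * field N Z ε b ω) *
      fun ω => field N Z ε a' ω * field N Z ε b' ω) ω ∂P = ∫ ω, I (fun m => Z m ω) ∂P := hjoint
  have hIm : Measurable fun ω => I (fun m => Z m ω) := by
    have h1 : Measurable fun q : Ω × Ω => ((ε (N (fun m => Z m q.1) a) q.2 *
        ε (N (fun m => Z m q.1) b) q.2) * (ε (N (fun m => Z m q.1) a') q.2 *
        ε (N (fun m => Z m q.1) b') q.2)) :=
      hf.comp ((henv.measurable_edges.comp measurable_fst).prodMk
        (henv.measurable_signs.comp measurable_snd))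
    exact (h1.stronglyMeasurable.integral_prod_right').measurable
  have hIabs : ∀ z, |I z| ≤ 1 := fun z => by
    have := norm_integral_le_of_norm_le_const (μ := P) (C := 1)
      (f := fun ω' => (ε (N z a) ω' * ε (N z b) ω') * (ε (N z a') ω' * ε (N z b') ω'))
      (ae_of_all _ (hbd z))
    simpa using this
  have hIint : Integrable (fun ω => I (fun m => Z m ω)) P :=
    Integrable.of_bound hIm.aestronglyMeasurable 1 (ae_of_all _ fun ω => hIabs _)
  have hpp : Integrable (fun ω => pairMean c a b (fun m => Z m ω) *
      pairMean c a' b' (fun m => Z m ω)) P := by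
    refine Integrable.of_bound (((measurable_pairMean c a b).comp henv.measurable_edges).mul
      ((measurable_pairMean c a' b').comp henv.measurable_edges)).aestronglyMeasurable 1
      (ae_of_all _ fun ω => ?_)
    have h1 := pairMean_mem hc0 hc1 a b (fun m => Z m ω)
    have h2 := pairMean_mem hc0 hc1 a' b' (fun m => Z m ω)
    rw [Real.norm_of_nonneg (mul_nonneg h1.1 h2.1)]
    exact mul_le_one₀ h1.2 h2.1 h2.2
  rw [hI]
  -- Given the graph, the fourth moment factorizes unless one of the four cross pairs meets. The
  -- first term is this defect; the second is the covariance of the two conditional means, that is,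
  -- of two meeting events.
  have hsplit : ∫ ω, I (fun m => Z m ω) ∂P - (∫ ω, pairMean c a b (fun m => Z m ω) ∂P) *
      ∫ ω, pairMean c a' b' (fun m => Z m ω) ∂P =
      (∫ ω, (I (fun m => Z m ω) - pairMean c a b (fun m => Z m ω) *
        pairMean c a' b' (fun m => Z m ω)) ∂P) + (1 - c) ^ 2 *
      (P.real ({ω | Meet (fun m => Z m ω) a b} ∩ {ω | Meet (fun m => Z m ω) a' b'}) -
        P.real {ω | Meet (fun m => Z m ω) a b} * P.real {ω | Meet (fun m => Z m ω) a' b'}) := by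
    rw [← henv.integral_pairMean_mul, integral_sub hIint hpp]
    ring
  rw [hsplit]
  refine (abs_add_le _ _).trans (add_le_add ?_ ?_)
  · have hms : ∀ x y, MeasurableSet {ω | Meet (fun m => Z m ω) x y} := fun x y =>
      henv.measurable_edges (measurableSet_meet x y)
    have hi : ∀ x y, Integrable (fun ω => {ω | Meet (fun m => Z m ω) x y}.indicator
        (1 : Ω → ℝ) ω) P := fun x y => (integrable_const (1 : ℝ)).indicator (hms x y)
    have hpt : ∀ ω, |I (fun m => Z m ω) - pairMean c a b (fun m => Z m ω) *
        pairMean c a' b' (fun m => Z m ω)| ≤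
        2 * ({ω | Meet (fun m => Z m ω) a a'}.indicator 1 ω +
          {ω | Meet (fun m => Z m ω) a b'}.indicator 1 ω +
          {ω | Meet (fun m => Z m ω) b a'}.indicator 1 ω +
          {ω | Meet (fun m => Z m ω) b b'}.indicator 1 ω) := fun ω => by
      have hnn : ∀ x y, 0 ≤ {ω | Meet (fun m => Z m ω) x y}.indicator (1 : Ω → ℝ) ω :=
        fun x y => Set.indicator_nonneg (fun _ _ => zero_le_one) _
      have hone : ∀ x y, Meet (fun m => Z m ω) x y →
          {ω | Meet (fun m => Z m ω) x y}.indicator (1 : Ω → ℝ) ω = 1 :=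
        fun x y h => Set.indicator_of_mem (s := {ω | Meet (fun m => Z m ω) x y}) h _
      have hle : |I (fun m => Z m ω) - pairMean c a b (fun m => Z m ω) *
          pairMean c a' b' (fun m => Z m ω)| ≤ 2 := by
        have h1 := pairMean_mem hc0 hc1 a b (fun m => Z m ω)
        have h2 := pairMean_mem hc0 hc1 a' b' (fun m => Z m ω)
        refine (abs_sub _ _).trans ?_
        rw [abs_of_nonneg (mul_nonneg h1.1 h2.1)]
        have h3 := mul_le_one₀ h1.2 h2.1 h2.2
        have h4 := hIabs (fun m => Z m ω)
        linarith
      by_cases h₁ : Meet (fun m => Z m ω) a a'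
      · linarith [hone _ _ h₁, hnn a b', hnn b a', hnn b b']
      by_cases h₂ : Meet (fun m => Z m ω) a b'
      · linarith [hone _ _ h₂, hnn a a', hnn b a', hnn b b']
      by_cases h₃ : Meet (fun m => Z m ω) b a'
      · linarith [hone _ _ h₃, hnn a b', hnn a a', hnn b b']
      by_cases h₄ : Meet (fun m => Z m ω) b b'
      · linarith [hone _ _ h₄, hnn a b', hnn b a', hnn a a']
      have h0 : I (fun m => Z m ω) - pairMean c a b (fun m => Z m ω) *
          pairMean c a' b' (fun m => Z m ω) = 0 :=
        sub_eq_zero.2 (henv.integral_sign_mul_mul hp hN _ h₁ h₂ h₃ h₄)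
      rw [h0, abs_zero]
      have := hnn a b'
      have := hnn a a'
      have := hnn b a'
      have := hnn b b'
      positivity
    refine (abs_integral_le_integral_abs).trans ?_
    have hi₂ : Integrable (fun ω => {ω | Meet (fun m => Z m ω) a a'}.indicator (1 : Ω → ℝ) ω +
        {ω | Meet (fun m => Z m ω) a b'}.indicator 1 ω) P := (hi a a').add (hi a b')
    have hi₃ : Integrable (fun ω => {ω | Meet (fun m => Z m ω) a a'}.indicator (1 : Ω → ℝ) ω +
        {ω | Meet (fun m => Z m ω) a b'}.indicator 1 ω +
        {ω | Meet (fun m => Z m ω) b a'}.indicator 1 ω) P := hi₂.add (hi b a')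
    refine (integral_mono (hIint.sub hpp).abs ((hi₃.add (hi b b')).const_mul 2) hpt).trans ?_
    refine le_of_eq ?_
    simp only [Pi.add_apply]
    rw [integral_const_mul, integral_add hi₃ (hi b b'),
      integral_add hi₂ (hi b a'), integral_add (hi a a') (hi a b'),
      integral_indicator_one (hms _ _), integral_indicator_one (hms _ _),
      integral_indicator_one (hms _ _), integral_indicator_one (hms _ _)]
  · rw [abs_mul]
    refine mul_le_of_le_one_left (abs_nonneg _) ?_
    rw [abs_of_nonneg (sq_nonneg _)]
    nlinarith

end Moments

/-! ### Variance of the innovations and decorrelation of the field. -/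

section Innovations

variable {d : ℕ} {μ : Measure (Site d)} {p : ℝ} {Ω : Type*}

lemma one_le_tsum_green_sq (hμ : IsStepLaw μ) (hd : 1 ≤ d) : 1 ≤ ∑' n, green μ n ^ 2 := by
  rw [← common_self μ 0, ← tsum_common_sub hμ hd]
  exact le_add_self

/-- The mean `∫ X_{l-z} dμ(z)` as a function of the field on the sites that avoid `k`. -/
lemma exists_measurable_mean [IsProbabilityMeasure μ] (hμ : IsStepLaw μ) {k l : Site d}
    (h : ∀ z : Site d, (∀ i, 0 < z i) → Avoids k (l - z)) (X : Site d → Ω → ℝ) :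
    ∃ G : ({j // Avoids k j} → ℝ) → ℝ, Measurable G ∧
      ∀ ω, G (fun j => X j ω) = ∫ z, X (l - z) ω ∂μ := by
  classical
  let g : Site d → ({j // Avoids k j} → ℝ) → ℝ := fun z x =>
    if h : Avoids k (l - z) then x ⟨l - z, h⟩ else 0
  have hgm : Measurable fun q : ({j // Avoids k j} → ℝ) × Site d => g q.2 q.1 := by
    refine measurable_from_prod_countable_left fun z => ?_
    by_cases h : Avoids k (l - z)
    · simp only [g, h, dif_pos]; exact measurable_pi_apply _
    · simp only [g, h, dif_neg, not_false_eq_true]; exact measurable_const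
  refine ⟨fun x => ∫ z, g z x ∂μ, (hgm.stronglyMeasurable.integral_prod_right').measurable,
    fun ω => integral_congr_ae ?_⟩
  change ∀ᵐ z ∂μ, g z (fun j => X j ω) = X (l - z) ω
  rw [ae_iff_of_countable]
  intro z hz
  simp only [g, dif_pos (h z (hμ.pos_of_ne_zero hz))]

variable [MeasurableSpace Ω] {P : Measure Ω} {Z : Site d → Ω → Site d} {ε : ℕ → Ω → ℝ}
  {N : (Site d → Site d) → Site d → ℕ}

/-- Meeting events are determined by the edges and translate with them, so this is mixing of the
i.i.d. edges. -/
lemma IsRegularEnvironment.tendsto_meet_inter [IsProbabilityMeasure μ]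
    (henv : IsRegularEnvironment P μ p Z ε) (a b a' b' : Site d) :
    Tendsto (fun k =>
      P.real ({ω | Meet (fun m => Z m ω) a b} ∩ {ω | Meet (fun m => Z m ω) (a' + k) (b' + k)}) -
        P.real {ω | Meet (fun m => Z m ω) a b} *
        P.real {ω | Meet (fun m => Z m ω) (a' + k) (b' + k)}) cofinite (𝓝 0) := by
  have hA := measurableSet_meet a b
  have hB := measurableSet_meet a' b'
  have hmap : ∀ {S : Set (Site d → Site d)}, MeasurableSet S →
      (Measure.infinitePi fun _ : Site d => μ).real S = P.real {ω | (fun m => Z m ω) ∈ S} :=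
    fun hS => by
      rw [← henv.map_edges, map_measureReal_apply henv.measurable_edges hS]; rfl
  have h := tendsto_shift_mixing μ hA hB
  have hs : ∀ k : Site d, MeasurableSet ((fun (z : Site d → Site d) m => z (m + k)) ⁻¹'
      {z | Meet z a' b'}) := fun k => (measurePreserving_shift μ k).measurable hB
  have e1 : ∀ k : Site d, (fun (z : Site d → Site d) m => z (m + k)) ⁻¹' {z | Meet z a' b'} =
      {z | Meet z (a' + k) (b' + k)} := fun k => by
    ext z; exact meet_shift z k a' b'
  have e2 : ∀ k : Site d, P.real {ω | Meet (fun m => Z m ω) (a' + k) (b' + k)} =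
      P.real {ω | Meet (fun m => Z m ω) a' b'} := fun k => by
    have := (measurePreserving_shift μ k).measureReal_preimage hB.nullMeasurableSet
    rw [hmap (hs k), hmap hB] at this
    rw [e1] at this
    exact this
  simp only [e2]
  rw [← sub_self (P.real {ω | Meet (fun m => Z m ω) a b} *
    P.real {ω | Meet (fun m => Z m ω) a' b'})]
  refine Tendsto.sub_const ?_ _
  rw [hmap hA, hmap hB] at h
  refine h.congr fun k => ?_
  rw [hmap (hA.inter (hs k)), e1]
  rfl

variable [IsProbabilityMeasure P]

/-- The diagonal recursion for `common`, rewritten by the meeting formula. -/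
lemma IsRegularEnvironment.lintegral_meet_add_one (henv : IsRegularEnvironment P μ p Z ε)
    (hμ : IsStepLaw μ) (hd : 1 ≤ d) (k : Site d) :
    (∫⁻ z, P {ω | Meet (fun m => Z m ω) k (k - z)} ∂μ) * (∑' n, green μ n ^ 2) + 1 =
      ∑' n, green μ n ^ 2 := by
  rw [lintegral_countable', ← ENNReal.tsum_mul_right, ← common_self μ k, ← tsum_common_sub hμ hd k]
  congr 1
  refine tsum_congr fun z => ?_
  rw [mul_right_comm, tsum_common_sub hμ hd k, common_self,
    henv.measure_meet_mul hμ hd henv.pos, mul_comm]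

lemma IsRegularEnvironment.integral_meet [IsProbabilityMeasure μ]
    (henv : IsRegularEnvironment P μ p Z ε)
    (hμ : IsStepLaw μ) (hd : 1 ≤ d) (hg : ∑' n, green μ n ^ 2 ≠ ∞) (k : Site d) :
    ∫ z, P.real {ω | Meet (fun m => Z m ω) k (k - z)} ∂μ =
      1 - 1 / (∑' n, green μ n ^ 2).toReal := by
  have h := henv.lintegral_meet_add_one hμ hd k
  have h1 := one_le_tsum_green_sq hμ hd
  set g := ∑' n, green μ n ^ 2
  have hle : ∫⁻ z, P {ω | Meet (fun m => Z m ω) k (k - z)} ∂μ ≤ 1 := by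
    refine (lintegral_mono fun z => prob_le_one).trans ?_
    simp
  have hne : ∫⁻ z, P {ω | Meet (fun m => Z m ω) k (k - z)} ∂μ ≠ ∞ :=
    ne_top_of_le_ne_top ENNReal.one_ne_top hle
  have hI : ∫ z, P.real {ω | Meet (fun m => Z m ω) k (k - z)} ∂μ =
      (∫⁻ z, P {ω | Meet (fun m => Z m ω) k (k - z)} ∂μ).toReal :=
    integral_toReal (measurable_of_countable _).aemeasurable
      (ae_of_all _ fun z => measure_lt_top _ _)
  have h2 := congrArg ENNReal.toReal h
  rw [ENNReal.toReal_add (ENNReal.mul_ne_top hne hg) ENNReal.one_ne_top, ENNReal.toReal_mul,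
    ENNReal.toReal_one] at h2
  have hpos : 0 < g.toReal :=
    ENNReal.toReal_pos (fun e => by simp [e] at h1) hg
  rw [hI, eq_sub_iff_add_eq]
  field_simp
  linarith

/-- With `M` the mean over `μ` and `Y = X - M`, the relations `X² = 1` and `E(Y M) = 0` give `E Y² =
1 - E(X M)`, and `E(X M)` follows from the averaged meeting probability. -/
theorem IsRegularEnvironment.integral_innov_sq [IsProbabilityMeasure μ]
    (henv : IsRegularEnvironment P μ p Z ε) (hp : 0 < p ∧ p < 1)
    (hμ : IsStepLaw μ) (hd : 1 ≤ d) (hN : IsNumbering N)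
    (hg : ∑' n, green μ n ^ 2 ≠ ∞) (k : Site d) :
    ∫ ω, innov μ (field N Z ε) k ω ^ 2 ∂P =
      (1 - (2 * p - 1) ^ 2) / (∑' n, green μ n ^ 2).toReal := by
  set X := field N Z ε with hX
  obtain ⟨G, hG, hGX⟩ := exists_measurable_mean hμ (fun z hz => avoids_self_sub hd k hz) X
  have hYM : ∫ ω, innov μ X k ω * ∫ z, X (k - z) ω ∂μ ∂P = 0 := by
    have := henv.integral_innov_smul hμ hd hN k hG.stronglyMeasurable (c := 1)
      (fun ω => by rw [hGX]; exact henv.abs_mean_le k ω)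
    simpa only [smul_eq_mul, ← hX, hGX] using this
  have hXm : Measurable (X k) := henv.measurable_field hN k
  have hMm : Measurable fun ω => ∫ z, X (k - z) ω ∂μ := henv.measurable_mean hN k
  have hYm : Measurable (innov μ X k) := henv.measurable_innov hN k
  have hYMi : Integrable (fun ω => innov μ X k ω * ∫ z, X (k - z) ω ∂μ) P := by
    refine Integrable.of_bound (hYm.mul hMm).aestronglyMeasurable (2 * 1) (ae_of_all _ fun ω => ?_)
    rw [norm_mul]
    exact mul_le_mul (henv.abs_innov_le k ω) (henv.abs_mean_le k ω) (norm_nonneg _) (by norm_num)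
  have hXMi : Integrable (fun ω => ∫ z, X k ω * X (k - z) ω ∂μ) P := by
    simp only [integral_const_mul]
    refine Integrable.of_bound (hXm.mul hMm).aestronglyMeasurable (1 * 1) (ae_of_all _ fun ω => ?_)
    rw [norm_mul]
    exact mul_le_mul (henv.abs_field k ω).le (henv.abs_mean_le k ω) (norm_nonneg _) (by norm_num)
  have hsq : ∀ ω, innov μ X k ω ^ 2 =
      (1 - ∫ z, X k ω * X (k - z) ω ∂μ) - innov μ X k ω * ∫ z, X (k - z) ω ∂μ := fun ω => by
    have h1 : X k ω * X k ω = 1 := henv.field_sq k ω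
    rw [integral_const_mul, innov]
    linear_combination h1
  have hi1 : Integrable (fun ω => 1 - ∫ z, X k ω * X (k - z) ω ∂μ) P :=
    (integrable_const _).sub hXMi
  simp only [hsq]
  rw [integral_sub hi1 hYMi, hYM, sub_zero, integral_sub (integrable_const _) hXMi]
  have huncurry : Integrable (Function.uncurry fun ω z => X k ω * X (k - z) ω) (P.prod μ) := by
    refine Integrable.of_bound ((hXm.comp measurable_fst).mul
      (henv.measurable_field_uncurry hN k)).aestronglyMeasurable 1 (ae_of_all _ fun q => ?_)
    simp only [Function.uncurry, norm_mul, Real.norm_eq_abs, hX, henv.abs_field, mul_one, le_refl]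
  rw [integral_integral_swap huncurry]
  have hz : ∀ z, ∫ ω, X k ω * X (k - z) ω ∂P = (2 * p - 1) ^ 2 + (1 - (2 * p - 1) ^ 2) *
      P.real {ω | Meet (fun m => Z m ω) k (k - z)} := fun z => by
    rw [hX, henv.integral_field_mul_eq hp hN, henv.integral_pairMean]
  have hri : Integrable (fun z => P.real {ω | Meet (fun m => Z m ω) k (k - z)}) μ :=
    Integrable.of_bound (measurable_of_countable _).aestronglyMeasurable 1
      (ae_of_all _ fun z => by
        rw [Real.norm_of_nonneg measureReal_nonneg]; exact measureReal_le_one)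
  simp only [hz]
  rw [integral_add (integrable_const _) (hri.const_mul _), integral_const_mul,
    henv.integral_meet hμ hd hg]
  simp only [integral_const, probReal_univ, smul_eq_mul, one_mul]
  ring

/-- Because `∑ g² ≥ 1`, the meeting probability is at most `common`, which vanishes at infinity. -/
lemma IsRegularEnvironment.tendsto_meet (henv : IsRegularEnvironment P μ p Z ε)
    (hμ : IsStepLaw μ) (hd : 1 ≤ d) (hg : ∑' n, green μ n ^ 2 ≠ ∞) (a b : Site d) :
    Tendsto (fun k => P.real {ω | Meet (fun m => Z m ω) a (b + k)}) cofinite (𝓝 0) := by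
  have h1 := (tendsto_common_cofinite hg a).comp (add_right_injective b).tendsto_cofinite
  have h2 : Tendsto (fun k => P {ω | Meet (fun m => Z m ω) a (b + k)}) cofinite (𝓝 0) := by
    refine tendsto_of_tendsto_of_tendsto_of_le_of_le tendsto_const_nhds h1 (fun _ => zero_le)
      fun k => ?_
    simp only [Function.comp_apply]
    rw [← henv.measure_meet_mul hμ hd henv.pos]
    exact le_mul_of_one_le_right zero_le (one_le_tsum_green_sq hμ hd)
  exact (ENNReal.tendsto_toReal ENNReal.zero_ne_top).comp h2

lemma IsRegularEnvironment.tendsto_cov_field [IsProbabilityMeasure μ]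
    (henv : IsRegularEnvironment P μ p Z ε) (hp : 0 < p ∧ p < 1)
    (hμ : IsStepLaw μ) (hd : 1 ≤ d) (hN : IsNumbering N)
    (hg : ∑' n, green μ n ^ 2 ≠ ∞) (a b a' b' : Site d) :
    Tendsto (fun k => cov[fun ω => field N Z ε a ω * field N Z ε b ω,
        fun ω => field N Z ε (a' + k) ω * field N Z ε (b' + k) ω; P]) cofinite (𝓝 0) := by
  refine squeeze_zero_norm (fun k => henv.abs_cov_field_le hp hN a b (a' + k) (b' + k)) ?_
  have h := ((((henv.tendsto_meet hμ hd hg a a').add (henv.tendsto_meet hμ hd hg a b')).add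
    (henv.tendsto_meet hμ hd hg b a')).add (henv.tendsto_meet hμ hd hg b b')).const_mul 2
  simpa using h.add (henv.tendsto_meet_inter a b a' b').abs

end Innovations

/-- The covariance of two bounded mixtures. -/
lemma covariance_integral_integral {Ω V : Type*} [MeasurableSpace Ω] {P : Measure Ω}
    [IsProbabilityMeasure P] [MeasurableSpace V] {M : Measure V} [IsProbabilityMeasure M]
    {f g : Ω → V → ℝ} (hf : Measurable (Function.uncurry f)) (hg : Measurable (Function.uncurry g))
    {c : ℝ} (hfc : ∀ ω v, |f ω v| ≤ c) (hgc : ∀ ω v, |g ω v| ≤ c) :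
    cov[fun ω => ∫ v, f ω v ∂M, fun ω => ∫ v, g ω v ∂M; P] =
      ∫ w, cov[fun ω => f ω w.1, fun ω => g ω w.2; P] ∂(M.prod M) := by
  have hmem : ∀ {h : Ω → V → ℝ}, Measurable (Function.uncurry h) → (∀ ω v, |h ω v| ≤ c) →
      MemLp (fun ω => ∫ v, h ω v ∂M) 2 P := fun {h} hh hhc => by
    refine MemLp.of_bound hh.stronglyMeasurable.integral_prod_right'.aestronglyMeasurable c
      (ae_of_all _ fun ω => ?_)
    simpa using norm_integral_le_of_norm_le_const (μ := M) (f := fun v => h ω v)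
      (ae_of_all _ fun v => hhc ω v)
  have hmem' : ∀ {h : Ω → V → ℝ}, Measurable (Function.uncurry h) → (∀ ω v, |h ω v| ≤ c) →
      ∀ v, MemLp (fun ω => h ω v) 2 P := fun {h} hh hhc v =>
    MemLp.of_bound (hh.comp (measurable_id.prodMk measurable_const)).aestronglyMeasurable c
      (ae_of_all _ fun ω => hhc ω v)
  have hc : ∀ ω : Ω, V → 0 ≤ c := fun ω v => (abs_nonneg _).trans (hfc ω v)
  have hfg : Integrable (Function.uncurry fun ω (w : V × V) => f ω w.1 * g ω w.2)
      (P.prod (M.prod M)) := by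
    refine Integrable.of_bound (C := c * c)
      ((hf.comp (measurable_fst.prodMk (measurable_fst.comp measurable_snd))).mul
      (hg.comp (measurable_fst.prodMk (measurable_snd.comp measurable_snd)))).aestronglyMeasurable
      (ae_of_all _ fun q => ?_)
    simp only [Function.uncurry, norm_mul, Real.norm_eq_abs]
    exact mul_le_mul (hfc _ _) (hgc _ _) (abs_nonneg _) (hc q.1 q.2.1)
  have hfi : Integrable (Function.uncurry f) (P.prod M) :=
    Integrable.of_bound hf.aestronglyMeasurable c (ae_of_all _ fun q => hfc _ _)
  have hgi : Integrable (Function.uncurry g) (P.prod M) :=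
    Integrable.of_bound hg.aestronglyMeasurable c (ae_of_all _ fun q => hgc _ _)
  have e1 : ∫ ω, (∫ v, f ω v ∂M) * ∫ v, g ω v ∂M ∂P =
      ∫ w : V × V, ∫ ω, f ω w.1 * g ω w.2 ∂P ∂(M.prod M) := by
    rw [← integral_integral_swap hfg]
    congr 1 with ω
    exact (integral_prod_mul (fun v => f ω v) (fun v => g ω v)).symm
  have e2 : (∫ ω, ∫ v, f ω v ∂M ∂P) * (∫ ω, ∫ v, g ω v ∂M ∂P) =
      ∫ w : V × V, (∫ ω, f ω w.1 ∂P) * (∫ ω, g ω w.2 ∂P) ∂(M.prod M) := by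
    rw [integral_integral_swap hfi, integral_integral_swap hgi]
    exact (integral_prod_mul (fun v => ∫ ω, f ω v ∂P) (fun v => ∫ ω, g ω v ∂P)).symm
  rw [covariance_eq_sub (hmem hf hfc) (hmem hg hgc)]
  simp only [Pi.mul_apply]
  rw [e1, e2, ← integral_sub]
  · congr 1 with w
    rw [covariance_eq_sub (hmem' hf hfc w.1) (hmem' hg hgc w.2)]
    rfl
  · exact hfg.integral_prod_right
  · exact (hfi.integral_prod_right).mul_prod (hgi.integral_prod_right)

/-- Dominated convergence along `cofinite` is stated for countably generated filters. -/
instance isCountablyGenerated_cofinite {α : Type*} [Countable α] :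
    (cofinite : Filter α).IsCountablyGenerated := by
  obtain ⟨f, hf⟩ := exists_injective_nat α
  rw [← hf.comap_cofinite_eq, Nat.cofinite_eq_atTop]
  infer_instance

lemma tendsto_covariance_sub_left {Ω κ : Type*} [MeasurableSpace Ω] {P : Measure Ω}
    [IsProbabilityMeasure P] {l : Filter κ} {f₁ f₂ : Ω → ℝ} {g : κ → Ω → ℝ}
    (hf₁ : MemLp f₁ 2 P) (hf₂ : MemLp f₂ 2 P) (hg : ∀ k, MemLp (g k) 2 P)
    (h₁ : Tendsto (fun k => cov[f₁, g k; P]) l (𝓝 0))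
    (h₂ : Tendsto (fun k => cov[f₂, g k; P]) l (𝓝 0)) :
    Tendsto (fun k => cov[f₁ - f₂, g k; P]) l (𝓝 0) := by
  simp only [covariance_sub_left hf₁ hf₂ (hg _)]
  simpa using h₁.sub h₂

lemma tendsto_covariance_sub_right {Ω κ : Type*} [MeasurableSpace Ω] {P : Measure Ω}
    [IsProbabilityMeasure P] {l : Filter κ} {f : Ω → ℝ} {g₁ g₂ : κ → Ω → ℝ}
    (hf : MemLp f 2 P) (hg₁ : ∀ k, MemLp (g₁ k) 2 P) (hg₂ : ∀ k, MemLp (g₂ k) 2 P)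
    (h₁ : Tendsto (fun k => cov[f, g₁ k; P]) l (𝓝 0))
    (h₂ : Tendsto (fun k => cov[f, g₂ k; P]) l (𝓝 0)) :
    Tendsto (fun k => cov[f, g₁ k - g₂ k; P]) l (𝓝 0) := by
  simp only [covariance_sub_right hf (hg₁ _) (hg₂ _)]
  simpa using h₁.sub h₂

/-! ### Covariances of squared innovations. -/

section Squares

variable {d : ℕ} {μ : Measure (Site d)} {p : ℝ} {Ω : Type*}
  [MeasurableSpace Ω] {P : Measure Ω} {Z : Site d → Ω → Site d} {ε : ℕ → Ω → ℝ}
  {N : (Site d → Site d) → Site d → ℕ} [IsProbabilityMeasure P] [IsProbabilityMeasure μ]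

/-- By bilinearity this is a combination of sixteen covariances of products of two field values. -/
lemma IsRegularEnvironment.tendsto_cov_field_sub (henv : IsRegularEnvironment P μ p Z ε)
    (hp : 0 < p ∧ p < 1) (hμ : IsStepLaw μ) (hd : 1 ≤ d) (hN : IsNumbering N)
    (hg : ∑' n, green μ n ^ 2 ≠ ∞) (x y z w : Site d) :
    Tendsto (fun k => cov[fun ω => (field N Z ε 0 ω - field N Z ε (-x) ω) *
        (field N Z ε 0 ω - field N Z ε (-y) ω),
      fun ω => (field N Z ε k ω - field N Z ε (k - z) ω) *
        (field N Z ε k ω - field N Z ε (k - w) ω); P]) cofinite (𝓝 0) := by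
  set X := field N Z ε with hX
  let B : Site d → Site d → Ω → ℝ := fun a b ω => X a ω * X b ω
  have hB : ∀ a b, MemLp (B a b) 2 P := fun a b => henv.memLp_field_mul hN a b
  have h0 : ∀ a b a' b', Tendsto (fun k => cov[B a b, B (a' + k) (b' + k); P]) cofinite (𝓝 0) :=
    fun a b a' b' => henv.tendsto_cov_field hp hμ hd hN hg a b a' b'
  have e1 : (fun ω => (X 0 ω - X (-x) ω) * (X 0 ω - X (-y) ω)) =
      (B 0 0 - B 0 (-y)) - (B (-x) 0 - B (-x) (-y)) := by
    funext ω; simp only [B, Pi.sub_apply]; ring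
  have e2 : ∀ k, (fun ω => (X k ω - X (k - z) ω) * (X k ω - X (k - w) ω)) =
      (B (0 + k) (0 + k) - B (0 + k) (-w + k)) - (B (-z + k) (0 + k) - B (-z + k) (-w + k)) :=
    fun k => by
      funext ω; simp only [B, Pi.sub_apply, zero_add, neg_add_eq_sub]; ring
  simp only [e1, e2]
  have h1 : ∀ a b, Tendsto (fun k => cov[B a b, (B (0 + k) (0 + k) - B (0 + k) (-w + k)) -
      (B (-z + k) (0 + k) - B (-z + k) (-w + k)); P]) cofinite (𝓝 0) := fun a b =>
    tendsto_covariance_sub_right (hB _ _) (fun k => (hB _ _).sub (hB _ _))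
      (fun k => (hB _ _).sub (hB _ _))
      (tendsto_covariance_sub_right (hB _ _) (fun k => hB _ _) (fun k => hB _ _)
        (h0 _ _ _ _) (h0 _ _ _ _))
      (tendsto_covariance_sub_right (hB _ _) (fun k => hB _ _) (fun k => hB _ _)
        (h0 _ _ _ _) (h0 _ _ _ _))
  have hR : ∀ k, MemLp ((B (0 + k) (0 + k) - B (0 + k) (-w + k)) -
      (B (-z + k) (0 + k) - B (-z + k) (-w + k))) 2 P := fun k =>
    ((hB _ _).sub (hB _ _)).sub ((hB _ _).sub (hB _ _))
  exact tendsto_covariance_sub_left ((hB _ _).sub (hB _ _)) ((hB _ _).sub (hB _ _)) hR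
    (tendsto_covariance_sub_left (hB _ _) (hB _ _) hR (h1 _ _) (h1 _ _))
    (tendsto_covariance_sub_left (hB _ _) (hB _ _) hR (h1 _ _) (h1 _ _))

lemma abs_covariance_le {f g : Ω → ℝ} {a b : ℝ} (hf : Measurable f) (hg : Measurable g)
    (hfa : ∀ ω, |f ω| ≤ a) (hgb : ∀ ω, |g ω| ≤ b) : |cov[f, g; P]| ≤ 2 * (a * b) := by
  have hf2 : MemLp f 2 P := MemLp.of_bound hf.aestronglyMeasurable a (ae_of_all _ hfa)
  have hg2 : MemLp g 2 P := MemLp.of_bound hg.aestronglyMeasurable b (ae_of_all _ hgb)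
  obtain ⟨ω⟩ : Nonempty Ω := nonempty_of_isProbabilityMeasure P
  have ha : 0 ≤ a := (abs_nonneg _).trans (hfa ω)
  have hb : 0 ≤ b := (abs_nonneg _).trans (hgb ω)
  have key : ∀ {h : Ω → ℝ} {c : ℝ}, (∀ ω, |h ω| ≤ c) → |∫ ω, h ω ∂P| ≤ c := fun {h c} hc => by
    simpa using norm_integral_le_of_norm_le_const (μ := P) (f := h) (ae_of_all _ hc)
  rw [covariance_eq_sub hf2 hg2]
  refine (abs_sub _ _).trans ?_
  rw [abs_mul]
  have h1 : |∫ ω, (f * g) ω ∂P| ≤ a * b := key fun ω => by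
    rw [Pi.mul_apply, abs_mul]
    exact mul_le_mul (hfa ω) (hgb ω) (abs_nonneg _) ha
  have h2 := mul_le_mul (key hfa) (key hgb) (abs_nonneg _) ha
  linarith

/-- A squared innovation is a double mean over `μ` of products of increments. The covariance
therefore becomes a fourfold mean, whose bounded integrand vanishes at infinity pointwise. -/
theorem IsRegularEnvironment.tendsto_cov_innov_sq (henv : IsRegularEnvironment P μ p Z ε)
    (hp : 0 < p ∧ p < 1) (hμ : IsStepLaw μ) (hd : 1 ≤ d) (hN : IsNumbering N)
    (hg : ∑' n, green μ n ^ 2 ≠ ∞) :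
    Tendsto (fun k => cov[fun ω => innov μ (field N Z ε) 0 ω ^ 2,
      fun ω => innov μ (field N Z ε) k ω ^ 2; P]) cofinite (𝓝 0) := by
  set X := field N Z ε with hX
  let D : Site d → Ω → Site d × Site d → ℝ := fun k ω v =>
    (X k ω - X (k - v.1) ω) * (X k ω - X (k - v.2) ω)
  have hDm : ∀ k, Measurable (Function.uncurry (D k)) := fun k =>
    measurable_from_prod_countable_left fun v =>
      ((henv.measurable_field hN k).sub (henv.measurable_field hN (k - v.1))).mul
        ((henv.measurable_field hN k).sub (henv.measurable_field hN (k - v.2)))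
  have hDc : ∀ k ω v, |D k ω v| ≤ 4 := fun k ω v => by
    have h2 : ∀ j, |X k ω - X (k - j) ω| ≤ 2 := fun j => by
      refine (abs_sub _ _).trans ?_
      rw [henv.abs_field, henv.abs_field]; norm_num
    rw [abs_mul]
    refine (mul_le_mul (h2 _) (h2 _) (abs_nonneg _) (by norm_num)).trans (by norm_num)
  have hi : ∀ k ω, Integrable (fun z => X (k - z) ω) μ := fun k ω =>
    Integrable.of_bound (measurable_of_countable _).aestronglyMeasurable 1
      (ae_of_all _ fun z => (henv.abs_field _ ω).le)
  have hsq : ∀ k ω, innov μ X k ω ^ 2 = ∫ v, D k ω v ∂(μ.prod μ) := fun k ω => by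
    have h1 : innov μ X k ω = ∫ z, (X k ω - X (k - z) ω) ∂μ := by
      rw [integral_sub (integrable_const _) (hi k ω), innov]; simp
    rw [sq, h1]
    exact (integral_prod_mul (fun z => X k ω - X (k - z) ω) fun z => X k ω - X (k - z) ω).symm
  simp only [hsq]
  simp only [covariance_integral_integral (hDm 0) (hDm _) (hDc 0) (hDc _)]
  rw [← integral_zero ((Site d × Site d) × (Site d × Site d)) ℝ
    (μ := (μ.prod μ).prod (μ.prod μ))]
  refine tendsto_integral_filter_of_dominated_convergence (fun _ => 2 * (4 * 4))
    (Eventually.of_forall fun k => (measurable_of_countable _).aestronglyMeasurable)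
    (Eventually.of_forall fun k => ae_of_all _ fun v => ?_) (integrable_const _)
    (ae_of_all _ fun v => ?_)
  · exact abs_covariance_le ((hDm 0).comp (measurable_id.prodMk measurable_const))
      ((hDm k).comp (measurable_id.prodMk measurable_const)) (fun ω => hDc 0 ω _)
      (fun ω => hDc k ω _)
  · simpa only [D, zero_sub] using
      henv.tendsto_cov_field_sub hp hμ hd hN hg v.1.1 v.1.2 v.2.1 v.2.2

lemma IsEnvironment.integral_field_shift (henv : IsEnvironment P μ p Z ε) (hN : IsNumbering N)
    (i : Site d) {Φ : (Site d → ℝ) → ℝ} (hΦ : Measurable Φ) :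
    ∫ ω, Φ (fun j => field N Z ε (j + i) ω) ∂P = ∫ ω, Φ (fun j => field N Z ε j ω) ∂P := by
  have hm : ∀ i, Measurable fun ω j => field N Z ε (j + i) ω := fun i =>
    measurable_pi_lambda _ fun j => henv.measurable_field hN (j + i)
  have hm0 : Measurable fun ω j => field N Z ε j ω :=
    measurable_pi_lambda _ fun j => henv.measurable_field hN j
  have : P.map (fun ω j => field N Z ε (j + i) ω) = P.map (fun ω j => field N Z ε j ω) := by
    ext B hB
    rw [Measure.map_apply (hm i) hB, Measure.map_apply hm0 hB]
    exact henv.measure_field_shift hN i hB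
  rw [← integral_map (hm i).aemeasurable hΦ.aestronglyMeasurable, this,
    integral_map hm0.aemeasurable hΦ.aestronglyMeasurable]

/-- All innovations arise from one functional of the field by translation; below, `innov` is applied
to the coordinate process in order to use stationarity of the field. -/
lemma IsEnvironment.integral_innov_shift (henv : IsEnvironment P μ p Z ε) (hN : IsNumbering N)
    (i a b : Site d) {φ : ℝ → ℝ → ℝ} (hφ : Measurable (Function.uncurry φ)) :
    ∫ ω, φ (innov μ (field N Z ε) (a + i) ω) (innov μ (field N Z ε) (b + i) ω) ∂P =
      ∫ ω, φ (innov μ (field N Z ε) a ω) (innov μ (field N Z ε) b ω) ∂P := by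
  have hm : ∀ k, Measurable (innov μ (fun (j : Site d) (x : Site d → ℝ) => x j) k) := fun k => by
    have h1 : Measurable fun q : (Site d → ℝ) × Site d => q.1 (k - q.2) :=
      measurable_from_prod_countable_left fun z => measurable_pi_apply (k - z)
    exact (measurable_pi_apply k).sub (h1.stronglyMeasurable.integral_prod_right').measurable
  have h := henv.integral_field_shift hN i (hφ.comp ((hm a).prodMk (hm b)))
  have e : ∀ k ω, innov μ (fun (j : Site d) (x : Site d → ℝ) => x j) k
      (fun j => field N Z ε (j + i) ω) = innov μ (field N Z ε) (k + i) ω := fun k ω => by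
    simp only [innov, sub_add_eq_add_sub]
  simp only [Function.comp_apply, Function.uncurry, e] at h
  exact h

end Squares

/-! ### Products of innovations. -/

section Products

variable {d : ℕ} {μ : Measure (Site d)} {p : ℝ} {Ω : Type*} [IsProbabilityMeasure μ]

/-- The innovation at `l` as a function of the field on the sites that avoid `k`. -/
lemma exists_measurable_innov (hμ : IsStepLaw μ) (X : Site d → Ω → ℝ) (k l : Site d) :
    ∃ H : ({j // Avoids k j} → ℝ) → ℝ, Measurable H ∧
      (Avoids k l → ∀ ω, H (fun j => X j ω) = innov μ X l ω) := by
  by_cases h : Avoids k l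
  · obtain ⟨G, hG, hGX⟩ := exists_measurable_mean hμ (fun z hz => h.sub hz) X
    refine ⟨fun x => x ⟨l, h⟩ - G x, (measurable_pi_apply _).sub hG, fun _ ω => ?_⟩
    simp only [hGX, innov]
  -- The junk value allows a choice of `H` for all sites `l` at once.
  · exact ⟨0, measurable_zero, fun h' => absurd h' h⟩

variable [MeasurableSpace Ω] {P : Measure Ω} {Z : Site d → Ω → Site d} {ε : ℕ → Ω → ℝ}
  {N : (Site d → Site d) → Site d → ℕ} [IsProbabilityMeasure P]

lemma IsRegularEnvironment.integral_innov (henv : IsRegularEnvironment P μ p Z ε)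
    (hμ : IsStepLaw μ) (hd : 1 ≤ d) (hN : IsNumbering N) (k : Site d) :
    ∫ ω, innov μ (field N Z ε) k ω ∂P = 0 := by
  have h := henv.integral_innov_smul hμ hd hN k (F := fun _ => (1 : ℝ))
    stronglyMeasurable_const (c := 1) (fun ω => by simp)
  simpa using h

lemma IsRegularEnvironment.integral_innov_mul (henv : IsRegularEnvironment P μ p Z ε)
    (hμ : IsStepLaw μ) (hd : 1 ≤ d) (hN : IsNumbering N) {j k : Site d} (hjk : j ≠ k) :
    ∫ ω, innov μ (field N Z ε) j ω * innov μ (field N Z ε) k ω ∂P = 0 := by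
  have key : ∀ {j k : Site d}, Avoids j k →
      ∫ ω, innov μ (field N Z ε) j ω * innov μ (field N Z ε) k ω ∂P = 0 := fun {j k} h => by
    obtain ⟨H, hH, hHX⟩ := exists_measurable_innov hμ (field N Z ε) j k
    have := henv.integral_innov_smul hμ hd hN j hH.stronglyMeasurable (c := 2)
      (fun ω => by rw [hHX h]; exact henv.abs_innov_le k ω)
    simpa only [hHX h, smul_eq_mul] using this
  rcases avoids_or_avoids hd hjk with h | h
  · simpa only [mul_comm] using key h
  · exact key h

/-- This replaces the martingale property, for which the partially ordered index set offers no
filtration along a line: one factor at a time is removed by orthogonality to the field on the sites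
it may ignore. -/
theorem IsRegularEnvironment.integral_prod_one_add (henv : IsRegularEnvironment P μ p Z ε)
    (hμ : IsStepLaw μ) (hd : 1 ≤ d) (hN : IsNumbering N) (s : Finset (Site d)) (a : Site d → ℝ) :
    ∫ ω, ∏ j ∈ s, (1 + Complex.I * ((a j * innov μ (field N Z ε) j ω : ℝ) : ℂ)) ∂P = 1 := by
  classical
  induction s using Finset.strongInduction with
  | H s ih =>
    rcases s.eq_empty_or_nonempty with rfl | hs
    · simp
    -- No other site of `s` is strictly above a site with maximal coordinate sum, so all of them
    -- avoid it.
    obtain ⟨j, hj, hmax⟩ := s.exists_max_image (fun j => ∑ i, j i) hs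
    have hav : ∀ k ∈ s.erase j, Avoids j k := fun k hk => by
      refine ⟨Finset.ne_of_mem_erase hk, fun h => ?_⟩
      refine absurd (hmax k (Finset.mem_of_mem_erase hk)) (not_le.2 ?_)
      exact Finset.sum_lt_sum_of_nonempty ⟨⟨0, hd⟩, Finset.mem_univ _⟩ fun i _ => h i
    choose H hH hHX using exists_measurable_innov hμ (field N Z ε) j
    let F : ({k // Avoids j k} → ℝ) → ℂ := fun x =>
      ∏ k ∈ s.erase j, (1 + Complex.I * ((a k * H k x : ℝ) : ℂ))
    have hFm : Measurable F := Finset.measurable_prod _ fun k _ =>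
      ((Complex.measurable_ofReal.comp ((hH k).const_mul (a k))).const_mul _).const_add _
    have hFX : ∀ ω, F (fun k => field N Z ε k ω) =
        ∏ k ∈ s.erase j, (1 + Complex.I * ((a k * innov μ (field N Z ε) k ω : ℝ) : ℂ)) :=
      fun ω => Finset.prod_congr rfl fun k hk => by rw [hHX k (hav k hk)]
    have hFc : ∀ ω, ‖F (fun k => field N Z ε k ω)‖ ≤ ∏ k ∈ s.erase j, (1 + |a k| * 2) :=
      fun ω => by
        rw [hFX, norm_prod]
        refine Finset.prod_le_prod (fun _ _ => norm_nonneg _) fun k _ => ?_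
        refine (norm_add_le _ _).trans ?_
        rw [norm_one, norm_mul, Complex.norm_I, one_mul, Complex.norm_real, norm_mul]
        exact add_le_add_right
          (mul_le_mul_of_nonneg_left (henv.abs_innov_le k ω) (abs_nonneg _)) _
    have horth := henv.integral_innov_smul hμ hd hN j hFm.stronglyMeasurable hFc
    have hW : Measurable fun ω (k : {k // Avoids j k}) => field N Z ε k ω :=
      measurable_pi_lambda _ fun k => henv.measurable_field hN k
    have hFi : Integrable (fun ω => F (fun k => field N Z ε k ω)) P :=
      Integrable.of_bound (hFm.comp hW).aestronglyMeasurable _ (ae_of_all _ hFc)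
    have hYFi : Integrable (fun ω => innov μ (field N Z ε) j ω •
        F (fun k => field N Z ε k ω)) P := by
      refine Integrable.bdd_smul hFi 2
        (henv.measurable_innov hN j).aestronglyMeasurable (ae_of_all _ fun ω => ?_)
      exact henv.abs_innov_le j ω
    have hsplit : ∀ ω, ∏ k ∈ s, (1 + Complex.I * ((a k * innov μ (field N Z ε) k ω : ℝ) : ℂ)) =
        F (fun k => field N Z ε k ω) + (Complex.I * a j) * (innov μ (field N Z ε) j ω •
          F (fun k => field N Z ε k ω)) := fun ω => by
      rw [← Finset.mul_prod_erase s _ hj, hFX, Complex.real_smul]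
      push_cast
      ring
    simp only [hsplit]
    rw [integral_add hFi (hYFi.const_mul _), integral_const_mul, horth, mul_zero, add_zero]
    simp only [hFX]
    exact ih _ (Finset.erase_ssubset hj)

end Products

/-! ### McLeish's estimate for characteristic functions. -/

section CentralLimit

lemma norm_prod_sub_prod_le {ι : Type*} (s : Finset ι) (f g : ι → ℂ) (hf : ∀ i ∈ s, ‖f i‖ ≤ 1)
    (hg : ∀ i ∈ s, ‖g i‖ ≤ 1) : ‖∏ i ∈ s, f i - ∏ i ∈ s, g i‖ ≤ ∑ i ∈ s, ‖f i - g i‖ := by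
  classical
  induction s using Finset.induction_on with
  | empty => simp
  | insert a s ha ih =>
    rw [Finset.prod_insert ha, Finset.prod_insert ha, Finset.sum_insert ha]
    have hs := ih (fun i hi => hf i (Finset.mem_insert_of_mem hi))
      (fun i hi => hg i (Finset.mem_insert_of_mem hi))
    have h1 : ‖∏ i ∈ s, f i‖ ≤ 1 := by
      rw [norm_prod]
      exact Finset.prod_le_one (fun _ _ => norm_nonneg _)
        fun i hi => hf i (Finset.mem_insert_of_mem hi)
    have h2 := hg a (Finset.mem_insert_self a s)
    have e : f a * ∏ i ∈ s, f i - g a * ∏ i ∈ s, g i =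
        (f a - g a) * ∏ i ∈ s, f i + g a * (∏ i ∈ s, f i - ∏ i ∈ s, g i) := by ring
    rw [e]
    refine (norm_add_le _ _).trans (add_le_add ?_ ?_)
    · rw [norm_mul]; exact mul_le_of_le_one_right (norm_nonneg _) h1
    · rw [norm_mul]
      exact (mul_le_of_le_one_left (norm_nonneg _) h2).trans hs

lemma norm_one_add_I_mul_le (x : ℝ) : ‖1 + Complex.I * (x : ℂ)‖ ≤ Real.exp (x ^ 2 / 2) := by
  have h : ‖1 + Complex.I * (x : ℂ)‖ ^ 2 = 1 + x ^ 2 := by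
    rw [Complex.sq_norm, Complex.normSq_apply]
    simp
    ring
  refine le_of_sq_le_sq ?_ (Real.exp_pos _).le
  rw [h, ← Real.exp_nat_mul]
  have := Real.add_one_le_exp (x ^ 2)
  push_cast
  rw [mul_div_cancel₀ _ (two_ne_zero)]
  linarith

/-- Taylor expansion for `|x| ≤ 1`, where the second-order terms cancel. For `|x| > 1` both terms
have norm at most one. -/
lemma norm_exp_I_sub_le (x : ℝ) :
    ‖Complex.exp (Complex.I * x) - (1 + Complex.I * x) * (Real.exp (-(x ^ 2 / 2)) : ℂ)‖ ≤
      2 * |x| ^ 3 := by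
  have hfac : ‖(1 + Complex.I * x) * (Real.exp (-(x ^ 2 / 2)) : ℂ)‖ ≤ 1 := by
    rw [norm_mul, Complex.norm_real, Real.norm_of_nonneg (Real.exp_pos _).le]
    calc _ ≤ Real.exp (x ^ 2 / 2) * Real.exp (-(x ^ 2 / 2)) :=
          mul_le_mul_of_nonneg_right (norm_one_add_I_mul_le x) (Real.exp_pos _).le
      _ = 1 := by rw [← Real.exp_add]; simp
  rcases le_or_gt |x| 1 with hx | hx
  · have hI : ‖Complex.I * (x : ℂ)‖ = |x| := by simp
    have h1 := Complex.exp_bound (x := Complex.I * x) (by rw [hI]; exact hx) (n := 3) (by norm_num)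
    rw [hI] at h1
    have hx2 : |-(x ^ 2 / 2)| ≤ 1 := by
      rw [abs_neg, abs_of_nonneg (by positivity)]
      have : x ^ 2 ≤ 1 := by rw [← sq_abs]; exact pow_le_one₀ (abs_nonneg _) hx
      linarith
    have h2 := Real.abs_exp_sub_one_sub_id_le hx2
    set r₁ := Complex.exp (Complex.I * x) -
      ∑ m ∈ Finset.range 3, (Complex.I * (x : ℂ)) ^ m / m.factorial with hr₁
    set r₂ := Real.exp (-(x ^ 2 / 2)) - 1 - -(x ^ 2 / 2) with hr₂
    have e : Complex.exp (Complex.I * x) - (1 + Complex.I * x) * (Real.exp (-(x ^ 2 / 2)) : ℂ) =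
        r₁ + Complex.I * ((x ^ 3 / 2 : ℝ) : ℂ) - (1 + Complex.I * x) * (r₂ : ℂ) := by
      rw [hr₁, hr₂]
      simp only [Finset.sum_range_succ, Finset.sum_range_zero, Nat.factorial]
      push_cast
      have := Complex.I_sq
      linear_combination (x : ℂ) ^ 2 / 2 * this
    rw [e]
    have h3 : ‖Complex.I * ((x ^ 3 / 2 : ℝ) : ℂ)‖ = |x| ^ 3 / 2 := by
      rw [norm_mul, Complex.norm_I, one_mul, Complex.norm_real, Real.norm_eq_abs, abs_div, abs_pow,
        abs_two]
    have h4 : ‖(1 + Complex.I * x) * (r₂ : ℂ)‖ ≤ 2 * (|x| ^ 3 / 4) := by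
      rw [norm_mul, Complex.norm_real, Real.norm_eq_abs]
      refine mul_le_mul ?_ (h2.trans ?_) (abs_nonneg _) (by norm_num)
      · refine (norm_add_le _ _).trans ?_
        rw [hI, norm_one]; linarith
      · have : (-(x ^ 2 / 2)) ^ 2 = |x| ^ 3 * |x| / 4 := by
          rw [← sq_abs x]; ring
        rw [this]
        have := mul_le_of_le_one_right (pow_nonneg (abs_nonneg x) 3) hx
        linarith
    have h5 : |x| ^ 3 * ((Nat.succ 3 : ℝ) * ((Nat.factorial 3 : ℝ) * (3 : ℕ))⁻¹) ≤ |x| ^ 3 / 2 := by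
      have : ((Nat.succ 3 : ℝ) * ((Nat.factorial 3 : ℝ) * (3 : ℕ))⁻¹) ≤ 1 / 2 := by
        norm_num [Nat.factorial]
      have := mul_le_mul_of_nonneg_left this (pow_nonneg (abs_nonneg x) 3)
      linarith
    have h6 := norm_sub_le (r₁ + Complex.I * ((x ^ 3 / 2 : ℝ) : ℂ)) ((1 + Complex.I * x) * (r₂ : ℂ))
    have h7 := norm_add_le r₁ (Complex.I * ((x ^ 3 / 2 : ℝ) : ℂ))
    linarith [pow_nonneg (abs_nonneg x) 3]
  · refine (norm_sub_le _ _).trans ?_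
    have : ‖Complex.exp (Complex.I * x)‖ = 1 := by rw [mul_comm, Complex.norm_exp_ofReal_mul_I]
    have h3 : 1 ≤ |x| ^ 3 := one_le_pow₀ hx.le
    linarith

lemma abs_exp_neg_sub_exp_neg_le {x y : ℝ} (hx : 0 ≤ x) (hy : 0 ≤ y) :
    |Real.exp (-x) - Real.exp (-y)| ≤ |x - y| := by
  have key : ∀ {x y : ℝ}, 0 ≤ x → x ≤ y → |Real.exp (-x) - Real.exp (-y)| ≤ |x - y| :=
    fun {x y} hx hxy => by
      rw [abs_of_nonneg (sub_nonneg.2 (Real.exp_le_exp.2 (by linarith))), abs_sub_comm,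
        abs_of_nonneg (sub_nonneg.2 hxy)]
      have h1 : Real.exp (-y) = Real.exp (-x) * Real.exp (-(y - x)) := by
        rw [← Real.exp_add]; congr 1; ring
      have h2 := Real.add_one_le_exp (-(y - x))
      have h3 : Real.exp (-x) ≤ 1 := Real.exp_le_one_iff.2 (by linarith)
      have h4 := Real.exp_pos (-x)
      rw [h1]
      nlinarith
  rcases le_total x y with h | h
  · exact key hx h
  · rw [abs_sub_comm, abs_sub_comm x]; exact key hy h

variable {Ω : Type*} [MeasurableSpace Ω] {P : Measure Ω} [IsProbabilityMeasure P]

/-- With `T = ∏ (1 + i x_j)` and `V = ∑ x_j²`, the exponential is replaced by `T e^{-V/2}` at a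
third-order cost, then by `T e^{-v/2}` at the cost of `|V - v|`, as `|T| ≤ e^{B²K/2}`. The last term
has mean `e^{-v/2}` because `E T = 1`. -/
lemma norm_integral_exp_sub_le {ι : Type*} {Y : ι → Ω → ℝ} {B v : ℝ} (hB : 0 ≤ B)
    (hYm : ∀ j, Measurable (Y j)) (hYB : ∀ j ω, |Y j ω| ≤ B)
    (hprod : ∀ (s : Finset ι) (a : ι → ℝ),
      ∫ ω, ∏ j ∈ s, (1 + Complex.I * ((a j * Y j ω : ℝ) : ℂ)) ∂P = 1)
    (s : Finset ι) (b : ι → ℝ) (hv : 0 ≤ v) {m K : ℝ} (hm : 0 ≤ m) (hb : ∀ j ∈ s, |b j| ≤ m)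
    (hK : ∑ j ∈ s, b j ^ 2 ≤ K) :
    ‖∫ ω, Complex.exp (Complex.I * ((∑ j ∈ s, b j * Y j ω : ℝ) : ℂ)) ∂P -
        (Real.exp (-(v / 2)) : ℂ)‖ ≤
      2 * (B ^ 3 * m * K) + Real.exp (B ^ 2 * K / 2) *
        ∫ ω, |∑ j ∈ s, (b j * Y j ω) ^ 2 - v| ∂P := by
  let T : Ω → ℂ := fun ω => ∏ j ∈ s, (1 + Complex.I * ((b j * Y j ω : ℝ) : ℂ))
  let V : Ω → ℝ := fun ω => ∑ j ∈ s, (b j * Y j ω) ^ 2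
  have hx : ∀ j ω, (b j * Y j ω) ^ 2 ≤ B ^ 2 * b j ^ 2 := fun j ω => by
    rw [mul_pow, mul_comm]
    exact mul_le_mul_of_nonneg_right (sq_le_sq.2 ((hYB j ω).trans (le_abs_self _))) (sq_nonneg _)
  have hV : ∀ ω, V ω ≤ B ^ 2 * K := fun ω => by
    refine (Finset.sum_le_sum fun j _ => hx j ω).trans ?_
    rw [← Finset.mul_sum]
    exact mul_le_mul_of_nonneg_left hK (sq_nonneg _)
  have hV0 : ∀ ω, 0 ≤ V ω := fun ω => Finset.sum_nonneg fun _ _ => sq_nonneg _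
  have hT : ∀ ω, ‖T ω‖ ≤ Real.exp (B ^ 2 * K / 2) := fun ω => by
    simp only [T]
    rw [norm_prod]
    refine (Finset.prod_le_prod (fun _ _ => norm_nonneg _)
      fun j _ => norm_one_add_I_mul_le _).trans ?_
    rw [← Real.exp_sum, ← Finset.sum_div]
    exact Real.exp_le_exp.2 (div_le_div_of_nonneg_right (hV ω) (by norm_num))
  have hTm : Measurable T := Finset.measurable_prod _ fun j _ =>
    ((Complex.measurable_ofReal.comp ((hYm j).const_mul (b j))).const_mul _).const_add _
  have hVm : Measurable V := Finset.measurable_sum _ fun j _ => ((hYm j).const_mul (b j)).pow_const 2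
  have hSm : Measurable fun ω => ∑ j ∈ s, b j * Y j ω :=
    Finset.measurable_sum _ fun j _ => (hYm j).const_mul (b j)
  have hTi : Integrable T P := Integrable.of_bound hTm.aestronglyMeasurable _ (ae_of_all _ hT)
  have hEi : Integrable (fun ω => Complex.exp (Complex.I * ((∑ j ∈ s, b j * Y j ω : ℝ) : ℂ))) P := by
    refine Integrable.of_bound (Complex.measurable_exp.comp
      ((Complex.measurable_ofReal.comp hSm).const_mul _)).aestronglyMeasurable 1
      (ae_of_all _ fun ω => ?_)
    rw [mul_comm, Complex.norm_exp_ofReal_mul_I]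
  have hTVi : Integrable (fun ω => T ω * (Real.exp (-(V ω / 2)) : ℂ)) P := by
    refine hTi.mul_bdd (c := 1) (Complex.measurable_ofReal.comp (Real.measurable_exp.comp
      (hVm.div_const 2).neg)).aestronglyMeasurable (ae_of_all _ fun ω => ?_)
    rw [Complex.norm_real, Real.norm_of_nonneg (Real.exp_pos _).le]
    exact Real.exp_le_one_iff.2 (by linarith [hV0 ω])
  have hVi : Integrable (fun ω => |V ω - v|) P :=
    ((Integrable.of_bound hVm.aestronglyMeasurable (B ^ 2 * K) (ae_of_all _ fun ω => by
      rw [Real.norm_of_nonneg (hV0 ω)]; exact hV ω)).sub (integrable_const _)).abs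
  have hT1 : ∫ ω, T ω * (Real.exp (-(v / 2)) : ℂ) ∂P = (Real.exp (-(v / 2)) : ℂ) := by
    rw [integral_mul_const]
    simp only [T]
    rw [hprod s b, one_mul]
  have h1 : ∀ ω, ‖Complex.exp (Complex.I * ((∑ j ∈ s, b j * Y j ω : ℝ) : ℂ)) -
      T ω * (Real.exp (-(V ω / 2)) : ℂ)‖ ≤ 2 * (B ^ 3 * m * K) := fun ω => by
    have e1 : Complex.exp (Complex.I * ((∑ j ∈ s, b j * Y j ω : ℝ) : ℂ)) =
        ∏ j ∈ s, Complex.exp (Complex.I * ((b j * Y j ω : ℝ) : ℂ)) := by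
      rw [← Complex.exp_sum, ← Finset.mul_sum, Complex.ofReal_sum]
    have e2 : T ω * (Real.exp (-(V ω / 2)) : ℂ) = ∏ j ∈ s,
        (1 + Complex.I * ((b j * Y j ω : ℝ) : ℂ)) * (Real.exp (-((b j * Y j ω) ^ 2 / 2)) : ℂ) := by
      rw [Finset.prod_mul_distrib, ← Complex.ofReal_prod, ← Real.exp_sum, Finset.sum_neg_distrib,
        ← Finset.sum_div]
    rw [e1, e2]
    refine (norm_prod_sub_prod_le s _ _ (fun j _ => ?_) fun j _ => ?_).trans ?_
    · rw [mul_comm, Complex.norm_exp_ofReal_mul_I]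
    · rw [norm_mul, Complex.norm_real, Real.norm_of_nonneg (Real.exp_pos _).le]
      calc _ ≤ Real.exp ((b j * Y j ω) ^ 2 / 2) * Real.exp (-((b j * Y j ω) ^ 2 / 2)) :=
            mul_le_mul_of_nonneg_right (norm_one_add_I_mul_le _) (Real.exp_pos _).le
        _ = 1 := by rw [← Real.exp_add]; simp
    · refine (Finset.sum_le_sum fun j _ => norm_exp_I_sub_le _).trans ?_
      rw [← Finset.mul_sum]
      refine mul_le_mul_of_nonneg_left ?_ (by norm_num)
      calc ∑ j ∈ s, |b j * Y j ω| ^ 3 ≤ ∑ j ∈ s, B ^ 3 * m * b j ^ 2 := by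
            refine Finset.sum_le_sum fun j hj => ?_
            rw [abs_mul, mul_pow, pow_succ |b j|, sq_abs, mul_comm]
            have := mul_le_mul (pow_le_pow_left₀ (abs_nonneg _) (hYB j ω) 3)
              (mul_le_mul_of_nonneg_left (hb j hj) (sq_nonneg (b j)))
              (by positivity) (by positivity)
            linarith
        _ ≤ B ^ 3 * m * K := by
            rw [← Finset.mul_sum]
            exact mul_le_mul_of_nonneg_left hK (by positivity)
  have h2 : ∀ ω, ‖T ω * (Real.exp (-(V ω / 2)) : ℂ) - T ω * (Real.exp (-(v / 2)) : ℂ)‖ ≤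
      Real.exp (B ^ 2 * K / 2) * |V ω - v| := fun ω => by
    rw [← mul_sub, norm_mul, ← Complex.ofReal_sub, Complex.norm_real, Real.norm_eq_abs]
    refine mul_le_mul (hT ω) ?_ (abs_nonneg _) (Real.exp_pos _).le
    refine (abs_exp_neg_sub_exp_neg_le (by linarith [hV0 ω]) (by linarith)).trans ?_
    rw [← sub_div, abs_div, abs_two]
    linarith [abs_nonneg (V ω - v)]
  have hTvi : Integrable (fun ω => T ω * (Real.exp (-(v / 2)) : ℂ)) P := hTi.mul_const _
  rw [← hT1]
  calc _ = ‖(∫ ω, (Complex.exp (Complex.I * ((∑ j ∈ s, b j * Y j ω : ℝ) : ℂ)) -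
          T ω * (Real.exp (-(V ω / 2)) : ℂ)) ∂P) + ∫ ω, (T ω * (Real.exp (-(V ω / 2)) : ℂ) -
          T ω * (Real.exp (-(v / 2)) : ℂ)) ∂P‖ := by
        rw [integral_sub hEi hTVi, integral_sub hTVi hTvi]
        congr 1
        ring
    _ ≤ _ := by
        refine (norm_add_le _ _).trans (add_le_add ?_ ?_)
        · simpa using norm_integral_le_of_norm_le_const (ae_of_all P h1)
        · rw [← integral_const_mul]
          exact norm_integral_le_of_norm_le (hVi.const_mul _) (ae_of_all _ h2)

end CentralLimit

/-! ### Concentration of the weighted squares. -/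

section Approximation

/-- A quadratic form whose kernel `γ (j - i)` is small off a finite set is small on spread out
vectors. -/
lemma sum_sum_mul_le {G : Type*} [AddCommGroup G] {γ : G → ℝ} {η δ K : ℝ} (hη : 0 ≤ η)
    (hδ : 0 ≤ δ) (F : Finset G) (hF : ∀ k ∉ F, |γ k| ≤ η) (s : Finset G) {w : G → ℝ} (hw : ∀ j, 0 ≤ w j)
    (hwδ : ∀ j ∈ s, w j ≤ δ) (hwK : ∑ j ∈ s, w j ≤ K) :
    ∑ i ∈ s, ∑ j ∈ s, w i * w j * γ (j - i) ≤ K * (η * K + δ * ∑ k ∈ F, |γ k|) := by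
  classical
  have hK : 0 ≤ K := (Finset.sum_nonneg fun j _ => hw j).trans hwK
  have hS : 0 ≤ ∑ k ∈ F, |γ k| := Finset.sum_nonneg fun _ _ => abs_nonneg _
  have h1 : ∀ i, ∑ j ∈ s, w j * γ (j - i) ≤ η * K + δ * ∑ k ∈ F, |γ k| := fun i => by
    calc ∑ j ∈ s, w j * γ (j - i)
        ≤ ∑ j ∈ s, (η * w j + if j - i ∈ F then δ * |γ (j - i)| else 0) := by
          refine Finset.sum_le_sum fun j hj => ?_
          split_ifs with h
          · have h1 := mul_le_mul_of_nonneg_left (le_abs_self (γ (j - i))) (hw j)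
            have h2 := mul_le_mul_of_nonneg_right (hwδ j hj) (abs_nonneg (γ (j - i)))
            have h3 := mul_nonneg hη (hw j)
            linarith
          · have h1 := mul_le_mul_of_nonneg_left ((le_abs_self _).trans (hF _ h)) (hw j)
            linarith
      _ ≤ η * K + δ * ∑ k ∈ F, |γ k| := by
          rw [Finset.sum_add_distrib, ← Finset.mul_sum, ← Finset.sum_filter, ← Finset.mul_sum]
          refine add_le_add (mul_le_mul_of_nonneg_left hwK hη)
            (mul_le_mul_of_nonneg_left ?_ hδ)
          rw [← Finset.sum_image (f := fun k => |γ k|) (g := fun j => j - i)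
            (fun a _ b _ h => sub_left_injective h)]
          refine Finset.sum_le_sum_of_subset_of_nonneg (fun k hk => ?_) fun _ _ _ => abs_nonneg _
          obtain ⟨j, hj, rfl⟩ := Finset.mem_image.1 hk
          exact (Finset.mem_filter.1 hj).2
  calc ∑ i ∈ s, ∑ j ∈ s, w i * w j * γ (j - i)
      = ∑ i ∈ s, w i * ∑ j ∈ s, w j * γ (j - i) := by
        refine Finset.sum_congr rfl fun i _ => ?_
        rw [Finset.mul_sum]
        exact Finset.sum_congr rfl fun j _ => by ring
    _ ≤ ∑ i ∈ s, w i * (η * K + δ * ∑ k ∈ F, |γ k|) :=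
        Finset.sum_le_sum fun i _ => mul_le_mul_of_nonneg_left (h1 i) (hw i)
    _ ≤ _ := by
        rw [← Finset.sum_mul]
        exact mul_le_mul_of_nonneg_right hwK (by positivity)

variable {Ω : Type*} [MeasurableSpace Ω] {P : Measure Ω} [IsProbabilityMeasure P]

lemma integral_abs_le_add_div {f : Ω → ℝ} (hf : Integrable f P)
    (hf2 : Integrable (fun ω => f ω ^ 2) P) {r : ℝ} (hr : 0 < r) :
    ∫ ω, |f ω| ∂P ≤ r + (∫ ω, f ω ^ 2 ∂P) / r := by
  have h : ∀ ω, |f ω| ≤ r + f ω ^ 2 / r := fun ω => by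
    rw [← sub_nonneg]
    have : r + f ω ^ 2 / r - |f ω| = ((r - |f ω| / 2) ^ 2 + 3 / 4 * |f ω| ^ 2) / r := by
      rw [← sq_abs (f ω)]
      field_simp
      ring
    rw [this]
    positivity
  refine (integral_mono hf.abs ((integrable_const r).add (hf2.div_const r)) h).trans (le_of_eq ?_)
  simp only [Pi.add_apply]
  rw [integral_add (integrable_const _) (hf2.div_const r), integral_div]
  simp

/-- The second moment of `∑ b_j² (Y_j² - v)` is a quadratic form in the weights `b_j²` with kernel
`γ (j - i)`, hence small when the weights are uniformly small and `γ` decays. The bound is uniform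
over finite sets, so it survives the passage to series. -/
lemma exists_norm_integral_exp_sub_le {G : Type*} [AddCommGroup G] {Y : G → Ω → ℝ} {B v : ℝ}
    (hB : 0 ≤ B) (hv : 0 ≤ v) (hYm : ∀ j, Measurable (Y j)) (hYB : ∀ j ω, |Y j ω| ≤ B)
    (hprod : ∀ (s : Finset G) (a : G → ℝ),
      ∫ ω, ∏ j ∈ s, (1 + Complex.I * ((a j * Y j ω : ℝ) : ℂ)) ∂P = 1)
    {γ : G → ℝ} (hγ : ∀ i j, ∫ ω, (Y i ω ^ 2 - v) * (Y j ω ^ 2 - v) ∂P = γ (j - i))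
    (hγ0 : Tendsto γ cofinite (𝓝 0)) {K e : ℝ} (hK : 0 ≤ K) (he : 0 < e) :
    ∃ δ > 0, ∀ (s : Finset G) (b : G → ℝ), (∀ j ∈ s, |b j| ≤ δ) → ∑ j ∈ s, b j ^ 2 ≤ K →
      ‖∫ ω, Complex.exp (Complex.I * ((∑ j ∈ s, b j * Y j ω : ℝ) : ℂ)) ∂P -
        (Real.exp (-(v * (∑ j ∈ s, b j ^ 2) / 2)) : ℂ)‖ ≤ e := by
  set A := Real.exp (B ^ 2 * K / 2) with hA
  have hA0 : 0 < A := Real.exp_pos _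
  -- An `L¹` error of at most `2 r` is allowed for the weighted squares; half of `e` is left for the
  -- third-order term.
  obtain ⟨r, hr, hrA⟩ : ∃ r > 0, A * (2 * r) = e / 2 :=
    ⟨e / (4 * A), by positivity, by field_simp; ring⟩
  -- The bound `K (η K + δ S)` on the second moment is split into two halves of `r²`. The `+ 1` here
  -- and in `δ` keeps denominators positive when `K = 0`.
  obtain ⟨η, hη, hηK⟩ : ∃ η > 0, η * (K ^ 2 + 1) = r ^ 2 / 2 :=
    ⟨r ^ 2 / 2 / (K ^ 2 + 1), by positivity, by field_simp⟩
  have hfin : {k | ¬ |γ k| ≤ η}.Finite := by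
    have : ∀ᶠ k in cofinite, |γ k| < η := by
      have := hγ0.abs
      rw [abs_zero] at this
      exact this.eventually (gt_mem_nhds hη)
    exact (this.mono fun k hk => hk.le)
  set F := hfin.toFinset with hFdef
  have hF : ∀ k ∉ F, |γ k| ≤ η := fun k hk => by
    by_contra h
    exact hk (hfin.mem_toFinset.2 h)
  set S := ∑ k ∈ F, |γ k|
  have hS : 0 ≤ S := Finset.sum_nonneg fun _ _ => abs_nonneg _
  refine ⟨min 1 (min (e / (4 * (B ^ 3 * K + 1))) (r ^ 2 / (2 * (K * S + 1)))),
    by positivity, fun s b hbδ hbK => ?_⟩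
  set δ := min 1 (min (e / (4 * (B ^ 3 * K + 1))) (r ^ 2 / (2 * (K * S + 1)))) with hδdef
  have hδ0 : 0 < δ := by positivity
  have hδ1 : δ ≤ 1 := min_le_left _ _
  have hδ2 : δ * (4 * (B ^ 3 * K + 1)) ≤ e := by
    rw [← le_div_iff₀ (by positivity)]
    exact (min_le_right _ _).trans (min_le_left _ _)
  have hδ3 : δ * (2 * (K * S + 1)) ≤ r ^ 2 := by
    rw [← le_div_iff₀ (by positivity)]
    exact (min_le_right _ _).trans (min_le_right _ _)
  have hsum0 : 0 ≤ ∑ j ∈ s, b j ^ 2 := Finset.sum_nonneg fun _ _ => sq_nonneg _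
  refine (norm_integral_exp_sub_le hB hYm hYB hprod s b (mul_nonneg hv hsum0) hδ0.le hbδ
    hbK).trans ?_
  let f : Ω → ℝ := fun ω => ∑ j ∈ s, b j ^ 2 * (Y j ω ^ 2 - v)
  have hf : ∀ ω, ∑ j ∈ s, (b j * Y j ω) ^ 2 - v * ∑ j ∈ s, b j ^ 2 = f ω := fun ω => by
    simp only [f, mul_sub, Finset.sum_sub_distrib, mul_pow, Finset.sum_mul, mul_comm v]
  simp only [hf]
  have hWm : ∀ j, Measurable fun ω => Y j ω ^ 2 - v := fun j => ((hYm j).pow_const 2).sub_const v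
  have hWB : ∀ j ω, |Y j ω ^ 2 - v| ≤ B ^ 2 + v := fun j ω => by
    refine (abs_sub _ _).trans ?_
    rw [abs_of_nonneg (sq_nonneg _), abs_of_nonneg hv]
    exact add_le_add_left (sq_le_sq.2 ((hYB j ω).trans (le_abs_self _))) _
  have hfi : Integrable f P := integrable_finsetSum _ fun j _ =>
    (Integrable.of_bound (hWm j).aestronglyMeasurable _ (ae_of_all _ (hWB j))).const_mul _
  have hWWi : ∀ i j, Integrable (fun ω => (Y i ω ^ 2 - v) * (Y j ω ^ 2 - v)) P := fun i j =>
    (Integrable.of_bound (hWm j).aestronglyMeasurable _ (ae_of_all _ (hWB j))).bdd_mul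
      (hWm i).aestronglyMeasurable (ae_of_all _ (hWB i))
  have hfsq : ∀ ω, f ω ^ 2 = ∑ i ∈ s, ∑ j ∈ s, b i ^ 2 * b j ^ 2 *
      ((Y i ω ^ 2 - v) * (Y j ω ^ 2 - v)) := fun ω => by
    rw [sq, Finset.sum_mul_sum]
    exact Finset.sum_congr rfl fun i _ => Finset.sum_congr rfl fun j _ => by ring
  have hf2i : Integrable (fun ω => f ω ^ 2) P := by
    simp only [hfsq]
    exact integrable_finsetSum _ fun i _ => integrable_finsetSum _ fun j _ =>
      (hWWi i j).const_mul _
  have hf2 : ∫ ω, f ω ^ 2 ∂P ≤ r ^ 2 := by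
    simp only [hfsq]
    rw [integral_finsetSum _ fun i _ => integrable_finsetSum _ fun j _ =>
      (hWWi i j).const_mul _]
    simp only [integral_finsetSum s fun j _ => (hWWi _ j).const_mul _, integral_const_mul, hγ]
    refine (sum_sum_mul_le hη.le hδ0.le F hF s (w := fun j => b j ^ 2) (δ := δ)
      (fun j => sq_nonneg _) (fun j hj => ?_) hbK).trans ?_
    -- As `δ ≤ 1`, the squared weights are at most `δ² ≤ δ`.
    · have := pow_le_pow_left₀ (abs_nonneg _) (hbδ j hj) 2
      rw [sq_abs] at this
      nlinarith
    · change K * (η * K + δ * S) ≤ r ^ 2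
      nlinarith
  have habs := integral_abs_le_add_div hfi hf2i hr
  have hdiv : (∫ ω, f ω ^ 2 ∂P) / r ≤ r := by
    rw [div_le_iff₀ hr]; nlinarith
  have h1 : A * ∫ ω, |f ω| ∂P ≤ A * (2 * r) :=
    mul_le_mul_of_nonneg_left (by linarith) hA0.le
  have h2 : 2 * (B ^ 3 * δ * K) ≤ e / 2 := by nlinarith
  linarith

end Approximation

/-! ### Square summable series and convergence to the Gaussian law. -/

section SquareSummable

variable {Ω : Type*} [MeasurableSpace Ω] {P : Measure Ω}

lemma IsL2Sum.congr {ι : Type*} {f g : ι → Ω → ℝ} {T : Ω → ℝ} (h : IsL2Sum P f T)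
    (hfg : ∀ j, f j =ᵐ[P] g j) : IsL2Sum P g T := by
  refine ⟨h.1, h.2.congr fun s => eLpNorm_congr_ae ?_⟩
  have : ∀ᵐ ω ∂P, ∀ j ∈ s, f j ω = g j ω := (s.eventually_all).2 fun j _ => hfg j
  filter_upwards [this] with ω hω
  rw [Finset.sum_congr rfl hω]

lemma hasSum_sq {ι : Type*} (c : lp (fun _ : ι => ℝ) 2) :
    HasSum (fun j => c j ^ 2) (‖c‖ ^ 2) := by
  have h := lp.hasSum_norm (p := 2) (by norm_num) c
  simpa using h

/-- A square summable combination of a bounded orthogonal family converges in `L²`. -/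
theorem exists_isL2Sum [IsProbabilityMeasure P] {ι : Type*} {Y : ι → Ω → ℝ} {B : ℝ}
    (hYm : ∀ j, Measurable (Y j)) (hYB : ∀ j ω, |Y j ω| ≤ B)
    (horth : ∀ i j, i ≠ j → ∫ ω, Y i ω * Y j ω ∂P = 0) (c : lp (fun _ : ι => ℝ) 2) :
    ∃ T, IsL2Sum P (fun j ω => c j * Y j ω) T := by
  have hmem : ∀ j, MemLp (fun ω => c j * Y j ω) 2 P := fun j =>
    MemLp.of_bound ((hYm j).const_mul _).aestronglyMeasurable (|c j| * B) (ae_of_all _ fun ω => by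
      rw [norm_mul]; exact mul_le_mul_of_nonneg_left (hYB j ω) (abs_nonneg _))
  let y : ι → Lp ℝ 2 P := fun j => (hmem j).toLp _
  have hinner : ∀ i j, i ≠ j → inner ℝ (y i) (y j) = 0 := fun i j hij => by
    rw [L2.inner_def]
    have : (fun ω => inner ℝ (y i ω) (y j ω)) =ᵐ[P] fun ω => c i * c j * (Y i ω * Y j ω) := by
      filter_upwards [(hmem i).coeFn_toLp, (hmem j).coeFn_toLp] with ω h1 h2
      simp only [y, h1, h2]
      rw [RCLike.inner_apply, conj_trivial]
      ring
    rw [integral_congr_ae this, integral_const_mul, horth i j hij, mul_zero]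
  -- Vectors that may vanish cannot be normalized; passing to the lines they span avoids this.
  have hof : OrthogonalFamily ℝ (fun j => Submodule.span ℝ {y j})
      fun j => (Submodule.span ℝ {y j}).subtypeₗᵢ := by
    refine OrthogonalFamily.of_pairwise fun i j hij => ?_
    change Submodule.span ℝ {y i} ⟂ Submodule.span ℝ {y j}
    rw [Submodule.isOrtho_span]
    rintro _ rfl _ rfl
    exact hinner i j hij
  have hnorm : ∀ j, ‖y j‖ ^ 2 ≤ B ^ 2 * c j ^ 2 := fun j => by
    have h1 : ‖y j‖ ^ 2 = ∫ ω, c j ^ 2 * Y j ω ^ 2 ∂P := by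
      rw [← real_inner_self_eq_norm_sq, L2.inner_def]
      refine integral_congr_ae ?_
      filter_upwards [(hmem j).coeFn_toLp] with ω h1
      simp only [y, h1]
      rw [RCLike.inner_apply, conj_trivial]
      ring
    rw [h1, integral_const_mul, mul_comm]
    refine mul_le_mul_of_nonneg_right ?_ (sq_nonneg _)
    have := norm_integral_le_of_norm_le_const (μ := P) (f := fun ω => Y j ω ^ 2) (C := B ^ 2)
      (ae_of_all _ fun ω => by
        rw [norm_pow]; exact pow_le_pow_left₀ (norm_nonneg _) (hYB j ω) 2)
    exact (le_abs_self _).trans (by simpa using this)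
  have hsum : Summable y := by
    have := (hof.summable_iff_norm_sq_summable
      (fun j => ⟨y j, Submodule.mem_span_singleton_self _⟩)).2
      (Summable.of_nonneg_of_le (fun j => sq_nonneg _) (fun j => hnorm j)
        ((hasSum_sq c).summable.mul_left _))
    exact this
  refine ⟨(∑' j, y j : Lp ℝ 2 P), Lp.memLp _, ?_⟩
  have h := (Lp.tendsto_Lp_iff_tendsto_eLpNorm' _ _).1 hsum.hasSum
  refine h.congr fun s => eLpNorm_congr_ae ?_
  have h2 : ∀ᵐ ω ∂P, ∀ j ∈ s, y j ω = c j * Y j ω :=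
    (s.eventually_all).2 fun j _ => (hmem j).coeFn_toLp
  filter_upwards [h2, Lp.coeFn_fun_finsetSum s y] with ω h2 h3
  rw [Pi.sub_apply, h3, Finset.sum_congr rfl h2]

lemma norm_exp_I_mul_sub_le (x y : ℝ) :
    ‖Complex.exp (Complex.I * x) - Complex.exp (Complex.I * y)‖ ≤ |x - y| := by
  have e : Complex.exp (Complex.I * x) - Complex.exp (Complex.I * y) =
      Complex.exp (Complex.I * y) * (Complex.exp (Complex.I * ((x - y : ℝ) : ℂ)) - 1) := by
    rw [mul_sub, ← Complex.exp_add, mul_one]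
    push_cast
    ring_nf
  rw [e, norm_mul, mul_comm Complex.I (y : ℂ), Complex.norm_exp_ofReal_mul_I, one_mul]
  exact Real.norm_exp_I_mul_ofReal_sub_one_le

lemma tendsto_integral_exp_of_eLpNorm [IsProbabilityMeasure P] {κ : Type*} {l : Filter κ}
    {S : κ → Ω → ℝ} {T : Ω → ℝ} (hS : ∀ k, MemLp (S k) 2 P) (hT : MemLp T 2 P)
    (h : Tendsto (fun k => eLpNorm (fun ω => S k ω - T ω) 2 P) l (𝓝 0)) (θ : ℝ) :
    Tendsto (fun k => ∫ ω, Complex.exp (Complex.I * ((θ * S k ω : ℝ) : ℂ)) ∂P) l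
      (𝓝 (∫ ω, Complex.exp (Complex.I * ((θ * T ω : ℝ) : ℂ)) ∂P)) := by
  have hintegrable : ∀ {U : Ω → ℝ}, MemLp U 2 P →
      Integrable (fun ω => Complex.exp (Complex.I * ((θ * U ω : ℝ) : ℂ))) P := fun {U} hU => by
    refine Integrable.of_bound (Complex.measurable_exp.comp_aemeasurable
      ((Complex.measurable_ofReal.comp_aemeasurable
        (hU.aestronglyMeasurable.aemeasurable.const_mul θ)).const_mul _)).aestronglyMeasurable 1
      (ae_of_all _ fun ω => ?_)
    rw [mul_comm, Complex.norm_exp_ofReal_mul_I]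
  rw [tendsto_iff_norm_sub_tendsto_zero]
  have h0 : Tendsto (fun k => |θ| * (eLpNorm (fun ω => S k ω - T ω) 2 P).toReal) l (𝓝 0) := by
    have := ((ENNReal.tendsto_toReal ENNReal.zero_ne_top).comp h).const_mul |θ|
    simpa using this
  refine squeeze_zero (fun _ => norm_nonneg _) (fun k => ?_) h0
  have hmem : MemLp (fun ω => S k ω - T ω) 2 P := (hS k).sub hT
  have hi : Integrable (fun ω => S k ω - T ω) P := hmem.integrable (by norm_num)
  rw [← integral_sub (hintegrable (hS k)) (hintegrable hT)]
  calc _ ≤ ∫ ω, |θ| * ‖S k ω - T ω‖ ∂P := by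
        refine norm_integral_le_of_norm_le (hi.norm.const_mul _) (ae_of_all _ fun ω => ?_)
        refine (norm_exp_I_mul_sub_le _ _).trans (le_of_eq ?_)
        rw [← mul_sub, abs_mul, Real.norm_eq_abs]
    _ ≤ _ := by
        rw [integral_const_mul, integral_norm_eq_lintegral_enorm hi.aestronglyMeasurable,
          ← eLpNorm_one_eq_lintegral_enorm]
        refine mul_le_mul_of_nonneg_left (ENNReal.toReal_mono hmem.2.ne ?_) (abs_nonneg _)
        exact eLpNorm_le_eLpNorm_of_exponent_le (by norm_num) hi.aestronglyMeasurable

/-- A central limit theorem for weighted sums of a bounded family indexed by a group, such that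
the products of the factors `1 + i a_j Y_j` have mean one and the covariances of the squares are
stationary and vanish at infinity. -/
theorem tendsto_charFun_of_isL2Sum [IsProbabilityMeasure P] {G : Type*} [AddCommGroup G]
    {Y : G → Ω → ℝ} {B v : ℝ}
    (hB : 0 ≤ B) (hv : 0 ≤ v) (hYm : ∀ j, Measurable (Y j)) (hYB : ∀ j ω, |Y j ω| ≤ B)
    (hprod : ∀ (s : Finset G) (a : G → ℝ),
      ∫ ω, ∏ j ∈ s, (1 + Complex.I * ((a j * Y j ω : ℝ) : ℂ)) ∂P = 1)
    {γ : G → ℝ} (hγ : ∀ i j, ∫ ω, (Y i ω ^ 2 - v) * (Y j ω ^ 2 - v) ∂P = γ (j - i))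
    (hγ0 : Tendsto γ cofinite (𝓝 0))
    {c : ℕ → lp (fun _ : G => ℝ) 2} (hc0 : ∀ n, c n ≠ 0)
    (hc : Tendsto (fun n => ⨆ j, |c n j| / ‖c n‖) atTop (𝓝 0)) {T : ℕ → Ω → ℝ}
    (hT : ∀ n, IsL2Sum P (fun j ω => c n j * Y j ω) (T n)) (t : ℝ) :
    Tendsto (fun n => ∫ ω, Complex.exp (Complex.I * ((t * (1 / ‖c n‖ * T n ω) : ℝ) : ℂ)) ∂P) atTop
      (𝓝 (Real.exp (-(v * t ^ 2 / 2)) : ℂ)) := by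
  rw [Metric.tendsto_nhds]
  intro e he
  obtain ⟨δ, hδ, hbound⟩ := exists_norm_integral_exp_sub_le hB hv hYm hYB hprod hγ hγ0
    (sq_nonneg t) (half_pos he)
  have hev : ∀ᶠ n in atTop, |t| * ⨆ j, |c n j| / ‖c n‖ < δ := by
    have := hc.const_mul |t|
    rw [mul_zero] at this
    exact this.eventually (gt_mem_nhds hδ)
  filter_upwards [hev] with n hn
  have hcn : 0 < ‖c n‖ := norm_pos_iff.2 (hc0 n)
  -- Normalized weights with `∑ b_j² = t²`, which is why `K = t²` was fixed above.
  let b : G → ℝ := fun j => t * (1 / ‖c n‖) * c n j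
  -- Boundedness makes the real supremum genuine instead of the default `0`.
  have hbdd : BddAbove (Set.range fun j => |c n j| / ‖c n‖) :=
    ⟨1, by
      rintro _ ⟨j, rfl⟩
      exact (div_le_one hcn).2 (lp.norm_apply_le_norm (by norm_num) (c n) j)⟩
  have hbδ : ∀ j, |b j| ≤ δ := fun j => by
    have h1 : |b j| = |t| * (|c n j| / ‖c n‖) := by
      simp only [b]
      rw [abs_mul, abs_mul, abs_of_pos (one_div_pos.2 hcn)]
      ring
    rw [h1]
    exact (mul_le_mul_of_nonneg_left (le_ciSup hbdd j) (abs_nonneg _)).trans hn.le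
  have hbsum : HasSum (fun j => b j ^ 2) (t ^ 2) := by
    have h1 := (hasSum_sq (c n)).mul_left ((t * (1 / ‖c n‖)) ^ 2)
    have h2 : (t * (1 / ‖c n‖)) ^ 2 * ‖c n‖ ^ 2 = t ^ 2 := by field_simp
    rw [h2] at h1
    simpa only [b, mul_pow] using h1
  have hs : ∀ s : Finset G, ‖∫ ω, Complex.exp (Complex.I *
      ((t * (1 / ‖c n‖) * ∑ j ∈ s, c n j * Y j ω : ℝ) : ℂ)) ∂P -
      (Real.exp (-(v * (∑ j ∈ s, b j ^ 2) / 2)) : ℂ)‖ ≤ e / 2 := fun s => by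
    have h1 := hbound s b (fun j _ => hbδ j) (sum_le_hasSum s (fun _ _ => sq_nonneg _) hbsum)
    have h2 : ∀ ω, t * (1 / ‖c n‖) * ∑ j ∈ s, c n j * Y j ω = ∑ j ∈ s, b j * Y j ω := fun ω => by
      rw [Finset.mul_sum]
      exact Finset.sum_congr rfl fun j _ => by simp only [b]; ring
    simpa only [h2] using h1
  have hmemS : ∀ s : Finset G, MemLp (fun ω => ∑ j ∈ s, c n j * Y j ω) 2 P := fun s =>
    memLp_finsetSum s fun j _ => (MemLp.of_bound (hYm j).aestronglyMeasurable B
      (ae_of_all _ (hYB j))).const_mul (c n j)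
  have hlim1 := tendsto_integral_exp_of_eLpNorm hmemS (hT n).1 (hT n).2 (t * (1 / ‖c n‖))
  have hlim2 : Tendsto (fun s : Finset G => (Real.exp (-(v * (∑ j ∈ s, b j ^ 2) / 2)) : ℂ)) atTop
      (𝓝 (Real.exp (-(v * t ^ 2 / 2)) : ℂ)) :=
    (Complex.continuous_ofReal.tendsto _).comp ((Real.continuous_exp.tendsto _).comp
      ((Tendsto.const_mul v hbsum).div_const 2).neg)
  have hle := le_of_tendsto (hlim1.sub hlim2).norm (Eventually.of_forall hs)
  rw [dist_eq_norm]
  simp only [← mul_assoc] at hle ⊢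
  linarith

/-- Convergence to a centred Gaussian law from convergence of the characteristic functions. -/
lemma tendstoInDistribution_gaussianReal [IsProbabilityMeasure P] {U : ℕ → Ω → ℝ}
    (hU : ∀ n, AEMeasurable (U n) P) {v : ℝ} (hv : 0 ≤ v)
    (h : ∀ t : ℝ, Tendsto (fun n => ∫ ω, Complex.exp (Complex.I * ((t * U n ω : ℝ) : ℂ)) ∂P) atTop
      (𝓝 (Real.exp (-(v * t ^ 2 / 2)) : ℂ))) :
    TendstoInDistribution U atTop id (fun _ => P) (gaussianReal 0 v.toNNReal) := by
  refine ⟨hU, aemeasurable_id, ?_⟩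
  refine ProbabilityMeasure.tendsto_iff_tendsto_charFun.2 fun t => ?_
  have e1 : charFun ((gaussianReal 0 v.toNNReal).map id) t =
      (Real.exp (-(v * t ^ 2 / 2)) : ℂ) := by
    rw [Measure.map_id, charFun_gaussianReal, Real.coe_toNNReal v hv]
    push_cast
    congr 1
    ring
  have e2 : ∀ n, charFun (P.map (U n)) t =
      ∫ ω, Complex.exp (Complex.I * ((t * U n ω : ℝ) : ℂ)) ∂P := fun n => by
    rw [charFun_apply_real, integral_map (hU n) (by fun_prop)]
    congr 1 with ω
    push_cast
    ring_nf
  change Tendsto (fun n => charFun (P.map (U n)) t) atTop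
    (𝓝 (charFun ((gaussianReal 0 v.toNNReal).map id) t))
  rw [e1]
  simpa only [e2] using h t

end SquareSummable

/-! ### Regular modifications and the sum over `ℕ^d`. -/

section Reduction

variable {d : ℕ} {μ : Measure (Site d)} {p : ℝ} {Ω : Type*} [MeasurableSpace Ω] {P : Measure Ω}
  {Z : Site d → Ω → Site d} {ε : ℕ → Ω → ℝ} {N : (Site d → Site d) → Site d → ℕ}

open scoped Classical in
/-- Every environment has a regular modification. -/
lemma IsEnvironment.exists_isRegularEnvironment (henv : IsEnvironment P μ p Z ε)
    (hμ : IsStepLaw μ) :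
    ∃ (Z' : Site d → Ω → Site d) (ε' : ℕ → Ω → ℝ), IsRegularEnvironment P μ p Z' ε' ∧
      (∀ n, Z' n =ᵐ[P] Z n) ∧ ∀ i, ε' i =ᵐ[P] ε i := by
  let φ : Site d → Site d := fun z => if ∀ i, 0 < z i then z else 1
  let ψ : ℝ → ℝ := fun x => if x = 1 ∨ x = -1 then x else 1
  have hφ : Measurable φ := measurable_of_countable _
  have hψ : Measurable ψ := Measurable.ite
    ((measurableSet_singleton (1 : ℝ)).union (measurableSet_singleton (-1 : ℝ)))
    measurable_id measurable_const
  have hφμ : ∀ᵐ z ∂μ, φ z = z := hμ.pos.mono fun z hz => if_pos hz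
  have hψ1 : ∀ i, ∀ᵐ x ∂(P.map (ε i)), ψ x = x := fun i => by
    have hm : MeasurableSet {x | ψ x = x} := measurableSet_eq_fun hψ measurable_id
    rw [henv.law_sign, ae_add_measure_iff]
    exact ⟨Measure.ae_smul_measure ((ae_dirac_iff hm).2 (by simp [ψ])) _,
      Measure.ae_smul_measure ((ae_dirac_iff hm).2 (by simp [ψ])) _⟩
  have hlawZ : ∀ n, P.map (φ ∘ Z n) = μ := fun n => by
    rw [← Measure.map_map hφ (henv.measurable_edge n), henv.law_edge,
      Measure.map_congr (g := id) hφμ, Measure.map_id]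
  refine ⟨fun n => φ ∘ Z n, fun i => ψ ∘ ε i, ?_, fun n => ?_, fun i => ?_⟩
  · refine { measurable_edge := fun n => hφ.comp (henv.measurable_edge n)
             law_edge := hlawZ
             indep_edge := henv.indep_edge.comp (fun _ => φ) fun _ => hφ
             measurable_sign := fun i => hψ.comp (henv.measurable_sign i)
             law_sign := fun i => ?_
             indep_sign := henv.indep_sign.comp (fun _ => ψ) fun _ => hψ
             indep := ?_
             pos := fun n ω i => ?_
             sign := fun i ω => ?_ }
    · rw [← Measure.map_map hψ (henv.measurable_sign i), Measure.map_congr (g := id) (hψ1 i),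
        Measure.map_id, henv.law_sign]
    · have h1 : Measurable fun (z : Site d → Site d) n => φ (z n) :=
        measurable_pi_lambda _ fun n => hφ.comp (measurable_pi_apply n)
      have h2 : Measurable fun (e : ℕ → ℝ) i => ψ (e i) :=
        measurable_pi_lambda _ fun i => hψ.comp (measurable_pi_apply i)
      exact henv.indep.comp h1 h2
    · simp only [φ, Function.comp_apply]
      split_ifs with h
      · exact h i
      · exact zero_lt_one
    · simp only [ψ, Function.comp_apply]
      split_ifs with h
      · exact h
      · exact Or.inl rfl
  · have := hφμ
    rw [← henv.law_edge n] at this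
    exact ae_of_ae_map (henv.measurable_edge n).aemeasurable this
  · exact ae_of_ae_map (henv.measurable_sign i).aemeasurable (hψ1 i)

lemma field_ae_eq {Z' : Site d → Ω → Site d} {ε' : ℕ → Ω → ℝ} (hZ : ∀ n, Z' n =ᵐ[P] Z n)
    (hε : ∀ i, ε' i =ᵐ[P] ε i) (k : Site d) : field N Z ε k =ᵐ[P] field N Z' ε' k := by
  have h1 : ∀ᵐ ω ∂P, ∀ n, Z' n ω = Z n ω := ae_all_iff.2 hZ
  have h2 : ∀ᵐ ω ∂P, ∀ i, ε' i ω = ε i ω := ae_all_iff.2 hε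
  filter_upwards [h1, h2] with ω h1 h2
  simp only [field, h1, h2]

lemma q_congr {Z' : Site d → Ω → Site d} (hZ : ∀ n, Z' n =ᵐ[P] Z n) (n : Site d) :
    q P Z n = q P Z' n := by
  have h1 : ∀ᵐ ω ∂P, ∀ n, Z' n ω = Z n ω := ae_all_iff.2 hZ
  refine measureReal_congr ?_
  filter_upwards [h1] with ω h1
  refine propext ?_
  change 0 ∈ ancestralLine (fun m => Z m ω) n ↔ 0 ∈ ancestralLine (fun m => Z' m ω) n
  simp only [h1]

/-- The Green function vanishes at sites with a negative coordinate, so the sum over `ℤ^d` is one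
over `ℕ^d`. -/
lemma hasSum_green_sq (hμ : IsStepLaw μ) (hg : ∑' n, green μ n ^ 2 ≠ ∞) :
    HasSum (fun k : Fin d → ℕ => (green μ fun i => (k i : ℤ)).toReal ^ 2)
      (∑' n, green μ n ^ 2).toReal := by
  have hfin : ∀ n, green μ n ^ 2 ≠ ∞ := ENNReal.ne_top_of_tsum_ne_top hg
  have h : HasSum (fun n : Site d => (green μ n).toReal ^ 2) (∑' n, green μ n ^ 2).toReal := by
    rw [ENNReal.tsum_toReal_eq hfin]
    simpa only [ENNReal.toReal_pow] using (ENNReal.summable_toReal hg).hasSum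
  have hinj : Function.Injective fun (k : Fin d → ℕ) i => (k i : ℤ) := fun a b hab => by
    funext i
    exact Int.ofNat_inj.1 (congrFun hab i)
  refine (hinj.hasSum_iff fun n hn => ?_).2 h
  have hneg : ∃ i, n i < 0 := by
    by_contra! hcon
    exact hn ⟨fun i => (n i).toNat, funext fun i => Int.toNat_of_nonneg (hcon i)⟩
  obtain ⟨i, hi⟩ := hneg
  rw [green_eq_zero hμ ⟨fun e => by simp [e] at hi, fun hpos => lt_asymm hi (hpos i)⟩]
  simp

variable [IsProbabilityMeasure P]

lemma IsRegularEnvironment.variance_field (henv : IsRegularEnvironment P μ p Z ε)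
    (hp : 0 < p ∧ p < 1) (hN : IsNumbering N) (k : Site d) :
    Var[field N Z ε k; P] = 1 - (2 * p - 1) ^ 2 := by
  have hmem : MemLp (field N Z ε k) 2 P :=
    MemLp.of_bound (henv.measurable_field hN k).aestronglyMeasurable 1
      (ae_of_all _ fun ω => (henv.abs_field k ω).le)
  have h1 : ∀ ω, (field N Z ε k ^ 2) ω = 1 := fun ω => by
    rw [Pi.pow_apply, sq]; exact henv.field_sq k ω
  rw [variance_eq_sub hmem, henv.integral_field hp hN]
  simp only [h1, integral_const, probReal_univ, smul_eq_mul, one_mul]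

end Reduction

end GraphField

/-! ### The main theorem. -/

theorem mainTheorem4 {d : ℕ} (hd : 1 ≤ d)
    -- the step law and its domain of attraction
    (μ : Measure (GraphField.Site d)) [IsProbabilityMeasure μ] (hμ : GraphField.IsStepLaw μ)
    (α : Fin d → ℝ) (hα : ∀ i, 0 < α i ∧ α i < 1) (hα1 : d = 1 → ∀ i, α i < 1 / 2)
    (ν : Measure (Fin d → ℝ)) [IsProbabilityMeasure ν] (hν : ∀ᵐ x ∂ν, ∀ i, 0 ≤ x i)
    (hfull : GraphField.IsFull ν) (hattr : GraphField.InStrictDomain μ α ν)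
    -- the random graph and the signs of its components
    (p : ℝ) (hp : 0 < p ∧ p < 1)
    {Ω : Type*} [MeasurableSpace Ω] (P : Measure Ω) [IsProbabilityMeasure P]
    (Z : GraphField.Site d → Ω → GraphField.Site d) (ε : ℕ → Ω → ℝ)
    (henv : GraphField.IsEnvironment P μ p Z ε)
    (N : (GraphField.Site d → GraphField.Site d) → GraphField.Site d → ℕ)
    (hN : GraphField.IsNumbering N)
    -- the field
    (X : GraphField.Site d → Ω → ℝ) (hX : X = GraphField.field N Z ε)
    -- the coefficients
    (c : ℕ → lp (fun _ : GraphField.Site d => ℝ) 2) (hc0 : ∀ n, c n ≠ 0)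
    (hc : Tendsto (fun n => ⨆ j, |c n j| / ‖c n‖) atTop (𝓝 0)) :
    (Summable fun k : Fin d → ℕ => GraphField.q P Z (fun i => (k i : ℤ)) ^ 2) ∧
    Var[GraphField.innovation P X 0; P] = GraphField.sigmaSq P Z X ∧
    (∀ n, ∃ T : Ω → ℝ,
      GraphField.IsL2Sum P (fun j ω => c n j * GraphField.innovation P X j ω) T) ∧
    ∀ T : ℕ → Ω → ℝ,
      (∀ n, GraphField.IsL2Sum P (fun j ω => c n j * GraphField.innovation P X j ω) (T n)) →
      TendstoInDistribution (fun n ω => (1 / ‖c n‖) * T n ω) atTop id (fun _ => P)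
        (gaussianReal 0 (GraphField.sigmaSq P Z X).toNNReal) := by
  open GraphField in
  obtain ⟨Z', ε', hreg, hZ, hε⟩ := henv.exists_isRegularEnvironment hμ
  have hg := tsum_green_sq_ne_top hd hμ.aperiodic hα hα1 hfull hattr
  have hq : ∀ k : Fin d → ℕ, q P Z (fun i => (k i : ℤ)) ^ 2 =
      (green μ fun i => (k i : ℤ)).toReal ^ 2 := fun k => by
    rw [q_congr hZ, hreg.q_eq_green hμ hd hreg.pos]
  have hsum := hasSum_green_sq hμ hg
  have hXX : ∀ k, X k =ᵐ[P] field N Z' ε' k := fun k => by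
    rw [hX]; exact field_ae_eq hZ hε k
  have hXm : ∀ k, Measurable (X k) := fun k => by rw [hX]; exact henv.measurable_field hN k
  set Y := innov μ (field N Z' ε') with hY
  have hinn : ∀ j, innovation P X j =ᵐ[P] Y j := hreg.innovation_ae_eq hμ hd hN hXm hXX
  have hYm : ∀ j, Measurable (Y j) := hreg.measurable_innov hN
  have hYB : ∀ j ω, |Y j ω| ≤ 2 := hreg.abs_innov_le
  set v := (1 - (2 * p - 1) ^ 2) / (∑' n, green μ n ^ 2).toReal with hvdef
  have hσ : sigmaSq P Z X = v := by
    simp only [sigmaSq, hq]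
    rw [hsum.tsum_eq, variance_congr (hXX 0), hreg.variance_field hp hN]
  have hYv : ∀ k, ∫ ω, Y k ω ^ 2 ∂P = v := hreg.integral_innov_sq hp hμ hd hN hg
  have hv : 0 ≤ v := by
    rw [← hYv 0]; exact integral_nonneg fun ω => sq_nonneg _
  have hT : ∀ {n T}, IsL2Sum P (fun j ω => c n j * innovation P X j ω) T →
      IsL2Sum P (fun j ω => c n j * Y j ω) T := fun h => h.congr fun j => by
    filter_upwards [hinn j] with ω hω
    rw [hω]
  refine ⟨?_, ?_, fun n => ?_, fun T hTn => ?_⟩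
  · simp only [hq]; exact hsum.summable
  · have hmem : MemLp (Y 0) 2 P :=
      MemLp.of_bound (hYm 0).aestronglyMeasurable 2 (ae_of_all _ (hYB 0))
    rw [variance_congr (hinn 0), variance_eq_sub hmem, hreg.integral_innov hμ hd hN, hσ, ← hYv 0]
    simp
  · obtain ⟨T, hT⟩ := exists_isL2Sum hYm hYB
      (fun i j hij => hreg.integral_innov_mul hμ hd hN hij) (c n)
    refine ⟨T, hT.congr fun j => ?_⟩
    filter_upwards [hinn j] with ω hω
    rw [hω]
  · rw [hσ]
    refine tendstoInDistribution_gaussianReal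
      (fun n => (hTn n).1.aestronglyMeasurable.aemeasurable.const_mul _) hv fun t => ?_
    -- By stationarity the covariance of `Y_i²` and `Y_j²` depends only on `j - i`; `γ` is its value
    -- with the first site at the origin.
    refine tendsto_charFun_of_isL2Sum (by norm_num) hv hYm hYB
      (hreg.integral_prod_one_add hμ hd hN)
      (γ := fun k => ∫ ω, (Y 0 ω ^ 2 - v) * (Y k ω ^ 2 - v) ∂P) (fun i j => ?_) ?_ hc0 hc
      (fun n => hT (hTn n)) t
    · have := hreg.integral_innov_shift hN i 0 (j - i)
        (φ := fun x y => (x ^ 2 - v) * (y ^ 2 - v)) (by unfold Function.uncurry; fun_prop)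
      rw [zero_add, sub_add_cancel] at this
      exact this
    · have := hreg.tendsto_cov_innov_sq hp hμ hd hN hg
      simpa only [covariance, ← hY, hYv] using this
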